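/- Let $D\subset\mathbb{C}^N$ be a bounded open set, equipped with Lebesgue measure. The Bergman projection $P_D$ is the orthogonal projection of $L^2(D)$ onto its closed subspace $A^2(D)$ of holomorphic square-integrable functions. For $1\le p<\infty$ we say that $P_D$ is bounded on $L^p(D)$ if there is a constant $C$ such that for all $f\in L^p(D)\cap L^2(D)$ one has $P_Df\in L^p(D)$ and $\|P_Df\|_{L^p(D)}\le C\|f\|_{L^p(D)}$; otherwise $P_D$ is unbounded on $L^p(D)$. Write $|\cdot|$ for the Euclidean norm. Theorem 1.2. Let $1\le k<n$, and let $$\mathbb{H}^n_k=\{z\in\mathbb{C}^n:\ |(z_1,\dots,z_k)|<|z_{k+1}|<\cdots<|z_n|<1\}.$$ Then $P_{\mathbb{H}^n_k}$ is bounded on $L^p(\mathbb{H}^n_k)$ when $\frac{2n}{n+1}<p<\frac{2n}{n-1}$, and it is unbounded on $L^p(\mathbb{H}^n_k)$ when $1\le p\le\frac{2n}{n+1}$. The same conclusion holds for the standard model: let $l\ge1$, let $k_1,\dots,k_l\ge1$ be integers with $k=k_1+\cdots+k_l<n$, put $m_j=k_1+\cdots+k_j$ (with $m_0=0$) and $\tilde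 z_j=(z_{m_{j-1}+1},\dots,z_{m_j})$, and let $$\mathbb{H}^n_{\{k_j\}}=\{z\in\mathbb{C}^n:\ \max_{1\le j\le l}|\tilde z_j|<|z_{k+1}|<\cdots<|z_n|<1\}.$$ Then $P_{\mathbb{H}^n_{\{k_j\}}}$ is bounded on $L^p(\mathbb{H}^n_{\{k_j\}})$ when $\frac{2n}{n+1}<p<\frac{2n}{n-1}$, and it is unbounded on $L^p(\mathbb{H}^n_{\{k_j\}})$ when $1\le p\le\frac{2n}{n+1}$. -/

import Mathlib

namespace HartogsBergman

section

open MeasureTheory Metric Filter Topology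


/-- Rotating the polydisc about its centre preserves Lebesgue measure. -/
lemma measurePreserving_rot {n : ℕ} (a : Fin n → ℂ) (c : Circle) :
    MeasurePreserving (fun w : Fin n → ℂ ↦ a + (c : ℂ) • (w - a)) := by
  have h1 : MeasurePreserving (fun w : Fin n → ℂ ↦ fun i ↦ rotation c (w i)) :=
    volume_preserving_pi (fun i ↦ (rotation c).measurePreserving)
  have h2 := (measurePreserving_add_left volume a).comp
    (h1.comp (measurePreserving_sub_right volume a))
  exact h2

/-- Mean value property of holomorphic functions on closed polydiscs
(closed balls of the sup norm on `Fin n → ℂ`). -/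
lemma setIntegral_closedBall {n : ℕ} {F : (Fin n → ℂ) → ℂ} {U : Set (Fin n → ℂ)}
    (hF : DifferentiableOn ℂ F U) {a : Fin n → ℂ} {r : ℝ}
    (hr : closedBall a r ⊆ U) :
    ∫ w in closedBall a r, F w = (volume.real (closedBall a r) : ℂ) * F a := by
  have hrot : ∀ θ : ℝ, ∫ w in closedBall a r, F (a + circleMap 0 1 θ • (w - a)) =
      ∫ w in closedBall a r, F w := by
    intro θ
    have hc : circleMap 0 1 θ = (Circle.exp θ : ℂ) := by simp [circleMap]
    have hp := measurePreserving_rot a (Circle.exp θ)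
    have hpre : (fun w : Fin n → ℂ ↦ a + (Circle.exp θ : ℂ) • (w - a)) ⁻¹' closedBall a r =
        closedBall a r := by
      ext w
      simp [dist_eq_norm, norm_smul]
    have hs := hp.restrict_preimage (s := closedBall a r) measurableSet_closedBall
    rw [hpre] at hs
    rw [hc]
    refine hs.integral_comp (Continuous.measurableEmbedding (by fun_prop) ?_) F
    intro x y hxy
    have h0 : (Circle.exp θ : ℂ) ≠ 0 := Circle.coe_ne_zero _
    have h1 := smul_right_injective (Fin n → ℂ) h0 (add_left_cancel hxy)
    exact sub_left_injective h1
  have hmv : ∀ w ∈ closedBall a r, Real.circleAverage (fun c : ℂ ↦ F (a + c • (w - a))) 0 1 = F a := by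
    intro w hw
    have hmap : ∀ c ∈ closedBall (0 : ℂ) 1, a + c • (w - a) ∈ U := by
      intro c hc
      apply hr
      rw [mem_closedBall, dist_eq_norm] at *
      rw [add_sub_cancel_left, norm_smul]
      rw [sub_zero] at hc
      nlinarith [norm_nonneg (w - a), norm_nonneg c]
    have := DiffContOnCl.circleAverage (f := fun c : ℂ ↦ F (a + c • (w - a))) (c := 0) (R := 1) ?_
    · simpa using this
    · have hd : DifferentiableOn ℂ (fun c : ℂ ↦ F (a + c • (w - a))) (closedBall 0 1) :=
        hF.comp (by fun_prop) hmap
      apply DifferentiableOn.diffContOnCl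
      rw [abs_one]
      exact hd.mono closure_ball_subset_closedBall
  have hcont : ContinuousOn (fun p : ℝ × (Fin n → ℂ) ↦ F (a + circleMap 0 1 p.1 • (p.2 - a)))
      (Set.Icc 0 (2 * Real.pi) ×ˢ closedBall a r) := by
    apply hF.continuousOn.comp
    · fun_prop
    · rintro ⟨θ, w⟩ ⟨-, hw⟩
      apply hr
      simpa [dist_eq_norm, norm_smul] using hw
  have hint : Integrable (Function.uncurry fun (θ : ℝ) (w : Fin n → ℂ) ↦
      F (a + circleMap 0 1 θ • (w - a)))
      ((volume.restrict (Set.Ioc 0 (2 * Real.pi))).prod (volume.restrict (closedBall a r))) := by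
    rw [Measure.prod_restrict]
    refine (hcont.integrableOn_compact (isCompact_Icc.prod (isCompact_closedBall a r))).mono_set ?_
    refine Set.prod_mono ?_ subset_rfl
    exact Set.Ioc_subset_Icc_self
  have key := integral_integral_swap hint
  simp_rw [hrot] at key
  have h3 : ∫ w in closedBall a r, (∫ θ in Set.Ioc 0 (2 * Real.pi),
      F (a + circleMap 0 1 θ • (w - a))) = ∫ w in closedBall a r, (2 * Real.pi) • F a := by
    apply setIntegral_congr_fun measurableSet_closedBall
    intro w hw
    have := hmv w hw
    rw [Real.circleAverage, intervalIntegral.integral_of_le Real.two_pi_pos.le] at this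
    simp only
    rw [← this, smul_smul, mul_inv_cancel₀ Real.two_pi_pos.ne', one_smul]
  rw [h3, setIntegral_const, setIntegral_const, smul_comm, measureReal_def, Real.volume_Ioc,
    sub_zero, ENNReal.toReal_ofReal Real.two_pi_pos.le] at key
  have := smul_right_injective ℂ Real.two_pi_pos.ne' key
  rw [this, Complex.real_smul]

/-- The Bergman space `A²(D)`: the subspace of `L²(D)` of (classes of) functions that are
holomorphic on the open set `D ⊆ ℂⁿ`. -/
noncomputable def bergmanSpace {n : ℕ} (D : TopologicalSpace.Opens (Fin n → ℂ)) :
    Submodule ℂ (Lp ℂ 2 (volume.restrict (D : Set (Fin n → ℂ)))) where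
  carrier := {f | ∃ F : (Fin n → ℂ) → ℂ, DifferentiableOn ℂ F D ∧
    f =ᵐ[volume.restrict (D : Set (Fin n → ℂ))] F}
  add_mem' := by
    rintro f g ⟨F, hF, hfF⟩ ⟨G, hG, hgG⟩
    exact ⟨F + G, hF.add hG, (Lp.coeFn_add f g).trans (hfF.add hgG)⟩
  zero_mem' := ⟨0, differentiableOn_const 0, Lp.coeFn_zero ℂ 2 _⟩
  smul_mem' := by
    rintro c f ⟨F, hF, hfF⟩
    exact ⟨c • F, hF.const_smul c, (Lp.coeFn_smul c f).trans (hfF.const_smul c)⟩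

/-- Point evaluations on the Bergman space are bounded, locally uniformly in the point. -/
lemma exists_bound {n : ℕ} (D : TopologicalSpace.Opens (Fin n → ℂ)) {r : ℝ} (hr : 0 < r) :
    ∃ C : ℝ, 0 ≤ C ∧ ∀ (f : Lp ℂ 2 (volume.restrict (D : Set (Fin n → ℂ)))) (F : (Fin n → ℂ) → ℂ),
      DifferentiableOn ℂ F D → f =ᵐ[volume.restrict (D : Set (Fin n → ℂ))] F →
      ∀ a, closedBall a r ⊆ (D : Set (Fin n → ℂ)) → ‖F a‖ ≤ C * ‖f‖ := by
  set v : ℝ := volume.real (closedBall (0 : Fin n → ℂ) r) with hv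
  have hv0 : 0 < v := by
    rw [hv, measureReal_def]
    exact ENNReal.toReal_pos (measure_closedBall_pos _ _ hr).ne' measure_closedBall_lt_top.ne
  set μ := volume.restrict (D : Set (Fin n → ℂ)) with hμ
  refine ⟨v⁻¹ * v ^ (1 / (2 : ℝ)), by positivity, fun f F hF hfF a ha ↦ ?_⟩
  have hres : μ.restrict (closedBall a r) = volume.restrict (closedBall a r) := by
    rw [hμ, Measure.restrict_restrict measurableSet_closedBall, Set.inter_eq_left.2 ha]
  have hm : μ (closedBall a r) = volume (closedBall (0 : Fin n → ℂ) r) := by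
    rw [hμ, Measure.restrict_apply measurableSet_closedBall, Set.inter_eq_left.2 ha,
      Measure.addHaar_closedBall_center]
  have hfin : μ (closedBall a r) ≠ ⊤ := by rw [hm]; exact measure_closedBall_lt_top.ne
  have hva : volume.real (closedBall a r) = v := by
    rw [hv, measureReal_def, measureReal_def, Measure.addHaar_closedBall_center]
  have h1 : ∫ w in closedBall a r, f w ∂μ = (v : ℂ) * F a := by
    rw [← hva, ← setIntegral_closedBall hF ha, ← hres]
    exact integral_congr_ae (ae_restrict_of_ae hfF)
  have h2 : ‖∫ w in closedBall a r, f w ∂μ‖ ≤ v ^ (1 / (2 : ℝ)) * ‖f‖ := by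
    rw [← L2.inner_indicatorConstLp_one (𝕜 := ℂ) measurableSet_closedBall hfin f]
    refine (norm_inner_le_norm _ _).trans ?_
    rw [norm_indicatorConstLp (by simp) (by simp), norm_one, one_mul, measureReal_def, hm]
    simp [hv, measureReal_def]
  rw [h1, norm_mul, Complex.norm_real, Real.norm_of_nonneg hv0.le] at h2
  rw [mul_assoc, inv_mul_eq_div, le_div_iff₀ hv0]
  linarith

/-- The Bergman space is a closed subspace of `L²(D)`. -/
lemma bergmanSpace_isClosed {n : ℕ} (D : TopologicalSpace.Opens (Fin n → ℂ)) :
    IsClosed (bergmanSpace D : Set (Lp ℂ 2 (volume.restrict (D : Set (Fin n → ℂ))))) := by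
  refine IsSeqClosed.isClosed fun f f₀ hf hlim ↦ ?_
  choose F hF hfF using hf
  have hdiff : ∀ (r : ℝ), 0 < r → ∃ C : ℝ, 0 ≤ C ∧ ∀ k l a,
      closedBall a r ⊆ (D : Set (Fin n → ℂ)) → ‖F k a - F l a‖ ≤ C * ‖f k - f l‖ := by
    intro r hr
    obtain ⟨C, hC, h⟩ := exists_bound D hr
    exact ⟨C, hC, fun k l a ha ↦ h (f k - f l) (F k - F l) ((hF k).sub (hF l))
      ((Lp.coeFn_sub _ _).trans ((hfF k).sub (hfF l))) a ha⟩
  have hcau := hlim.cauchySeq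
  have hball : ∀ a ∈ (D : Set (Fin n → ℂ)), ∃ r > 0, closedBall a r ⊆ (D : Set (Fin n → ℂ)) :=
    fun a ha ↦ nhds_basis_closedBall.mem_iff.1 (D.isOpen.mem_nhds ha)
  have hlimF : ∀ a : D, ∃ c, Tendsto (fun k ↦ F k a) atTop (𝓝 c) := by
    rintro ⟨a, ha⟩
    obtain ⟨r, hr, har⟩ := hball a ha
    obtain ⟨C, hC, h⟩ := hdiff r hr
    apply cauchySeq_tendsto_of_complete
    rw [Metric.cauchySeq_iff] at hcau ⊢
    intro ε hε
    obtain ⟨N, hN⟩ := hcau (ε / (C + 1)) (by positivity)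
    refine ⟨N, fun k hk l hl ↦ ?_⟩
    have h1 := hN k hk l hl
    rw [dist_eq_norm] at h1 ⊢
    rw [lt_div_iff₀ (by positivity)] at h1
    have := h k l a har
    nlinarith [norm_nonneg (f k - f l)]
  choose G₀ hG₀ using hlimF
  classical
  let G : (Fin n → ℂ) → ℂ := fun a ↦ if h : a ∈ D then G₀ ⟨a, h⟩ else 0
  have hG : ∀ a ∈ D, Tendsto (fun k ↦ F k a) atTop (𝓝 (G a)) := by
    intro a ha
    simpa [G, ha] using hG₀ ⟨a, ha⟩
  refine ⟨G, fun a ha ↦ ?_, ?_⟩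
  · obtain ⟨r, hr, har⟩ := hball a ha
    obtain ⟨C, hC, h⟩ := hdiff (r / 3) (by positivity)
    have hsub : ∀ x ∈ ball a (r / 3), ∀ y ∈ ball x (r / 3),
        closedBall y (r / 3) ⊆ (D : Set (Fin n → ℂ)) := by
      intro x hx y hy w hw
      apply har
      rw [mem_ball] at hx hy
      rw [mem_closedBall] at hw ⊢
      linarith [dist_triangle w y a, dist_triangle y x a]
    have hder : ∀ k l, ∀ x ∈ ball a (r / 3),
        ‖fderiv ℂ (F k) x - fderiv ℂ (F l) x‖ ≤ (2 * (C * ‖f k - f l‖)) / (r / 3) := by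
      intro k l x hx
      have hxD : x ∈ (D : Set (Fin n → ℂ)) :=
        hsub x hx x (mem_ball_self (by positivity)) (mem_closedBall_self (by positivity))
      have hd : ∀ k, DifferentiableAt ℂ (F k) x :=
        fun k ↦ (hF k).differentiableAt (D.isOpen.mem_nhds hxD)
      rw [← fderiv_sub (hd k) (hd l)]
      apply Complex.norm_fderiv_le_div_of_mapsTo_ball _ _ (by positivity)
      · refine ((hF k).sub (hF l)).mono fun y hy ↦ ?_
        exact hsub x hx y hy (mem_closedBall_self (by positivity))
      · intro y hy
        have h1 := h k l y (hsub x hx y hy)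
        have h2 := h k l x (hsub x hx x (mem_ball_self (by positivity)))
        rw [mem_closedBall, dist_eq_norm]
        refine (norm_sub_le _ _).trans ?_
        simp only [Pi.sub_apply]
        linarith
    have hucau : UniformCauchySeqOn (fun k ↦ fderiv ℂ (F k)) atTop (ball a (r / 3)) := by
      rw [Metric.uniformCauchySeqOn_iff]
      rw [Metric.cauchySeq_iff] at hcau
      intro ε hε
      obtain ⟨N, hN⟩ := hcau (ε * (r / 3) / (2 * C + 1)) (by positivity)
      refine ⟨N, fun k hk l hl x hx ↦ ?_⟩
      have h1 := hN k hk l hl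
      rw [dist_eq_norm] at h1 ⊢
      refine (hder k l x hx).trans_lt ?_
      rw [div_lt_iff₀ (by positivity)]
      rw [lt_div_iff₀ (by positivity)] at h1
      nlinarith [norm_nonneg (f k - f l)]
    have hex : ∀ x, ∃ L : (Fin n → ℂ) →L[ℂ] ℂ, x ∈ ball a (r / 3) →
        Tendsto (fun k ↦ fderiv ℂ (F k) x) atTop (𝓝 L) := by
      intro x
      by_cases hx : x ∈ ball a (r / 3)
      · obtain ⟨L, hL⟩ := cauchySeq_tendsto_of_complete (hucau.cauchySeq hx)
        exact ⟨L, fun _ ↦ hL⟩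
      · exact ⟨0, fun h ↦ absurd h hx⟩
    choose G' hG' using hex
    have hunif := hucau.tendstoUniformlyOn_of_tendsto (fun x hx ↦ hG' x hx)
    have hxD : ∀ x ∈ ball a (r / 3), x ∈ (D : Set (Fin n → ℂ)) := fun x hx ↦
      hsub x hx x (mem_ball_self (by positivity)) (mem_closedBall_self (by positivity))
    exact (hasFDerivAt_of_tendstoUniformlyOn isOpen_ball hunif
      (fun k x hx ↦ ((hF k).differentiableAt (D.isOpen.mem_nhds (hxD x hx))).hasFDerivAt)
      (fun x hx ↦ hG x (hxD x hx))
      (mem_ball_self (by positivity))).differentiableAt.differentiableWithinAt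
  · obtain ⟨φ, hφ, hae⟩ := (tendstoInMeasure_of_tendsto_Lp hlim).exists_seq_tendsto_ae
    filter_upwards [hae, ae_all_iff.2 hfF, ae_restrict_mem D.isOpen.measurableSet] with x hx hx' hxD
    refine tendsto_nhds_unique hx ?_
    simp_rw [hx']
    exact (hG x hxD).comp hφ.tendsto_atTop

/-- Hence the orthogonal projection of `L²(D)` onto the Bergman space exists. -/
instance {n : ℕ} (D : TopologicalSpace.Opens (Fin n → ℂ)) :
    (bergmanSpace D).HasOrthogonalProjection :=
  haveI : CompleteSpace (bergmanSpace D) := (bergmanSpace_isClosed D).completeSpace_coe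
  inferInstance

/-- The Bergman projection `P_D : L²(D) → L²(D)`, the orthogonal projection onto `A²(D)`. -/
noncomputable def bergmanProjection {n : ℕ} (D : TopologicalSpace.Opens (Fin n → ℂ)) :
    Lp ℂ 2 (volume.restrict (D : Set (Fin n → ℂ))) →L[ℂ]
      Lp ℂ 2 (volume.restrict (D : Set (Fin n → ℂ))) :=
  (bergmanSpace D).starProjection

/-- `P_D` is bounded on `L^p(D)`: on the subspace `L^p(D) ∩ L²(D)`, it takes values in `L^p(D)`
and satisfies an estimate `‖P_D f‖_p ≤ C ‖f‖_p` with a constant `C` independent of `f`. -/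
def BergmanProjectionBounded {n : ℕ} (D : TopologicalSpace.Opens (Fin n → ℂ)) (p : ℝ) : Prop :=
  ∃ C : NNReal, ∀ f : Lp ℂ 2 (volume.restrict (D : Set (Fin n → ℂ))),
    MemLp f (ENNReal.ofReal p) (volume.restrict (D : Set (Fin n → ℂ))) →
      MemLp (bergmanProjection D f) (ENNReal.ofReal p)
        (volume.restrict (D : Set (Fin n → ℂ))) ∧
      eLpNorm (bergmanProjection D f) (ENNReal.ofReal p)
          (volume.restrict (D : Set (Fin n → ℂ))) ≤
        C * eLpNorm f (ENNReal.ofReal p) (volume.restrict (D : Set (Fin n → ℂ)))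

/-- The chain `|z_{k+1}| < ⋯ < |z_n| < 1`. The coordinate `z_{i+1}` of the mathematical text is
`z i` here, `i = 0, …, n - 1`. -/
def Chain (n k : ℕ) (z : Fin n → ℂ) : Prop :=
  (∀ i j : Fin n, k ≤ (i : ℕ) → (j : ℕ) = i + 1 → ‖z i‖ < ‖z j‖) ∧
    ∀ i : Fin n, (i : ℕ) + 1 = n → ‖z i‖ < 1

lemma isOpen_chain (n k : ℕ) : IsOpen {z | Chain n k z} := by
  simp only [Chain, Set.ofPred_and, Set.ofPred_forall]
  refine IsOpen.inter ?_ ?_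
  · exact isOpen_iInter_of_finite fun i ↦ isOpen_iInter_of_finite fun j ↦
      isOpen_iInter_of_finite fun _ ↦ isOpen_iInter_of_finite fun _ ↦
      isOpen_lt (by fun_prop) (by fun_prop)
  · exact isOpen_iInter_of_finite fun i ↦ isOpen_iInter_of_finite fun _ ↦
      isOpen_lt (by fun_prop) (by fun_prop)

/-- The Euclidean norm `|(z_{a+1}, …, z_b)|` of a block of coordinates. -/
noncomputable def blockNorm {n : ℕ} (a b : ℕ) (z : Fin n → ℂ) : ℝ :=
  √(∑ i ∈ Finset.univ.filter (fun i : Fin n ↦ a ≤ (i : ℕ) ∧ (i : ℕ) < b), ‖z i‖ ^ 2)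

lemma continuous_blockNorm {n : ℕ} (a b : ℕ) :
    Continuous (blockNorm a b : (Fin n → ℂ) → ℝ) := by
  unfold blockNorm
  fun_prop

/-- The generalized Hartogs triangle
`{z ∈ ℂⁿ : |(z_1, …, z_k)| < |z_{k+1}| < ⋯ < |z_n| < 1}`, for `k < n`. -/
def hartogsTriangle (n k : ℕ) : TopologicalSpace.Opens (Fin n → ℂ) where
  carrier := {z | (∀ i : Fin n, (i : ℕ) = k → blockNorm 0 k z < ‖z i‖) ∧ Chain n k z}
  is_open' := by
    rw [Set.ofPred_and]
    refine IsOpen.inter ?_ (isOpen_chain n k)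
    simp only [Set.ofPred_forall]
    exact isOpen_iInter_of_finite fun i ↦ isOpen_iInter_of_finite fun _ ↦
      isOpen_lt (continuous_blockNorm _ _) (by fun_prop)

/-- The partial sum `m = κ_1 + ⋯ + κ_j` of the block sizes that precede the block with
(zero-based) index `j`. -/
def blockStart {l : ℕ} (κ : Fin l → ℕ) (j : Fin l) : ℕ :=
  ∑ s ∈ Finset.Iio j, κ s

/-- The standard model with `l` blocks of sizes `κ_1, …, κ_l` and `k = κ_1 + ⋯ + κ_l < n`:
`{z ∈ ℂⁿ : max_j |z̃_j| < |z_{k+1}| < ⋯ < |z_n| < 1}`, where `z̃_j` is the `j`-th of the `l`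
consecutive blocks of coordinates. -/
def standardModel (n : ℕ) {l : ℕ} (κ : Fin l → ℕ) : TopologicalSpace.Opens (Fin n → ℂ) where
  carrier := {z | (∀ i : Fin n, (i : ℕ) = ∑ s, κ s → ∀ j : Fin l,
      blockNorm (blockStart κ j) (blockStart κ j + κ j) z < ‖z i‖) ∧ Chain n (∑ s, κ s) z}
  is_open' := by
    rw [Set.ofPred_and]
    refine IsOpen.inter ?_ (isOpen_chain n _)
    simp only [Set.ofPred_forall]
    exact isOpen_iInter_of_finite fun i ↦ isOpen_iInter_of_finite fun _ ↦
      isOpen_iInter_of_finite fun j ↦ isOpen_lt (continuous_blockNorm _ _) (by fun_prop)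

end

end HartogsBergman

/-!
# The Bergman projection on generalized Hartogs triangles

**Boundedness.** The map `(u, η) ↦ (η u, η)` is biholomorphic from `D × (punctured disc)` onto the
cone `{(z, ξ) : 0 < |ξ| < 1, z / ξ ∈ D}` over `D`. The standard model is obtained from a product of
Euclidean balls by repeating this construction once for each coordinate after the blocks
(`preimage_standardModel_base`, `preimage_standardModel_succ`); `hartogsTriangle n k`
is the model with one block. Bergman kernels are explicit for the ball (`isBergmanKernel_ball`) and for
the punctured disc, which has the kernel of the disc (`isBergmanKernel_puncturedDisc`), and they
are multiplicative under products and transform under biholomorphic maps with the Jacobian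
determinant. Boundedness on `L^p` then follows from Schur's test
(`IsBergmanKernel.bergmanProjectionBounded`): one needs a positive function `h` such that `h^p` and
`h^q`, `q` being the conjugate exponent, are both subinvariant for the modulus of the kernel. On balls
and discs, powers of the distance to the boundary serve for every `1 < p < ∞`, by the Forelli–Rudin
estimates `subinvariant_ballKernel` and `subinvariant_discKernel`. The cone over `D ⊆ ℂᴺ` has the
Jacobian determinant `η^N`, for which `h` is corrected by a power of `|η|`; such a power with the
required integrability at the puncture exists exactly if `(N + 1) |1/p - 1/2| < 1/2`
(`HasSchurKernel.cone`). The strictest condition comes from the last cone, `N = n - 1`, and it is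
`2n / (n + 1) < p < 2n / (n - 1)`.

**Unboundedness.** Let `e = z_n^{-(n-1)}`, and cut the domain `D` into the dyadic pieces
`S_j = {2^{-j-1} ≤ |z_n| < 2^{-j}}`, all similar to `S_0`. By rotation, pairing a holomorphic function
with `e` on `S_j` only sees the component of the function that is homogeneous of degree `-(n-1)`, so
the pairings on `S_j` are `4^{-j}` times the pairing on `S_0` (`IsHartogsDomain.integral_shell`). Hence
`∑_{j < J} 4^j 1_{S_j} e` has the same pairings with `A²(D)` as `(3J/4) e`, which is therefore its
Bergman projection (`bergmanProjection_testFunction`). The projection has `L^p` norm of order `J`,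
but for `p ≤ 2n / (n + 1)` the pieces of the function contribute a nonincreasing geometric progression
to the `p`-th power of its norm; so this norm is at most of order `J^{1/p}` if `p > 1`, and it is
bounded if `p = 1`.
-/

namespace HartogsBergman

section

set_option linter.unusedSectionVars false

open MeasureTheory Metric Filter Topology
open scoped ENNReal NNReal ComplexConjugate

/-! ### Rotation averages -/

section Rotation

variable {E : Type*} [NormedAddCommGroup E] [NormedSpace ℂ E] [MeasurableSpace E] [BorelSpace E]
  [SecondCountableTopology E]

/-- A measure on a complex vector space that is invariant under multiplication by unimodular
scalars. -/
def RotationInvariant (μ : Measure E) : Prop :=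
  ∀ c : Circle, MeasurePreserving (fun z : E ↦ (c : ℂ) • z) μ μ

lemma circleMap_zero_one (θ : ℝ) : circleMap 0 1 θ = (Circle.exp θ : ℂ) := by
  simp [circleMap]

lemma RotationInvariant.restrict {μ : Measure E} (h : RotationInvariant μ) {S : Set E}
    (hS : MeasurableSet S) (hinv : ∀ (c : Circle) (z : E), (c : ℂ) • z ∈ S ↔ z ∈ S) :
    RotationInvariant (μ.restrict S) := by
  intro c
  have h1 := (h c).restrict_preimage hS
  have h2 : (fun z : E ↦ (c : ℂ) • z) ⁻¹' S = S := by ext z; exact hinv c z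
  rwa [h2] at h1

/-- Rotation by the angle given by the first coordinate preserves the product measure. This makes the
rotated integrands jointly measurable and integrable, as needed for Fubini's theorem. -/
lemma RotationInvariant.measurePreserving_skew {μ : Measure E} [SFinite μ]
    (h : RotationInvariant μ) (ν : Measure ℝ) [SFinite ν] :
    MeasurePreserving (fun q : ℝ × E ↦ (q.1, circleMap 0 1 q.1 • q.2)) (ν.prod μ) (ν.prod μ) := by
  refine (MeasurePreserving.id ν).skew_product (g := fun θ z ↦ circleMap 0 1 θ • z) ?_ ?_
  · have : Continuous (Function.uncurry fun (θ : ℝ) (z : E) ↦ circleMap 0 1 θ • z) := by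
      unfold Function.uncurry; fun_prop
    exact this.measurable
  · refine ae_of_all _ fun θ ↦ ?_
    rw [circleMap_zero_one]
    exact (h (Circle.exp θ)).map_eq

/-- The integral against a rotation-invariant measure does not change when the integrand is
averaged over rotations. -/
lemma RotationInvariant.integral_eq {μ : Measure E} [SFinite μ] (h : RotationInvariant μ)
    {g : E → ℂ} (hg : Integrable g μ) :
    ∫ z, g z ∂μ = ∫ z, Real.circleAverage (fun c ↦ g (c • z)) 0 1 ∂μ := by
  set ν : Measure ℝ := volume.restrict (Set.Ioc 0 (2 * Real.pi)) with hν
  have hmp := h.measurePreserving_skew ν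
  have hint : Integrable (Function.uncurry fun (θ : ℝ) (z : E) ↦ g (circleMap 0 1 θ • z))
      (ν.prod μ) := (hmp.integrable_comp_of_integrable (hg.comp_snd ν))
  have hrot : ∀ θ : ℝ, ∫ z, g (circleMap 0 1 θ • z) ∂μ = ∫ z, g z ∂μ := by
    intro θ
    rw [circleMap_zero_one]
    exact (h (Circle.exp θ)).integral_comp
      (Homeomorph.smulOfNeZero (Circle.exp θ : ℂ) (Circle.coe_ne_zero _)).measurableEmbedding g
  have key := integral_integral_swap hint
  simp_rw [hrot] at key
  rw [integral_const] at key
  simp_rw [Real.circleAverage, intervalIntegral.integral_of_le Real.two_pi_pos.le]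
  rw [integral_smul, ← key, smul_smul, hν, measureReal_restrict_apply_univ, measureReal_def,
    Real.volume_Ioc, sub_zero, ENNReal.toReal_ofReal Real.two_pi_pos.le,
    inv_mul_cancel₀ Real.two_pi_pos.ne', one_smul]

/-- Averaging a nonnegative integrand over rotations, in the Lebesgue sense. -/
lemma RotationInvariant.lintegral_eq {μ : Measure E} [SFinite μ] (h : RotationInvariant μ)
    {g : E → ℝ≥0∞} (hg : Measurable g) :
    ENNReal.ofReal (2 * Real.pi) * ∫⁻ z, g z ∂μ =
      ∫⁻ z, (∫⁻ θ in Set.Ioc 0 (2 * Real.pi), g (circleMap 0 1 θ • z)) ∂μ := by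
  set ν : Measure ℝ := volume.restrict (Set.Ioc 0 (2 * Real.pi)) with hν
  have hrot : ∀ θ : ℝ, ∫⁻ z, g (circleMap 0 1 θ • z) ∂μ = ∫⁻ z, g z ∂μ := by
    intro θ
    rw [circleMap_zero_one]
    exact (h (Circle.exp θ)).lintegral_comp hg
  have hm : Measurable (Function.uncurry fun (z : E) (θ : ℝ) ↦ g (circleMap 0 1 θ • z)) := by
    refine hg.comp (Continuous.measurable ?_)
    fun_prop
  rw [lintegral_lintegral_swap hm.aemeasurable]
  simp_rw [hrot]
  rw [lintegral_const, hν, Measure.restrict_apply_univ, Real.volume_Ioc, sub_zero, mul_comm]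

/-- The average of a holomorphic function over a circle `{c • z : |c| = 1}` is its value at `0`. -/
lemma circleAverage_smul_eq {S : Set E} (hbal : ∀ c : ℂ, ‖c‖ ≤ 1 → ∀ z ∈ S, c • z ∈ S)
    {F : E → ℂ} (hF : DifferentiableOn ℂ F S) {z : E} (hz : z ∈ S) :
    Real.circleAverage (fun c ↦ F (c • z)) 0 1 = F 0 := by
  have := DiffContOnCl.circleAverage (f := fun c : ℂ ↦ F (c • z)) (c := 0) (R := 1) ?_
  · simpa using this
  · have hd : DifferentiableOn ℂ (fun c : ℂ ↦ F (c • z)) (closedBall 0 1) :=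
      hF.comp (by fun_prop) (fun c hc ↦ hbal c (by simpa using hc) z hz)
    apply DifferentiableOn.diffContOnCl
    rw [abs_one]
    exact hd.mono closure_ball_subset_closedBall

/-- Mean value property on balanced sets. -/
lemma RotationInvariant.setIntegral_eq_of_balanced {μ : Measure E} [SFinite μ]
    (h : RotationInvariant μ)
    {S : Set E} (hS : MeasurableSet S) (hbal : ∀ c : ℂ, ‖c‖ ≤ 1 → ∀ z ∈ S, c • z ∈ S)
    {F : E → ℂ} (hF : DifferentiableOn ℂ F S) (hi : IntegrableOn F S μ) :
    ∫ z in S, F z ∂μ = (μ.real S : ℂ) * F 0 := by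
  have hinv : ∀ (c : Circle) (z : E), (c : ℂ) • z ∈ S ↔ z ∈ S := by
    refine fun c z ↦ ⟨fun hz ↦ ?_, fun hz ↦ hbal c (Circle.norm_coe c).le z hz⟩
    have := hbal ((c⁻¹ : Circle) : ℂ) (Circle.norm_coe _).le _ hz
    rwa [smul_smul, ← Circle.coe_mul, inv_mul_cancel, Circle.coe_one, one_smul] at this
  rw [(h.restrict hS hinv).integral_eq hi]
  rw [setIntegral_congr_fun hS (g := fun _ ↦ F 0) fun z hz ↦ circleAverage_smul_eq hbal hF hz,
    setIntegral_const, Complex.real_smul]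

end Rotation

lemma rotationInvariant_volume_complex : RotationInvariant (volume : Measure ℂ) := by
  intro c
  exact (rotation c).measurePreserving

lemma rotationInvariant_volume_pi (n : ℕ) : RotationInvariant (volume : Measure (Fin n → ℂ)) := by
  intro c
  simpa using measurePreserving_rot (n := n) 0 c

/-! ### Bergman kernels -/

lemma memLp_two_iff {α : Type*} [MeasurableSpace α] {μ : Measure α} {f : α → ℂ} :
    MemLp f 2 μ ↔ AEStronglyMeasurable f μ ∧ ∫⁻ x, ‖f x‖ₑ ^ 2 ∂μ < ∞ := by
  unfold MemLp
  refine and_congr_right fun _ ↦ ?_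
  rw [eLpNorm_lt_top_iff_lintegral_rpow_enorm_lt_top (by norm_num) (by norm_num)]
  norm_num

section Kernel

variable {E : Type*} [NormedAddCommGroup E] [NormedSpace ℂ E] [MeasureSpace E] [BorelSpace E]
  [SecondCountableTopology E] [SigmaFinite (volume : Measure E)]
variable {E' : Type*} [NormedAddCommGroup E'] [NormedSpace ℂ E'] [MeasureSpace E'] [BorelSpace E']
  [SecondCountableTopology E'] [SigmaFinite (volume : Measure E')]

/-- `K` is the Bergman kernel of the open set `D`: it is Hermitian, the functions `K(·, y)` belong
to `A²(D)`, and `K` reproduces every function of `A²(D)` at every point. Hermitian symmetry is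
asked for all pairs of points, in `D` or not: every kernel used here is given by a formula for
which it holds everywhere. -/
structure IsBergmanKernel (D : Set E) (K : E → E → ℂ) : Prop where
  isOpen : IsOpen D
  measurable : Measurable (Function.uncurry K)
  symm : ∀ x y, K x y = conj (K y x)
  holo : ∀ y ∈ D, DifferentiableOn ℂ (fun x ↦ K x y) D
  memLp : ∀ y ∈ D, MemLp (fun x ↦ K x y) 2 (volume.restrict D)
  repr : ∀ F : E → ℂ, DifferentiableOn ℂ F D → MemLp F 2 (volume.restrict D) →
    ∀ z ∈ D, F z = ∫ ζ in D, K z ζ * F ζ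

namespace IsBergmanKernel

variable {D : Set E} {K : E → E → ℂ} {D' : Set E'} {K' : E' → E' → ℂ}

lemma enorm_symm (h : IsBergmanKernel D K) (x y : E) : ‖K x y‖ₑ = ‖K y x‖ₑ := by
  rw [h.symm x y, RCLike.enorm_conj]

lemma measurable_right (h : IsBergmanKernel D K) (x : E) : Measurable (K x) :=
  h.measurable.comp measurable_prodMk_left

lemma measurable_left (h : IsBergmanKernel D K) (y : E) : Measurable (fun x ↦ K x y) :=
  h.measurable.comp measurable_prodMk_right

lemma memLp_right (h : IsBergmanKernel D K) {x : E} (hx : x ∈ D) :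
    MemLp (K x) 2 (volume.restrict D) := by
  have h1 := memLp_two_iff.1 (h.memLp x hx)
  refine memLp_two_iff.2 ⟨(h.measurable_right x).aestronglyMeasurable, ?_⟩
  simp_rw [h.enorm_symm x]
  exact h1.2

/-- Point evaluations are bounded on the Bergman space. -/
lemma enorm_sq_le (h : IsBergmanKernel D K) {x : E} (hx : x ∈ D) {F : E → ℂ}
    (hF : DifferentiableOn ℂ F D) (hF2 : MemLp F 2 (volume.restrict D)) :
    ‖F x‖ₑ ^ 2 ≤ (∫⁻ y in D, ‖K x y‖ₑ ^ 2) * ∫⁻ y in D, ‖F y‖ₑ ^ 2 := by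
  have h1 : ‖F x‖ₑ ≤ ∫⁻ y in D, ‖K x y‖ₑ * ‖F y‖ₑ := by
    rw [h.repr F hF hF2 x hx]
    refine (enorm_integral_le_lintegral_enorm _).trans (le_of_eq ?_)
    simp_rw [enorm_mul]
  have h2 := ENNReal.lintegral_mul_le_Lp_mul_Lq (volume.restrict D)
    (f := fun y ↦ ‖K x y‖ₑ) (g := fun y ↦ ‖F y‖ₑ) Real.HolderConjugate.two_two
    (h.measurable_right x).enorm.aemeasurable hF2.1.enorm
  have h3 := pow_le_pow_left' (h1.trans h2) 2
  refine h3.trans (le_of_eq ?_)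
  rw [mul_pow, ← ENNReal.rpow_natCast, ← ENNReal.rpow_natCast, ← ENNReal.rpow_mul,
    ← ENNReal.rpow_mul]
  norm_num

/-- The Bergman kernel of a product is the product of the Bergman kernels. -/
lemma prod (h : IsBergmanKernel D K) (h' : IsBergmanKernel D' K') :
    IsBergmanKernel (D ×ˢ D') fun x y : E × E' ↦ K x.1 y.1 * K' x.2 y.2 := by
  have hres : (volume : Measure (E × E')).restrict (D ×ˢ D') =
      (volume.restrict D).prod (volume.restrict D') := by
    rw [Measure.prod_restrict, Measure.volume_eq_prod]
  refine ⟨h.isOpen.prod h'.isOpen, ?_, ?_, ?_, ?_, ?_⟩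
  · exact (h.measurable.comp ((measurable_fst.comp measurable_fst).prodMk
      (measurable_fst.comp measurable_snd))).mul
      (h'.measurable.comp ((measurable_snd.comp measurable_fst).prodMk
      (measurable_snd.comp measurable_snd)))
  · intro x y
    rw [h.symm, h'.symm, map_mul]
  · rintro ⟨y, y'⟩ ⟨hy, hy'⟩
    refine DifferentiableOn.mul ?_ ?_
    · exact (h.holo y hy).comp differentiableOn_fst fun x hx ↦ hx.1
    · exact (h'.holo y' hy').comp differentiableOn_snd fun x hx ↦ hx.2
  · rintro ⟨y, y'⟩ ⟨hy, hy'⟩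
    rw [hres]
    refine memLp_two_iff.2 ⟨Measurable.aestronglyMeasurable ?_, ?_⟩
    · exact ((h.measurable_left y).comp measurable_fst).mul
        ((h'.measurable_left y').comp measurable_snd)
    · simp_rw [enorm_mul, mul_pow]
      rw [lintegral_prod_mul ((h.measurable_left y).enorm.pow_const 2).aemeasurable
        ((h'.measurable_left y').enorm.pow_const 2).aemeasurable]
      exact ENNReal.mul_lt_top (memLp_two_iff.1 (h.memLp y hy)).2
        (memLp_two_iff.1 (h'.memLp y' hy')).2
  · rintro F hF hF2 ⟨x, x'⟩ ⟨hx, hx'⟩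
    rw [hres] at hF2 ⊢
    have hslice : ∀ y ∈ D, DifferentiableOn ℂ (fun y' ↦ F (y, y')) D' := fun y hy ↦
      hF.comp (by fun_prop) fun y' hy' ↦ ⟨hy, hy'⟩
    have hslice' : DifferentiableOn ℂ (fun y ↦ F (y, x')) D :=
      hF.comp (by fun_prop) fun y hy ↦ ⟨hy, hx'⟩
    have hlin := (memLp_two_iff.1 hF2).2
    have hm : AEMeasurable (fun q : E × E' ↦ ‖F q‖ₑ ^ 2)
      ((volume.restrict D).prod (volume.restrict D')) := hF2.1.enorm.pow_const 2
    rw [lintegral_prod _ hm] at hlin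
    have hae : ∀ᵐ y ∂(volume.restrict D), MemLp (fun y' ↦ F (y, y')) 2 (volume.restrict D') := by
      filter_upwards [ae_lt_top' hm.lintegral_prod_right' hlin.ne,
        ae_restrict_mem h.isOpen.measurableSet] with y hy hyD
      exact memLp_two_iff.2 ⟨(hslice y hyD).continuousOn.aestronglyMeasurable
        h'.isOpen.measurableSet, hy⟩
    have h1 : MemLp (fun y ↦ F (y, x')) 2 (volume.restrict D) := by
      refine memLp_two_iff.2 ⟨hslice'.continuousOn.aestronglyMeasurable h.isOpen.measurableSet, ?_⟩
      calc ∫⁻ y in D, ‖F (y, x')‖ₑ ^ 2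
          ≤ ∫⁻ y in D, (∫⁻ y' in D', ‖K' x' y'‖ₑ ^ 2) * ∫⁻ y' in D', ‖F (y, y')‖ₑ ^ 2 := by
            refine lintegral_mono_ae ?_
            filter_upwards [hae, ae_restrict_mem h.isOpen.measurableSet] with y hy hyD
            exact h'.enorm_sq_le hx' (hslice y hyD) hy
        _ = (∫⁻ y' in D', ‖K' x' y'‖ₑ ^ 2) * ∫⁻ y in D, ∫⁻ y' in D', ‖F (y, y')‖ₑ ^ 2 :=
            lintegral_const_mul'' _ hm.lintegral_prod_right'
        _ < ∞ := ENNReal.mul_lt_top (memLp_two_iff.1 (h'.memLp_right hx')).2 hlin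
    have hK2 : MemLp (fun q : E × E' ↦ K x q.1 * K' x' q.2) 2
        ((volume.restrict D).prod (volume.restrict D')) := by
      refine memLp_two_iff.2 ⟨Measurable.aestronglyMeasurable ?_, ?_⟩
      · exact ((h.measurable_right x).comp measurable_fst).mul
          ((h'.measurable_right x').comp measurable_snd)
      · simp_rw [enorm_mul, mul_pow]
        rw [lintegral_prod_mul ((h.measurable_right x).enorm.pow_const 2).aemeasurable
          ((h'.measurable_right x').enorm.pow_const 2).aemeasurable]
        exact ENNReal.mul_lt_top (memLp_two_iff.1 (h.memLp_right hx)).2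
          (memLp_two_iff.1 (h'.memLp_right hx')).2
    have hint : Integrable (fun q : E × E' ↦ K x q.1 * K' x' q.2 * F q)
        ((volume.restrict D).prod (volume.restrict D')) := hK2.integrable_mul hF2
    rw [integral_prod _ hint, h.repr _ hslice' h1 x hx]
    refine integral_congr_ae ?_
    filter_upwards [hae, ae_restrict_mem h.isOpen.measurableSet] with y hy hyD
    rw [h'.repr _ (hslice y hyD) hy x' hx', ← integral_const_mul]
    refine integral_congr_ae (ae_of_all _ fun y' ↦ ?_)
    simp only
    ring

end IsBergmanKernel

/-- `φ` is subinvariant for `|K|` on `D`, up to a constant: `∫_D |K(x, y)| φ(y) dy ≤ C φ(x)`. -/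
def Subinvariant (D : Set E) (K : E → E → ℂ) (φ : E → ℝ≥0∞) : Prop :=
  ∃ C : ℝ≥0, ∀ x ∈ D, ∫⁻ y in D, ‖K x y‖ₑ * φ y ≤ C * φ x

lemma Subinvariant.congr {D : Set E} {K : E → E → ℂ} {φ ψ : E → ℝ≥0∞} (hD : MeasurableSet D)
    (h : Subinvariant D K φ) (hφ : ∀ x ∈ D, φ x = ψ x) : Subinvariant D K ψ := by
  obtain ⟨C, hC⟩ := h
  refine ⟨C, fun x hx ↦ ?_⟩
  rw [← hφ x hx, setLIntegral_congr_fun (g := fun y ↦ ‖K x y‖ₑ * φ y) hD]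
  · exact hC x hx
  · intro y hy
    simp only [hφ y hy]

/-- By Tonelli's theorem, subinvariance is inherited by products. -/
lemma Subinvariant.prod {D : Set E} {K : E → E → ℂ} {D' : Set E'} {K' : E' → E' → ℂ}
    (hK : IsBergmanKernel D K) (hK' : IsBergmanKernel D' K')
    {φ : E → ℝ≥0∞} {φ' : E' → ℝ≥0∞} (hφ : Measurable φ) (hφ' : Measurable φ')
    (h : Subinvariant D K φ) (h' : Subinvariant D' K' φ') :
    Subinvariant (D ×ˢ D') (fun x y : E × E' ↦ K x.1 y.1 * K' x.2 y.2)
      fun x ↦ φ x.1 * φ' x.2 := by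
  obtain ⟨C, hC⟩ := h
  obtain ⟨C', hC'⟩ := h'
  refine ⟨C * C', ?_⟩
  rintro ⟨x, x'⟩ ⟨hx, hx'⟩
  rw [Measure.volume_eq_prod, ← Measure.prod_restrict]
  have : ∀ y : E × E', ‖K x y.1 * K' x' y.2‖ₑ * (φ y.1 * φ' y.2) =
      (‖K x y.1‖ₑ * φ y.1) * (‖K' x' y.2‖ₑ * φ' y.2) := by
    intro y
    rw [enorm_mul]
    ring
  simp only [this]
  rw [lintegral_prod_mul (f := fun y ↦ ‖K x y‖ₑ * φ y) (g := fun y ↦ ‖K' x' y‖ₑ * φ' y)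
    ((hK.measurable_right x).enorm.mul hφ).aemeasurable
    ((hK'.measurable_right x').enorm.mul hφ').aemeasurable]
  refine (mul_le_mul' (hC x hx) (hC' x' hx')).trans (le_of_eq ?_)
  push_cast
  ring

/-- The function `h` satisfies the hypotheses of Schur's test for the exponent `p` and its conjugate
exponent `q`, for the kernel `|K|` on `D`. -/
structure IsSchurFunction (D : Set E) (K : E → E → ℂ) (p q : ℝ) (h : E → ℝ≥0∞) : Prop where
  measurable : Measurable h
  ne_zero : ∀ x ∈ D, h x ≠ 0
  ne_top : ∀ x ∈ D, h x ≠ ∞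
  left : Subinvariant D K fun x ↦ h x ^ p
  right : Subinvariant D K fun x ↦ h x ^ q

lemma IsSchurFunction.prod {D : Set E} {K : E → E → ℂ} {D' : Set E'} {K' : E' → E' → ℂ} {p q : ℝ}
    (hK : IsBergmanKernel D K) (hK' : IsBergmanKernel D' K') (hp : 0 ≤ p) (hq : 0 ≤ q)
    {h : E → ℝ≥0∞} {h' : E' → ℝ≥0∞} (hh : IsSchurFunction D K p q h)
    (hh' : IsSchurFunction D' K' p q h') :
    IsSchurFunction (D ×ˢ D') (fun x y : E × E' ↦ K x.1 y.1 * K' x.2 y.2) p q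
      fun x ↦ h x.1 * h' x.2 := by
  refine ⟨(hh.measurable.comp measurable_fst).mul (hh'.measurable.comp measurable_snd),
    fun x hx ↦ mul_ne_zero (hh.ne_zero _ hx.1) (hh'.ne_zero _ hx.2),
    fun x hx ↦ ENNReal.mul_ne_top (hh.ne_top _ hx.1) (hh'.ne_top _ hx.2), ?_, ?_⟩
  · simp_rw [ENNReal.mul_rpow_of_nonneg _ _ hp]
    exact Subinvariant.prod hK hK' (hh.measurable.pow_const p) (hh'.measurable.pow_const p)
      hh.left hh'.left
  · simp_rw [ENNReal.mul_rpow_of_nonneg _ _ hq]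
    exact Subinvariant.prod hK hK' (hh.measurable.pow_const q) (hh'.measurable.pow_const q)
      hh.right hh'.right

/-- **Schur's test.** -/
lemma IsSchurFunction.lintegral_rpow_le {D : Set E} {K : E → E → ℂ} {p q : ℝ}
    (hpq : p.HolderConjugate q) (hK : IsBergmanKernel D K) {h : E → ℝ≥0∞}
    (hh : IsSchurFunction D K p q h) :
    ∃ C : ℝ≥0, ∀ f : E → ℝ≥0∞, AEMeasurable f (volume.restrict D) →
      ∫⁻ x in D, (∫⁻ y in D, ‖K x y‖ₑ * f y) ^ p ≤ C * ∫⁻ y in D, f y ^ p := by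
  obtain ⟨A, hA⟩ := hh.left
  obtain ⟨B, hB⟩ := hh.right
  have hp := hpq.pos
  have hq := hpq.symm.pos
  have hmeas := hK.isOpen.measurableSet
  refine ⟨B ^ (p / q) * A, fun f hf ↦ ?_⟩
  have hKm : Measurable fun z : E × E ↦ ‖K z.1 z.2‖ₑ := hK.measurable.enorm
  -- Hölder's inequality for the factors `|K|^{1/q} h` and `|K|^{1/p} h⁻¹ f`
  have key : ∀ x ∈ D, (∫⁻ y in D, ‖K x y‖ₑ * f y) ^ p ≤
      (B : ℝ≥0∞) ^ (p / q) * (h x ^ p * ∫⁻ y in D, ‖K x y‖ₑ * (h y ^ (-p) * f y ^ p)) := by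
    intro x hx
    have h1 : ∫⁻ y in D, ‖K x y‖ₑ * f y =
        ∫⁻ y in D, (‖K x y‖ₑ ^ (1 / q) * h y) * (‖K x y‖ₑ ^ (1 / p) * (h y)⁻¹ * f y) := by
      refine setLIntegral_congr_fun hmeas fun y hy ↦ ?_
      have h2 : ‖K x y‖ₑ = ‖K x y‖ₑ ^ (1 / q) * ‖K x y‖ₑ ^ (1 / p) := by
        rw [← ENNReal.rpow_add_of_nonneg _ _ (by positivity) (by positivity), one_div, one_div,
          hpq.symm.inv_add_inv_eq_one, ENNReal.rpow_one]
      have h3 := ENNReal.mul_inv_cancel (hh.ne_zero y hy) (hh.ne_top y hy)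
      calc ‖K x y‖ₑ * f y = (‖K x y‖ₑ ^ (1 / q) * ‖K x y‖ₑ ^ (1 / p)) * (h y * (h y)⁻¹) * f y := by
            rw [← h2, h3, mul_one]
        _ = _ := by ring
    have h2 := ENNReal.lintegral_mul_le_Lp_mul_Lq (volume.restrict D)
      (f := fun y ↦ ‖K x y‖ₑ ^ (1 / q) * h y) (g := fun y ↦ ‖K x y‖ₑ ^ (1 / p) * (h y)⁻¹ * f y)
      hpq.symm (((hK.measurable_right x).enorm.pow_const _).mul hh.measurable).aemeasurable
      ((((hK.measurable_right x).enorm.pow_const _).mul hh.measurable.inv).aemeasurable.mul hf)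
    have h3 : ∀ y, (‖K x y‖ₑ ^ (1 / q) * h y) ^ q = ‖K x y‖ₑ * h y ^ q := fun y ↦ by
      rw [ENNReal.mul_rpow_of_nonneg _ _ hq.le, ← ENNReal.rpow_mul, one_div_mul_cancel hq.ne',
        ENNReal.rpow_one]
    have h4 : ∀ y, (‖K x y‖ₑ ^ (1 / p) * (h y)⁻¹ * f y) ^ p =
        ‖K x y‖ₑ * (h y ^ (-p) * f y ^ p) := fun y ↦ by
      rw [ENNReal.mul_rpow_of_nonneg _ _ hp.le, ENNReal.mul_rpow_of_nonneg _ _ hp.le,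
        ← ENNReal.rpow_mul, one_div_mul_cancel hp.ne', ENNReal.rpow_one, ENNReal.inv_rpow,
        ENNReal.rpow_neg, mul_assoc]
    simp only [Pi.mul_apply, h3, h4] at h2
    rw [h1]
    calc _ ≤ ((∫⁻ y in D, ‖K x y‖ₑ * h y ^ q) ^ (1 / q) *
          (∫⁻ y in D, ‖K x y‖ₑ * (h y ^ (-p) * f y ^ p)) ^ (1 / p)) ^ p :=
          ENNReal.rpow_le_rpow h2 hp.le
      _ ≤ ((B * h x ^ q) ^ (1 / q) *
          (∫⁻ y in D, ‖K x y‖ₑ * (h y ^ (-p) * f y ^ p)) ^ (1 / p)) ^ p := by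
          gcongr
          exact hB x hx
      _ = _ := by
          rw [ENNReal.mul_rpow_of_nonneg _ _ hp.le,
            ENNReal.mul_rpow_of_nonneg _ _ (show 0 ≤ 1 / q by positivity),
            ← ENNReal.rpow_mul (h x), mul_one_div_cancel hq.ne', ENNReal.rpow_one,
            ENNReal.mul_rpow_of_nonneg _ _ hp.le, ← ENNReal.rpow_mul, ← ENNReal.rpow_mul,
            one_div_mul_cancel hp.ne', ENNReal.rpow_one, mul_assoc, one_div_mul_eq_div]
  have hgm : AEMeasurable (fun y ↦ h y ^ (-p) * f y ^ p) (volume.restrict D) :=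
    (hh.measurable.pow_const _).aemeasurable.mul (hf.pow_const _)
  have hjoint : AEMeasurable (fun z : E × E ↦ h z.1 ^ p *
      (‖K z.1 z.2‖ₑ * (h z.2 ^ (-p) * f z.2 ^ p)))
      ((volume.restrict D).prod (volume.restrict D)) :=
    ((hh.measurable.comp measurable_fst).pow_const p).aemeasurable.mul
      (hKm.aemeasurable.mul hgm.comp_snd)
  have hKg : ∀ x, AEMeasurable (fun y ↦ ‖K x y‖ₑ * (h y ^ (-p) * f y ^ p)) (volume.restrict D) :=
    fun x ↦ (hK.measurable_right x).enorm.aemeasurable.mul hgm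
  calc ∫⁻ x in D, (∫⁻ y in D, ‖K x y‖ₑ * f y) ^ p
      ≤ ∫⁻ x in D, (B : ℝ≥0∞) ^ (p / q) *
          (h x ^ p * ∫⁻ y in D, ‖K x y‖ₑ * (h y ^ (-p) * f y ^ p)) :=
        setLIntegral_mono' hmeas key
    _ = (B : ℝ≥0∞) ^ (p / q) * ∫⁻ x in D, ∫⁻ y in D,
          h x ^ p * (‖K x y‖ₑ * (h y ^ (-p) * f y ^ p)) := by
        rw [lintegral_const_mul' _ _ (ENNReal.rpow_ne_top_of_nonneg
          (div_nonneg hp.le hq.le) ENNReal.coe_ne_top)]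
        congr 1
        refine lintegral_congr fun x ↦ ?_
        rw [lintegral_const_mul'' _ (hKg x)]
    _ = (B : ℝ≥0∞) ^ (p / q) * ∫⁻ y in D, ∫⁻ x in D,
          h x ^ p * (‖K x y‖ₑ * (h y ^ (-p) * f y ^ p)) := by
        rw [lintegral_lintegral_swap hjoint]
    _ = (B : ℝ≥0∞) ^ (p / q) * ∫⁻ y in D,
          (∫⁻ x in D, ‖K y x‖ₑ * h x ^ p) * (h y ^ (-p) * f y ^ p) := by
        congr 1
        refine lintegral_congr fun y ↦ ?_
        have hm : Measurable fun x ↦ ‖K y x‖ₑ * h x ^ p :=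
          (hK.measurable_right y).enorm.mul (hh.measurable.pow_const p)
        rw [← lintegral_mul_const _ hm]
        refine lintegral_congr fun x ↦ ?_
        rw [hK.enorm_symm x y]
        ring
    _ ≤ (B : ℝ≥0∞) ^ (p / q) * ∫⁻ y in D, A * f y ^ p := by
        gcongr 1
        refine setLIntegral_mono' hmeas fun y hy ↦ ?_
        calc _ ≤ (A * h y ^ p) * (h y ^ (-p) * f y ^ p) := by
              gcongr
              exact hA y hy
          _ = A * f y ^ p * (h y ^ p * h y ^ (-p)) := by ring
          _ = A * f y ^ p := by
              rw [← ENNReal.rpow_add _ _ (hh.ne_zero y hy) (hh.ne_top y hy), add_neg_cancel,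
                ENNReal.rpow_zero, mul_one]
    _ = _ := by
        rw [lintegral_const_mul' _ _ ENNReal.coe_ne_top, ← mul_assoc]
        congr 1
        rw [ENNReal.coe_mul, ENNReal.coe_rpow_of_nonneg _ (div_nonneg hp.le hq.le)]

end Kernel

/-- The Bergman projection is the integral operator with the Bergman kernel. -/
lemma IsBergmanKernel.bergmanProjection_eq {n : ℕ} {D : TopologicalSpace.Opens (Fin n → ℂ)}
    {K : (Fin n → ℂ) → (Fin n → ℂ) → ℂ} (hK : IsBergmanKernel (D : Set (Fin n → ℂ)) K)
    (f : Lp ℂ 2 (volume.restrict (D : Set (Fin n → ℂ)))) :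
    bergmanProjection D f =ᵐ[volume.restrict (D : Set (Fin n → ℂ))]
      fun z ↦ ∫ ζ in D, K z ζ * f ζ := by
  have hmem : bergmanProjection D f ∈ bergmanSpace D :=
    Submodule.starProjection_apply_mem _ _
  obtain ⟨F, hF, hfF⟩ := hmem
  have hF2 : MemLp F 2 (volume.restrict (D : Set (Fin n → ℂ))) :=
    (memLp_congr_ae hfF).1 (Lp.memLp _)
  refine hfF.trans ?_
  filter_upwards [ae_restrict_mem D.isOpen.measurableSet] with z hz
  set k := (hK.memLp z hz).toLp with hk
  have hkae : k =ᵐ[volume.restrict (D : Set (Fin n → ℂ))] fun x ↦ K x z :=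
    (hK.memLp z hz).coeFn_toLp
  have hkmem : k ∈ bergmanSpace D := ⟨_, hK.holo z hz, hkae⟩
  have hinner : ∀ g : Lp ℂ 2 (volume.restrict (D : Set (Fin n → ℂ))),
      inner ℂ k g = ∫ ζ in D, K z ζ * g ζ := by
    intro g
    rw [L2.inner_def]
    refine integral_congr_ae ?_
    filter_upwards [hkae] with ζ hζ
    rw [hζ, hK.symm z ζ, RCLike.inner_apply, mul_comm]
  rw [hK.repr F hF hF2 z hz, ← hinner f]
  have h1 : ∫ ζ in D, K z ζ * F ζ = inner ℂ k (bergmanProjection D f) := by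
    rw [hinner]
    refine integral_congr_ae ?_
    filter_upwards [hfF] with ζ hζ
    rw [hζ]
  rw [h1, bergmanProjection, ← Submodule.inner_starProjection_left_eq_right,
    Submodule.starProjection_eq_self_iff.2 hkmem]

/-- If Schur's test applies to the Bergman kernel of `D` and the exponent `p`, then the Bergman
projection is bounded on `L^p(D)`. -/
lemma IsBergmanKernel.bergmanProjectionBounded {n : ℕ} {D : TopologicalSpace.Opens (Fin n → ℂ)}
    {K : (Fin n → ℂ) → (Fin n → ℂ) → ℂ} (hK : IsBergmanKernel (D : Set (Fin n → ℂ)) K) {p q : ℝ}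
    (hpq : p.HolderConjugate q) {h : (Fin n → ℂ) → ℝ≥0∞} (hh : IsSchurFunction D K p q h) :
    BergmanProjectionBounded D p := by
  obtain ⟨C, hC⟩ := hh.lintegral_rpow_le hpq hK
  have hp := hpq.pos
  have hp0 : ENNReal.ofReal p ≠ 0 := by simpa using hp
  have hpt : (ENNReal.ofReal p).toReal = p := ENNReal.toReal_ofReal hp.le
  refine ⟨C ^ (1 / p), fun f hf ↦ ?_⟩
  have hle : eLpNorm (bergmanProjection D f) (ENNReal.ofReal p)
      (volume.restrict (D : Set (Fin n → ℂ))) ≤ (C ^ (1 / p) : ℝ≥0) *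
        eLpNorm f (ENNReal.ofReal p) (volume.restrict (D : Set (Fin n → ℂ))) := by
    rw [eLpNorm_eq_lintegral_rpow_enorm_toReal hp0 ENNReal.ofReal_ne_top,
      eLpNorm_eq_lintegral_rpow_enorm_toReal hp0 ENNReal.ofReal_ne_top, hpt,
      ENNReal.coe_rpow_of_nonneg _ (show 0 ≤ 1 / p by positivity),
      ← ENNReal.mul_rpow_of_nonneg _ _ (by positivity)]
    refine ENNReal.rpow_le_rpow ?_ (by positivity)
    refine le_trans ?_ (hC _ f.1.aestronglyMeasurable.enorm)
    refine lintegral_mono_ae ?_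
    filter_upwards [hK.bergmanProjection_eq f] with x hx
    rw [hx]
    refine ENNReal.rpow_le_rpow ?_ hp.le
    refine (enorm_integral_le_lintegral_enorm _).trans (le_of_eq ?_)
    simp_rw [enorm_mul]
  exact ⟨⟨(Lp.aestronglyMeasurable _), hle.trans_lt (ENNReal.mul_lt_top ENNReal.coe_lt_top hf.2)⟩,
    hle⟩

/-! ### Change of variables -/

section Transfer

variable {X : Type*} [NormedAddCommGroup X] [NormedSpace ℂ X] [MeasureSpace X] [BorelSpace X]
  [SecondCountableTopology X] [SigmaFinite (volume : Measure X)]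
variable {Y : Type*} [NormedAddCommGroup Y] [NormedSpace ℂ Y] [MeasureSpace Y] [BorelSpace Y]
  [SecondCountableTopology Y] [SigmaFinite (volume : Measure Y)]

/-- A biholomorphic map `Ψ : U → V` with inverse `Φ` and complex Jacobian determinant `J`. The role
of the Jacobian is recorded by the change of variables formula: Lebesgue measure on `V` is
the image of `|J|²` times Lebesgue measure on `U`. -/
structure IsBiholomorphism (U : Set X) (V : Set Y) (Ψ : X → Y) (Φ : Y → X) (J : X → ℂ) : Prop where
  isOpen_source : IsOpen U
  isOpen_target : IsOpen V
  mapsTo : Set.MapsTo Ψ U V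
  mapsTo_inv : Set.MapsTo Φ V U
  left_inv : ∀ x ∈ U, Φ (Ψ x) = x
  right_inv : ∀ y ∈ V, Ψ (Φ y) = y
  holo : DifferentiableOn ℂ Ψ U
  holo_inv : DifferentiableOn ℂ Φ V
  holo_jac : DifferentiableOn ℂ J U
  jac_ne_zero : ∀ x ∈ U, J x ≠ 0
  measurable : Measurable Ψ
  measurable_inv : Measurable Φ
  measurable_jac : Measurable J
  map_eq : ((volume.restrict U).withDensity fun x ↦ ((‖J x‖₊ ^ 2 : ℝ≥0) : ℝ≥0∞)).map Ψ =
    volume.restrict V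

namespace IsBiholomorphism

variable {U : Set X} {V : Set Y} {Ψ : X → Y} {Φ : Y → X} {J : X → ℂ}

lemma measurable_density (h : IsBiholomorphism U V Ψ Φ J) : Measurable fun x ↦ ‖J x‖₊ ^ 2 :=
  h.measurable_jac.nnnorm.pow_const 2

lemma lintegral_eq (h : IsBiholomorphism U V Ψ Φ J) {g : Y → ℝ≥0∞}
    (hg : AEMeasurable g (volume.restrict V)) :
    ∫⁻ y in V, g y = ∫⁻ x in U, ‖J x‖ₑ ^ 2 * g (Ψ x) := by
  rw [← h.map_eq] at hg ⊢
  rw [lintegral_map' hg h.measurable.aemeasurable,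
    lintegral_withDensity_eq_lintegral_mul_non_measurable _ h.measurable_density.coe_nnreal_ennreal
      (ae_of_all _ fun x ↦ ENNReal.coe_lt_top)]
  rfl

lemma integral_eq (h : IsBiholomorphism U V Ψ Φ J) {g : Y → ℂ}
    (hg : AEStronglyMeasurable g (volume.restrict V)) :
    ∫ y in V, g y = ∫ x in U, J x * conj (J x) * g (Ψ x) := by
  rw [← h.map_eq] at hg ⊢
  rw [integral_map h.measurable.aemeasurable hg,
    integral_withDensity_eq_integral_smul h.measurable_density]
  refine integral_congr_ae (ae_of_all _ fun x ↦ ?_)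
  simp only
  rw [Complex.mul_conj, NNReal.smul_def, Complex.real_smul, Complex.normSq_eq_norm_sq]
  simp

/-- The Bergman kernel of the image of a biholomorphic map. -/
lemma isBergmanKernel (h : IsBiholomorphism U V Ψ Φ J) {K : X → X → ℂ}
    (hK : IsBergmanKernel U K) :
    IsBergmanKernel V fun y y' ↦ K (Φ y) (Φ y') * ((J (Φ y))⁻¹ * conj (J (Φ y'))⁻¹) := by
  have hjac := h.measurable_jac.comp h.measurable_inv
  have hV := h.isOpen_target.measurableSet
  have hU := h.isOpen_source.measurableSet
  refine ⟨h.isOpen_target, ?_, ?_, ?_, ?_, ?_⟩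
  · refine (hK.measurable.comp ((h.measurable_inv.comp measurable_fst).prodMk
      (h.measurable_inv.comp measurable_snd))).mul ((hjac.comp measurable_fst).inv.mul ?_)
    exact (Complex.continuous_conj.measurable.comp (hjac.comp measurable_snd).inv)
  · intro x y
    rw [hK.symm]
    simp only [map_mul, Complex.conj_conj]
    ring
  · intro y' hy'
    have h1 : DifferentiableOn ℂ (fun y ↦ K (Φ y) (Φ y')) V :=
      (hK.holo _ (h.mapsTo_inv hy')).comp h.holo_inv h.mapsTo_inv
    have h2 : DifferentiableOn ℂ (fun y ↦ (J (Φ y))⁻¹) V :=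
      (h.holo_jac.comp h.holo_inv h.mapsTo_inv).inv
        fun y hy ↦ h.jac_ne_zero _ (h.mapsTo_inv hy)
    exact h1.mul (h2.mul_const _)
  · intro y' hy'
    have hm : Measurable fun y ↦ K (Φ y) (Φ y') * ((J (Φ y))⁻¹ * conj (J (Φ y'))⁻¹) :=
      ((hK.measurable_left _).comp h.measurable_inv).mul (hjac.inv.mul_const _)
    refine memLp_two_iff.2 ⟨hm.aestronglyMeasurable, ?_⟩
    rw [h.lintegral_eq (hm.enorm.pow_const 2).aemeasurable]
    have h1 : ∫⁻ x in U, ‖J x‖ₑ ^ 2 *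
          ‖K (Φ (Ψ x)) (Φ y') * ((J (Φ (Ψ x)))⁻¹ * conj (J (Φ y'))⁻¹)‖ₑ ^ 2 =
        ∫⁻ x in U, ‖K x (Φ y')‖ₑ ^ 2 * ‖conj (J (Φ y'))⁻¹‖ₑ ^ 2 := by
      refine setLIntegral_congr_fun hU fun x hx ↦ ?_
      simp only [h.left_inv x hx]
      rw [← mul_pow, ← mul_pow, ← enorm_mul, ← enorm_mul]
      congr 2
      field_simp [h.jac_ne_zero x hx]
    rw [h1, lintegral_mul_const _ ((hK.measurable_left _).enorm.pow_const 2)]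
    refine ENNReal.mul_lt_top (memLp_two_iff.1 (hK.memLp _ (h.mapsTo_inv hy'))).2 ?_
    exact ENNReal.pow_lt_top enorm_lt_top
  · intro F hF hF2 y hy
    have hG : DifferentiableOn ℂ (fun x ↦ J x * F (Ψ x)) U :=
      h.holo_jac.mul (hF.comp h.holo h.mapsTo)
    have hG2 : MemLp (fun x ↦ J x * F (Ψ x)) 2 (volume.restrict U) := by
      refine memLp_two_iff.2 ⟨hG.continuousOn.aestronglyMeasurable hU, ?_⟩
      have h1 := (memLp_two_iff.1 hF2).2
      rw [h.lintegral_eq (hF2.1.enorm.pow_const 2)] at h1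
      simpa only [enorm_mul, mul_pow] using h1
    have h1 := hK.repr _ hG hG2 (Φ y) (h.mapsTo_inv hy)
    rw [h.right_inv y hy] at h1
    have hm : Measurable fun y' ↦ K (Φ y) (Φ y') * ((J (Φ y))⁻¹ * conj (J (Φ y'))⁻¹) :=
      ((hK.measurable_right _).comp h.measurable_inv).mul
        (Measurable.const_mul (Complex.continuous_conj.measurable.comp hjac.inv) _)
    have hm' : AEStronglyMeasurable (fun y' ↦ K (Φ y) (Φ y') *
        ((J (Φ y))⁻¹ * conj (J (Φ y'))⁻¹) * F y') (volume.restrict V) :=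
      hm.aestronglyMeasurable.mul hF2.1
    rw [h.integral_eq hm']
    have h2 : F y = (J (Φ y))⁻¹ * (J (Φ y) * F y) := by
      rw [inv_mul_cancel_left₀ (h.jac_ne_zero _ (h.mapsTo_inv hy))]
    rw [h2, h1, ← integral_const_mul]
    refine setIntegral_congr_fun hU fun x hx ↦ ?_
    have h3 := h.jac_ne_zero x hx
    have h4 : conj (J x) ≠ 0 := by simpa using h3
    simp only [h.left_inv x hx, map_inv₀]
    field_simp

/-- The kernel on the image has a factor `|J|⁻¹` in each variable, and the measure a factor `|J|²`; so
a subinvariant function `φ` on the image corresponds to `|J| φ ∘ Ψ`. -/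
lemma subinvariant (h : IsBiholomorphism U V Ψ Φ J) {K : X → X → ℂ}
    (hK : IsBergmanKernel U K) {φ : Y → ℝ≥0∞} (hφ : Measurable φ)
    (hs : Subinvariant U K fun x ↦ ‖J x‖ₑ * φ (Ψ x)) :
    Subinvariant V (fun y y' ↦ K (Φ y) (Φ y') * ((J (Φ y))⁻¹ * conj (J (Φ y'))⁻¹)) φ := by
  obtain ⟨C, hC⟩ := hs
  have hU := h.isOpen_source.measurableSet
  refine ⟨C, fun y hy ↦ ?_⟩
  have hJy := h.jac_ne_zero _ (h.mapsTo_inv hy)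
  have hm : Measurable fun y' ↦
      ‖K (Φ y) (Φ y') * ((J (Φ y))⁻¹ * conj (J (Φ y'))⁻¹)‖ₑ * φ y' :=
    ((h.isBergmanKernel hK).measurable_right y).enorm.mul hφ
  simp only
  rw [h.lintegral_eq hm.aemeasurable]
  have h1 : ∫⁻ x in U, ‖J x‖ₑ ^ 2 *
        (‖K (Φ y) (Φ (Ψ x)) * ((J (Φ y))⁻¹ * conj (J (Φ (Ψ x)))⁻¹)‖ₑ * φ (Ψ x)) =
      ∫⁻ x in U, ‖(J (Φ y))⁻¹‖ₑ * (‖K (Φ y) x‖ₑ * (‖J x‖ₑ * φ (Ψ x))) := by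
    refine setLIntegral_congr_fun hU fun x hx ↦ ?_
    have hJ : ‖J x‖ₑ * ‖(J x)⁻¹‖ₑ = 1 := by
      rw [← enorm_mul, mul_inv_cancel₀ (h.jac_ne_zero x hx), enorm_one]
    simp only [h.left_inv x hx, enorm_mul, RCLike.enorm_conj]
    calc _ = ‖(J (Φ y))⁻¹‖ₑ * (‖K (Φ y) x‖ₑ * (‖J x‖ₑ * φ (Ψ x))) * (‖J x‖ₑ * ‖(J x)⁻¹‖ₑ) := by
          ring
      _ = _ := by rw [hJ, mul_one]
  refine h1.trans_le ?_
  rw [lintegral_const_mul' _ _ enorm_ne_top]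
  refine (mul_le_mul_right (hC _ (h.mapsTo_inv hy)) _).trans (le_of_eq ?_)
  have hJ : ‖(J (Φ y))⁻¹‖ₑ * ‖J (Φ y)‖ₑ = 1 := by
    rw [← enorm_mul, inv_mul_cancel₀ hJy, enorm_one]
  simp only [h.right_inv y hy]
  calc _ = C * φ y * (‖(J (Φ y))⁻¹‖ₑ * ‖J (Φ y)‖ₑ) := by ring
    _ = _ := by rw [hJ, mul_one]

/-- A measure preserving linear isomorphism, restricted to an open set. -/
lemma of_continuousLinearEquiv (e : X ≃L[ℂ] Y) (he : MeasurePreserving e) {V : Set Y}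
    (hV : IsOpen V) : IsBiholomorphism (e ⁻¹' V) V e e.symm fun _ ↦ 1 where
  isOpen_source := hV.preimage e.continuous
  isOpen_target := hV
  mapsTo x hx := hx
  mapsTo_inv y hy := by simpa using hy
  left_inv x _ := e.symm_apply_apply x
  right_inv y _ := e.apply_symm_apply y
  holo := e.differentiableOn
  holo_inv := e.symm.differentiableOn
  holo_jac := differentiableOn_const 1
  jac_ne_zero _ _ := one_ne_zero
  measurable := e.continuous.measurable
  measurable_inv := e.symm.continuous.measurable
  measurable_jac := measurable_const
  map_eq := by
    simp only [nnnorm_one, one_pow, ENNReal.coe_one]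
    rw [withDensity_const, one_smul]
    exact (he.restrict_preimage hV.measurableSet).map_eq

end IsBiholomorphism

/-- The set `V` has a Bergman kernel to which Schur's test applies with the exponents `p`, `q`. -/
def HasSchurKernel (V : Set X) (p q : ℝ) : Prop :=
  ∃ (K : X → X → ℂ) (h : X → ℝ≥0∞), IsBergmanKernel V K ∧ IsSchurFunction V K p q h

lemma HasSchurKernel.prod {U : Set X} {V : Set Y} {p q : ℝ} (hp : 0 ≤ p) (hq : 0 ≤ q)
    (hU : HasSchurKernel U p q) (hV : HasSchurKernel V p q) : HasSchurKernel (U ×ˢ V) p q := by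
  obtain ⟨K, h, hK, hh⟩ := hU
  obtain ⟨K', h', hK', hh'⟩ := hV
  exact ⟨_, _, hK.prod hK', hh.prod hK hK' hp hq hh'⟩

lemma HasSchurKernel.of_preimage (e : X ≃L[ℂ] Y) (he : MeasurePreserving e) {V : Set Y}
    {p q : ℝ} (hV : IsOpen V) (h : HasSchurKernel (e ⁻¹' V) p q) : HasSchurKernel V p q := by
  obtain ⟨K, h, hK, hh⟩ := h
  have hb := IsBiholomorphism.of_continuousLinearEquiv e he hV
  have hm : Measurable fun y ↦ h (e.symm y) := hh.measurable.comp hb.measurable_inv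
  refine ⟨_, fun y ↦ h (e.symm y), hb.isBergmanKernel hK, hm,
    fun y hy ↦ hh.ne_zero _ (hb.mapsTo_inv hy), fun y hy ↦ hh.ne_top _ (hb.mapsTo_inv hy), ?_, ?_⟩
  · refine hb.subinvariant hK (hm.pow_const p) ?_
    simpa using hh.left
  · refine hb.subinvariant hK (hm.pow_const q) ?_
    simpa using hh.right

end Transfer

/-! ### Cones -/

/-- Change of variables for the multiplication of all coordinates by a complex number. -/
lemma map_smul_volume_pi {N : ℕ} {η : ℂ} (hη : η ≠ 0) :
    ∀ g : (Fin N → ℂ) → ℝ≥0∞, Measurable g →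
      ‖η‖ₑ ^ (2 * N) * ∫⁻ u, g (η • u) = ∫⁻ z, g z := by
  intro g hg
  have hr : ‖η‖ ≠ 0 := norm_ne_zero_iff.2 hη
  -- split off the rotation by `η / ‖η‖`
  let u : Circle := ⟨η / ‖η‖, by simp [Submonoid.unitSphere, hr]⟩
  have hu : η = (u : ℂ) * (‖η‖ : ℂ) := by
    have : ((‖η‖ : ℝ) : ℂ) ≠ 0 := by exact_mod_cast hr
    change η = η / ‖η‖ * ‖η‖
    field_simp
  have h1 : ∫⁻ x : Fin N → ℂ, g (η • x) = ∫⁻ x : Fin N → ℂ, g ((u : ℂ) • (‖η‖ • x)) := by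
    refine lintegral_congr fun x ↦ ?_
    congr 1
    conv_lhs => rw [hu]
    rw [mul_smul]
    rfl
  have h2 : ∫⁻ x : Fin N → ℂ, g ((u : ℂ) • x) = ∫⁻ x : Fin N → ℂ, g x :=
    (rotationInvariant_volume_pi N u).lintegral_comp hg
  have h3 := Measure.map_addHaar_smul (volume : Measure (Fin N → ℂ)) hr
  have hg' : Measurable fun x : Fin N → ℂ ↦ g ((u : ℂ) • x) :=
    hg.comp (measurable_const_smul _)
  have h4 : ∫⁻ x : Fin N → ℂ, g ((u : ℂ) • (‖η‖ • x)) =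
      ENNReal.ofReal |(‖η‖ ^ Module.finrank ℝ (Fin N → ℂ))⁻¹| * ∫⁻ x, g x := by
    rw [← h2, ← lintegral_map hg' (measurable_const_smul _), h3, lintegral_smul_measure]
    rfl
  have hfin : Module.finrank ℝ (Fin N → ℂ) = 2 * N := by
    simp [Module.finrank_pi_fintype, mul_comm]
  rw [h1, h4, hfin, ← mul_assoc]
  have h5 : ‖η‖ₑ ^ (2 * N) * ENNReal.ofReal |(‖η‖ ^ (2 * N))⁻¹| = 1 := by
    rw [← ofReal_norm, ← ENNReal.ofReal_pow (norm_nonneg _),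
      ← ENNReal.ofReal_mul (by positivity), abs_of_nonneg (by positivity),
      mul_inv_cancel₀ (by positivity), ENNReal.ofReal_one]
  rw [h5, one_mul]

/-- The open unit disc without its centre. -/
def puncturedDisc : Set ℂ := {w | w ≠ 0 ∧ ‖w‖ < 1}

lemma isOpen_puncturedDisc : IsOpen puncturedDisc := by
  refine IsOpen.inter isOpen_ne ?_
  exact isOpen_lt continuous_norm continuous_const

/-- The cone `{(z, ξ) : 0 < |ξ| < 1, z / ξ ∈ D}` over a set `D`. -/
def cone {N : ℕ} (D : Set (Fin N → ℂ)) : Set ((Fin N → ℂ) × ℂ) :=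
  {z | z.2 ∈ puncturedDisc ∧ z.2⁻¹ • z.1 ∈ D}

/-- The product of `D` with the punctured disc is biholomorphic to the cone over `D`, by
`(u, η) ↦ (η u, η)`. -/
lemma isBiholomorphism_cone {N : ℕ} {D : Set (Fin N → ℂ)} (hD : IsOpen D) :
    IsBiholomorphism (D ×ˢ puncturedDisc) (cone D) (fun x ↦ (x.2 • x.1, x.2))
      (fun z ↦ (z.2⁻¹ • z.1, z.2)) fun x ↦ x.2 ^ N := by
  have hinv : DifferentiableOn ℂ (fun z : (Fin N → ℂ) × ℂ ↦ z.2⁻¹ • z.1) {z | z.2 ≠ 0} := by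
    have h1 : DifferentiableOn ℂ (fun z : (Fin N → ℂ) × ℂ ↦ z.2⁻¹) {z | z.2 ≠ 0} :=
      DifferentiableOn.inv (by fun_prop) fun z hz ↦ hz
    exact h1.smul (by fun_prop)
  have hpre : (fun x : (Fin N → ℂ) × ℂ ↦ (x.2 • x.1, x.2)) ⁻¹' cone D = D ×ˢ puncturedDisc := by
    ext ⟨u, η⟩
    simp only [cone, Set.mem_preimage, Set.mem_ofPred_eq, Set.mem_prod]
    rw [and_comm]
    refine and_congr_left fun hη ↦ ?_
    rw [inv_smul_smul₀ hη.1]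
  have hopen : IsOpen (cone D) := by
    have h1 : IsOpen {z : (Fin N → ℂ) × ℂ | z.2 ≠ 0} :=
      isOpen_ne.preimage continuous_snd
    have h2 := hinv.continuousOn.isOpen_inter_preimage h1 hD
    have h3 := (isOpen_puncturedDisc.preimage
      (continuous_snd : Continuous (Prod.snd : (Fin N → ℂ) × ℂ → ℂ))).inter h2
    convert h3 using 1
    ext z
    simp only [cone, puncturedDisc, Set.mem_inter_iff, Set.mem_preimage, Set.mem_ofPred_eq]
    tauto
  have hmeas : Measurable fun x : (Fin N → ℂ) × ℂ ↦ (x.2 • x.1, x.2) := by fun_prop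
  refine ⟨hD.prod isOpen_puncturedDisc, hopen, fun x hx ↦ ?_, fun z hz ↦ ⟨hz.2, hz.1⟩,
    fun x hx ↦ ?_, fun z hz ↦ ?_, by fun_prop, ?_, by fun_prop, fun x hx ↦ pow_ne_zero _ hx.2.1,
    hmeas, by fun_prop, by fun_prop, ?_⟩
  · rw [← hpre] at hx; exact hx
  · simp [inv_smul_smul₀ hx.2.1]
  · simp [smul_inv_smul₀ hz.1.1]
  · exact (hinv.mono fun z hz ↦ hz.1.1).prodMk differentiableOn_snd
  · have hdens : Measurable fun x : (Fin N → ℂ) × ℂ ↦ ((‖x.2 ^ N‖₊ ^ 2 : ℝ≥0) : ℝ≥0∞) := by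
      fun_prop
    have hfull : ((volume : Measure ((Fin N → ℂ) × ℂ)).withDensity
        fun x ↦ ((‖x.2 ^ N‖₊ ^ 2 : ℝ≥0) : ℝ≥0∞)).map (fun x ↦ (x.2 • x.1, x.2)) = volume := by
      refine Measure.ext_of_lintegral _ fun g hg ↦ ?_
      have hgm : Measurable fun x : (Fin N → ℂ) × ℂ ↦ g (x.2 • x.1, x.2) := hg.comp hmeas
      rw [lintegral_map hg hmeas, lintegral_withDensity_eq_lintegral_mul _ hdens hgm,
        Measure.volume_eq_prod]
      rw [lintegral_prod_symm _ (hdens.mul hgm).aemeasurable,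
        lintegral_prod_symm _ hg.aemeasurable]
      have h0 : ∀ᵐ η : ℂ, η ≠ 0 := by
        simp [ae_iff, measure_singleton]
      refine lintegral_congr_ae ?_
      filter_upwards [h0] with η hη
      simp only [Pi.mul_apply]
      have hgη : Measurable fun u : Fin N → ℂ ↦ g (η • u, η) := hg.comp (by fun_prop)
      rw [lintegral_const_mul _ hgη, ← map_smul_volume_pi hη (fun z ↦ g (z, η)) (hg.comp (by fun_prop))]
      congr 1
      rw [ENNReal.coe_pow, nnnorm_pow, ENNReal.coe_pow, ← pow_mul, mul_comm]
      rfl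
    rw [← hpre, ← restrict_withDensity (hmeas hopen.measurableSet),
      ← Measure.restrict_map hmeas hopen.measurableSet, hfull]

/-! ### The unit disc -/

lemma measurable_norm_sq : Measurable fun z : ℂ ↦ ‖z‖ ^ 2 := by fun_prop

/-- Under `z ↦ |z|²`, Lebesgue measure on the unit disc becomes `π` times Lebesgue measure on the
unit interval. -/
lemma map_norm_sq_volume_disc :
    ((volume : Measure ℂ).restrict (ball 0 1)).map (fun z ↦ ‖z‖ ^ 2) =
      (NNReal.pi : ℝ≥0∞) • (volume : Measure ℝ).restrict (Set.Ioo 0 1) := by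
  have hfin : IsFiniteMeasure (((volume : Measure ℂ).restrict (ball 0 1)).map
      (fun z ↦ ‖z‖ ^ 2)) := by
    have : IsFiniteMeasure ((volume : Measure ℂ).restrict (ball 0 1)) :=
      ⟨by simp⟩
    infer_instance
  refine Measure.ext_of_Iic _ _ fun x ↦ ?_
  rw [Measure.map_apply measurable_norm_sq measurableSet_Iic,
    Measure.restrict_apply (measurable_norm_sq measurableSet_Iic), Measure.smul_apply,
    Measure.restrict_apply measurableSet_Iic, smul_eq_mul]
  rcases lt_or_ge x 0 with hx | hx
  · have h1 : (fun z : ℂ ↦ ‖z‖ ^ 2) ⁻¹' Set.Iic x ∩ ball 0 1 = ∅ := by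
      ext z
      simp only [Set.mem_inter_iff, Set.mem_preimage, Set.mem_Iic, Set.mem_empty_iff_false,
        iff_false, not_and]
      intro h
      nlinarith [sq_nonneg ‖z‖]
    have h2 : Set.Iic x ∩ Set.Ioo 0 1 = ∅ := by
      ext y
      simp only [Set.mem_inter_iff, Set.mem_Iic, Set.mem_Ioo, Set.mem_empty_iff_false, iff_false]
      intro h
      linarith [h.1, h.2.1]
    rw [h1, h2]
    simp
  rcases lt_or_ge x 1 with hx1 | hx1
  · have h1 : (fun z : ℂ ↦ ‖z‖ ^ 2) ⁻¹' Set.Iic x ∩ ball 0 1 = closedBall 0 (√x) := by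
      ext z
      simp only [Set.mem_inter_iff, Set.mem_preimage, Set.mem_Iic, mem_ball_zero_iff,
        mem_closedBall_zero_iff]
      rw [Real.le_sqrt (norm_nonneg _) hx]
      refine ⟨fun h ↦ h.1, fun h ↦ ⟨h, ?_⟩⟩
      nlinarith [norm_nonneg z]
    have h2 : Set.Iic x ∩ Set.Ioo 0 1 = Set.Ioc 0 x := by
      ext y
      simp only [Set.mem_inter_iff, Set.mem_Iic, Set.mem_Ioo, Set.mem_Ioc]
      constructor
      · rintro ⟨a, b, c⟩; exact ⟨b, a⟩
      · rintro ⟨a, b⟩; exact ⟨b, a, by linarith⟩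
    rw [h1, h2, Complex.volume_closedBall, Real.volume_Ioc, sub_zero,
      ← ENNReal.ofReal_pow (Real.sqrt_nonneg _), Real.sq_sqrt hx, mul_comm]
  · have h1 : (fun z : ℂ ↦ ‖z‖ ^ 2) ⁻¹' Set.Iic x ∩ ball 0 1 = ball 0 1 := by
      ext z
      simp only [Set.mem_inter_iff, Set.mem_preimage, Set.mem_Iic, mem_ball_zero_iff,
        and_iff_right_iff_imp]
      intro h
      nlinarith [norm_nonneg z]
    have h2 : Set.Iic x ∩ Set.Ioo 0 1 = Set.Ioo 0 1 := by
      ext y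
      simp only [Set.mem_inter_iff, Set.mem_Iic, Set.mem_Ioo, and_iff_right_iff_imp]
      intro h
      linarith [h.2]
    rw [h1, h2, Complex.volume_ball, Real.volume_Ioo]
    simp

lemma integral_disc_norm_sq {φ : ℝ → ℝ} (hφ : Measurable φ) :
    ∫ z in ball (0 : ℂ) 1, φ (‖z‖ ^ 2) = Real.pi * ∫ x in (0 : ℝ)..1, φ x := by
  rw [← integral_map measurable_norm_sq.aemeasurable (f := φ) hφ.aestronglyMeasurable,
    map_norm_sq_volume_disc, integral_smul_measure, intervalIntegral.integral_of_le zero_le_one,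
    integral_Ioc_eq_integral_Ioo]
  simp

lemma lintegral_disc_norm_sq {φ : ℝ → ℝ≥0∞} (hφ : Measurable φ) :
    ∫⁻ z in ball (0 : ℂ) 1, φ (‖z‖ ^ 2) = NNReal.pi * ∫⁻ x in Set.Ioo (0 : ℝ) 1, φ x := by
  rw [← lintegral_map hφ measurable_norm_sq, map_norm_sq_volume_disc, lintegral_smul_measure]
  rfl

/-- Recursion for the Beta integrals `∫₀¹ (1 - x)^α x^m dx`. -/
lemma beta_recursion (α m : ℕ) :
    ((m : ℝ) + 1) * ∫ x in (0 : ℝ)..1, (1 - x) ^ α * x ^ m =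
      ((m : ℝ) + α + 2) * ∫ x in (0 : ℝ)..1, (1 - x) ^ α * x ^ (m + 1) := by
  have h1 : ∀ x : ℝ, HasDerivAt (fun x : ℝ ↦ (1 - x) ^ (α + 1) * x ^ (m + 1))
      ((m + 1) * ((1 - x) ^ α * x ^ m) - (m + α + 2) * ((1 - x) ^ α * x ^ (m + 1))) x := by
    intro x
    have ha : HasDerivAt (fun x : ℝ ↦ (1 - x) ^ (α + 1)) (((α + 1 : ℕ) : ℝ) * (1 - x) ^ α * (-1)) x := by
      exact ((hasDerivAt_id' x).const_sub 1).fun_pow (α + 1)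
    have hb : HasDerivAt (fun x : ℝ ↦ x ^ (m + 1)) (((m + 1 : ℕ) : ℝ) * x ^ m) x := by
      simpa using hasDerivAt_pow (m + 1) x
    convert! ha.mul hb using 1
    push_cast
    ring
  have h2 := intervalIntegral.integral_eq_sub_of_hasDerivAt (a := 0) (b := 1)
    (fun x _ ↦ h1 x) (Continuous.intervalIntegrable (by fun_prop) _ _)
  rw [intervalIntegral.integral_sub (Continuous.intervalIntegrable (by fun_prop) _ _)
    (Continuous.intervalIntegrable (by fun_prop) _ _), intervalIntegral.integral_const_mul,
    intervalIntegral.integral_const_mul] at h2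
  simp at h2
  linarith

/-- The Taylor coefficients of `(1 - x)^{-(α + 2)}` are the inverses of the normalized Beta integrals.
This is what makes the weighted kernel of the disc reproducing. -/
lemma choose_mul_beta (α m : ℕ) :
    ((m + (α + 1)).choose (α + 1) : ℝ) * ∫ x in (0 : ℝ)..1, (1 - x) ^ α * x ^ m =
      ∫ x in (0 : ℝ)..1, (1 - x) ^ α := by
  induction m with
  | zero => simp
  | succ m ih =>
    have h1 := beta_recursion α m
    have h2 := Nat.choose_mul_succ_eq (m + (α + 1)) (α + 1)
    have h3 : m + (α + 1) + 1 - (α + 1) = m + 1 := by omega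
    rw [h3] at h2
    have h4 : ((m + (α + 1)).choose (α + 1) : ℝ) * ((m : ℝ) + α + 2) =
        ((m + 1 + (α + 1)).choose (α + 1) : ℝ) * (m + 1) := by
      have := congrArg (Nat.cast : ℕ → ℝ) h2
      push_cast at this
      rw [show m + 1 + (α + 1) = m + (α + 1) + 1 by ring]
      linarith
    have h5 : (m : ℝ) + 1 ≠ 0 := by positivity
    have h6 : (m : ℝ) + α + 2 ≠ 0 := by positivity
    rw [← ih]
    apply mul_left_cancel₀ h5
    set A := ∫ x in (0 : ℝ)..1, (1 - x) ^ α * x ^ m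
    set B := ∫ x in (0 : ℝ)..1, (1 - x) ^ α * x ^ (m + 1)
    calc _ = ((m + 1 + (α + 1)).choose (α + 1) : ℝ) * (m + 1) * B := by ring
      _ = ((m + (α + 1)).choose (α + 1) : ℝ) * (((m : ℝ) + α + 2) * B) := by rw [← h4]; ring
      _ = _ := by rw [← h1]; ring

/-- Averaging over the rotations of a point is averaging over the circle through it. -/
lemma circleAverage_mul_right (h : ℂ → ℂ) (v : ℂ) :
    Real.circleAverage (fun c ↦ h (c * v)) 0 1 = Real.circleAverage h 0 ‖v‖ := by
  rw [Real.circleAverage_eq_integral_add (f := h) (Complex.arg v), Real.circleAverage]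
  congr 1
  refine intervalIntegral.integral_congr fun θ _ ↦ congrArg h ?_
  conv_lhs => rw [← Complex.norm_mul_exp_arg_mul_I v]
  simp only [circleMap, zero_add, Complex.ofReal_one, one_mul, Complex.ofReal_add, add_mul,
    Complex.exp_add]
  ring

/-- Averaging over rotations against `conj v ^ m` extracts the `m`-th Taylor coefficient. -/
lemma circleAverage_mul_conj_pow {f : ℂ → ℂ} (hf : DifferentiableOn ℂ f (ball 0 1)) (m : ℕ)
    {v : ℂ} (hv : v ∈ ball (0 : ℂ) 1) :
    Real.circleAverage (fun c ↦ f (c * v) * conj (c * v) ^ m) 0 1 =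
      ((m.factorial : ℂ)⁻¹ * iteratedDeriv m f 0) * (((‖v‖ ^ 2) ^ m : ℝ) : ℂ) := by
  rw [circleAverage_mul_right (fun w ↦ f w * conj w ^ m)]
  rcases eq_or_ne v 0 with rfl | hv0
  · rcases m with _ | m <;> simp
  have hr : 0 < ‖v‖ := norm_pos_iff.2 hv0
  have hr' : (‖v‖ : ℂ) ≠ 0 := by exact_mod_cast hr.ne'
  have hsub : closedBall (0 : ℂ) ‖v‖ ⊆ ball 0 1 := closedBall_subset_ball (by simpa using hv)
  have h1 := (hf.mono hsub).circleIntegral_one_div_sub_center_pow_smul hr m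
  rw [Real.circleAverage_eq_circleIntegral hr.ne']
  have h2 : (∮ z in C(0, ‖v‖), (z - 0)⁻¹ • (f z * conj z ^ m)) =
      ∮ z in C(0, ‖v‖), (((‖v‖ ^ 2) ^ m : ℝ) : ℂ) * ((1 / (z - 0) ^ (m + 1)) • f z) := by
    refine circleIntegral.integral_congr hr.le fun z hz ↦ ?_
    have hz' : ‖z‖ = ‖v‖ := by simpa using hz
    have hz0 : z ≠ 0 := by rw [← norm_ne_zero_iff, hz']; exact hr.ne'
    have h3 : z * conj z = ((‖v‖ ^ 2 : ℝ) : ℂ) := by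
      rw [Complex.mul_conj, Complex.normSq_eq_norm_sq, hz']
    have h4 : (((‖v‖ ^ 2) ^ m : ℝ) : ℂ) = z ^ m * conj z ^ m := by
      rw [← mul_pow, h3]
      push_cast
      rfl
    simp only [sub_zero, smul_eq_mul]
    rw [h4, pow_succ]
    field_simp
  rw [h2, circleIntegral.integral_const_mul, h1]
  have h5 : (2 * (Real.pi : ℂ) * Complex.I) ≠ 0 := Complex.two_pi_I_ne_zero
  simp only [smul_eq_mul]
  field_simp

/-- Reproducing formula for the disc with the weight `(1 - |v|²)^α`. The kernel is expanded in
powers of `t * conj v`, and each power extracts a Taylor coefficient. -/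
lemma disc_reproducing (α : ℕ) {f : ℂ → ℂ} (hf : DifferentiableOn ℂ f (ball 0 1))
    (hi : IntegrableOn (fun v ↦ f v * (((1 - ‖v‖ ^ 2) ^ α : ℝ) : ℂ)) (ball 0 1)) {t : ℂ}
    (ht : ‖t‖ < 1) :
    ∫ v in ball (0 : ℂ) 1, f v * (((1 - ‖v‖ ^ 2) ^ α : ℝ) : ℂ) * (1 / (1 - t * conj v) ^ (α + 2)) =
      f t * ((∫ v in ball (0 : ℂ) 1, (1 - ‖v‖ ^ 2) ^ α : ℝ) : ℂ) := by
  set g : ℂ → ℂ := fun v ↦ f v * (((1 - ‖v‖ ^ 2) ^ α : ℝ) : ℂ) with hg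
  set G : ℕ → ℂ → ℂ := fun m v ↦
    g v * (((m + (α + 1)).choose (α + 1) : ℂ) * (t * conj v) ^ m) with hG
  have hball : MeasurableSet (ball (0 : ℂ) 1) := measurableSet_ball
  have hbd : ∀ m, ∀ v ∈ ball (0 : ℂ) 1,
      ‖((m + (α + 1)).choose (α + 1) : ℂ) * (t * conj v) ^ m‖ ≤
        ((m + (α + 1)).choose (α + 1) : ℝ) * ‖t‖ ^ m := by
    intro m v hv
    rw [norm_mul, norm_pow, norm_mul, RCLike.norm_conj, Complex.norm_natCast]
    have : ‖v‖ < 1 := by simpa using hv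
    gcongr
    nlinarith [norm_nonneg t, norm_nonneg v]
  have hGint : ∀ m, IntegrableOn (G m) (ball 0 1) := by
    intro m
    refine Integrable.mul_bdd (c := ((m + (α + 1)).choose (α + 1) : ℝ) * ‖t‖ ^ m) hi
      (Continuous.aestronglyMeasurable (by fun_prop)) ?_
    filter_upwards [ae_restrict_mem hball] with v hv using hbd m v hv
  have hsum : Summable fun m ↦ ∫ v in ball (0 : ℂ) 1, ‖G m v‖ := by
    have h1 : Summable fun m : ℕ ↦ ((m + (α + 1)).choose (α + 1) : ℝ) * ‖t‖ ^ m :=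
      (hasSum_choose_mul_geometric_of_norm_lt_one (α + 1) (r := ‖t‖) (by simpa using ht)).summable
    refine Summable.of_nonneg_of_le (fun m ↦ integral_nonneg fun _ ↦ norm_nonneg _) (fun m ↦ ?_)
      (h1.mul_left (∫ v in ball (0 : ℂ) 1, ‖g v‖))
    rw [← integral_mul_const]
    refine setIntegral_mono_on (hGint m).norm (hi.norm.mul_const _) hball fun v hv ↦ ?_
    rw [hG, norm_mul]
    exact mul_le_mul_of_nonneg_left (hbd m v hv) (norm_nonneg _)
  have hterm : ∀ m, ∫ v in ball (0 : ℂ) 1, G m v =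
      ((m.factorial : ℂ)⁻¹ • (t - 0) ^ m • iteratedDeriv m f 0) *
        ((∫ v in ball (0 : ℂ) 1, (1 - ‖v‖ ^ 2) ^ α : ℝ) : ℂ) := by
    intro m
    have hrot : RotationInvariant ((volume : Measure ℂ).restrict (ball 0 1)) :=
      rotationInvariant_volume_complex.restrict hball fun c z ↦ by
        simp [Circle.norm_coe]
    have h1 := hrot.integral_eq (hGint m)
    rw [h1]
    have h2 : ∀ v ∈ ball (0 : ℂ) 1, Real.circleAverage (fun c ↦ G m (c • v)) 0 1 =
        (((m + (α + 1)).choose (α + 1) : ℂ) * t ^ m * ((m.factorial : ℂ)⁻¹ * iteratedDeriv m f 0)) *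
          (((1 - ‖v‖ ^ 2) ^ α * (‖v‖ ^ 2) ^ m : ℝ) : ℂ) := by
      intro v hv
      have h3 : Real.circleAverage (fun c ↦ G m (c • v)) 0 1 =
          Real.circleAverage (fun c ↦ ((((1 - ‖v‖ ^ 2) ^ α : ℝ) : ℂ) *
            (((m + (α + 1)).choose (α + 1) : ℂ) * t ^ m)) •
              (f (c * v) * conj (c * v) ^ m)) 0 1 := by
        refine Real.circleAverage_congr_sphere fun c hc ↦ ?_
        have hc1 : ‖c‖ = 1 := by simpa using hc
        simp only [hG, hg, smul_eq_mul, norm_mul, hc1, one_mul]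
        ring
      rw [h3, Real.circleAverage_fun_smul, circleAverage_mul_conj_pow hf m hv, smul_eq_mul]
      push_cast
      ring
    rw [setIntegral_congr_fun hball h2, integral_const_mul, integral_complex_ofReal,
      integral_disc_norm_sq (φ := fun x ↦ (1 - x) ^ α * x ^ m) (by fun_prop),
      integral_disc_norm_sq (φ := fun x ↦ (1 - x) ^ α) (by fun_prop), ← choose_mul_beta α m]
    simp only [sub_zero, smul_eq_mul]
    push_cast
    ring
  have h1 := hasSum_integral_of_summable_integral_norm hGint hsum
  have h2 : ∀ v ∈ ball (0 : ℂ) 1, ∑' m, G m v = g v * (1 / (1 - t * conj v) ^ (α + 2)) := by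
    intro v hv
    have hv1 : ‖v‖ < 1 := by simpa using hv
    have h3 : ‖t * conj v‖ < 1 := by
      rw [norm_mul, RCLike.norm_conj]
      nlinarith [norm_nonneg t, norm_nonneg v]
    exact ((hasSum_choose_mul_geometric_of_norm_lt_one (α + 1) h3).mul_left (g v)).tsum_eq
  rw [setIntegral_congr_fun hball h2] at h1
  simp_rw [hterm] at h1
  have h3 := (Complex.hasSum_taylorSeries_on_ball hf (z := t) (by simpa using ht)).mul_right
    ((∫ v in ball (0 : ℂ) 1, (1 - ‖v‖ ^ 2) ^ α : ℝ) : ℂ)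
  exact h1.unique h3

lemma one_sub_mul_conj_ne_zero {t v : ℂ} (ht : ‖t‖ < 1) (hv : ‖v‖ < 1) : 1 - t * conj v ≠ 0 := by
  intro h
  have h1 : ‖t * conj v‖ = 1 := by rw [← sub_eq_zero.1 h, norm_one]
  rw [norm_mul, RCLike.norm_conj] at h1
  nlinarith [norm_nonneg t, norm_nonneg v]

/-- The integral of the Poisson kernel, up to its normalization, over the unit circle. -/
lemma lintegral_circle_poisson {a : ℂ} (ha : ‖a‖ < 1) :
    ∫⁻ θ in Set.Ioc 0 (2 * Real.pi), ‖1 / (1 - a * conj (circleMap 0 1 θ)) ^ 2‖ₑ =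
      ENNReal.ofReal (2 * Real.pi) * ENNReal.ofReal (1 / (1 - ‖a‖ ^ 2)) := by
  have ha2 : 0 < 1 - ‖a‖ ^ 2 := by nlinarith [norm_nonneg a]
  have hne : ∀ c : ℂ, ‖c‖ ≤ 1 → 1 - conj a * c ≠ 0 := by
    intro c hc h
    have h1 : ‖conj a * c‖ = 1 := by rw [← sub_eq_zero.1 h, norm_one]
    rw [norm_mul, RCLike.norm_conj] at h1
    nlinarith [norm_nonneg a, norm_nonneg c]
  set h : ℂ → ℂ := fun c ↦ (1 + conj a * c) / (1 - conj a * c) with hh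
  have hd : DifferentiableOn ℂ h (closedBall 0 1) :=
    DifferentiableOn.div (by fun_prop) (by fun_prop) fun c hc ↦ hne c (by simpa using hc)
  have hav : Real.circleAverage h 0 1 = 1 := by
    have : DiffContOnCl ℂ h (ball 0 |1|) := by
      apply DifferentiableOn.diffContOnCl
      rw [abs_one]
      exact hd.mono closure_ball_subset_closedBall
    rw [this.circleAverage]
    simp [hh]
  have hcont : Continuous fun θ : ℝ ↦ h (circleMap 0 1 θ) := by
    refine hd.continuousOn.comp_continuous (continuous_circleMap 0 1) fun θ ↦ ?_
    simp
  have hre : ∀ θ : ℝ, ‖1 / (1 - a * conj (circleMap 0 1 θ)) ^ 2‖ =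
      (1 / (1 - ‖a‖ ^ 2)) * (h (circleMap 0 1 θ)).re := by
    intro θ
    set c := circleMap 0 1 θ with hc
    have hc1 : ‖c‖ = 1 := by simp [hc]
    have h1 := hne c hc1.le
    have h2 : ‖1 - a * conj c‖ = ‖1 - conj a * c‖ := by
      rw [← RCLike.norm_conj]
      simp
    have h3 : (h c).re = (1 - ‖a‖ ^ 2) / ‖1 - conj a * c‖ ^ 2 := by
      have h4 : h c = ((1 + conj a * c) * conj (1 - conj a * c)) /
          ((‖1 - conj a * c‖ ^ 2 : ℝ) : ℂ) := by
        rw [← Complex.normSq_eq_norm_sq, ← Complex.mul_conj]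
        have h5 : conj (1 - conj a * c) ≠ 0 := by
          rw [Ne, map_eq_zero]
          exact h1
        rw [hh]
        field_simp
      rw [h4, Complex.div_ofReal_re]
      congr 1
      have h6 : ‖conj a * c‖ ^ 2 = ‖a‖ ^ 2 := by rw [norm_mul, RCLike.norm_conj, hc1, mul_one]
      rw [← h6, ← Complex.normSq_eq_norm_sq, Complex.normSq_apply]
      simp only [map_sub, map_one, Complex.mul_re, Complex.add_re, Complex.one_re, Complex.sub_re,
        Complex.add_im, Complex.one_im, Complex.sub_im, Complex.conj_re, Complex.conj_im]
      ring
    rw [h3, norm_div, norm_pow, norm_one, h2]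
    field_simp
  have hint : IntervalIntegrable (fun θ ↦ h (circleMap 0 1 θ)) volume 0 (2 * Real.pi) :=
    hcont.intervalIntegrable _ _
  have hintre : Continuous fun θ : ℝ ↦ (1 / (1 - ‖a‖ ^ 2)) * (h (circleMap 0 1 θ)).re :=
    (Complex.continuous_re.comp hcont).const_mul _
  have hval : ∫ θ in (0 : ℝ)..2 * Real.pi, (h (circleMap 0 1 θ)).re = 2 * Real.pi := by
    have h1 := Complex.reCLM.intervalIntegral_comp_comm hint
    simp only [Complex.reCLM_apply] at h1
    rw [h1]
    have h2 : ∫ θ in (0 : ℝ)..2 * Real.pi, h (circleMap 0 1 θ) = 2 * Real.pi := by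
      rw [Real.circleAverage, inv_smul_eq_iff₀ Real.two_pi_pos.ne'] at hav
      rw [hav]
      simp
    rw [h2]
    simp
  calc ∫⁻ θ in Set.Ioc 0 (2 * Real.pi), ‖1 / (1 - a * conj (circleMap 0 1 θ)) ^ 2‖ₑ
      = ∫⁻ θ in Set.Ioc 0 (2 * Real.pi),
          ENNReal.ofReal ((1 / (1 - ‖a‖ ^ 2)) * (h (circleMap 0 1 θ)).re) := by
        refine lintegral_congr fun θ ↦ ?_
        rw [← hre, ofReal_norm]
    _ = ENNReal.ofReal (∫ θ in Set.Ioc 0 (2 * Real.pi),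
          (1 / (1 - ‖a‖ ^ 2)) * (h (circleMap 0 1 θ)).re) := by
        rw [ofReal_integral_eq_lintegral_ofReal]
        · exact (hintre.integrableOn_Ioc)
        · exact ae_of_all _ fun θ ↦ by
            simp only [Pi.zero_apply]
            rw [← hre]; exact norm_nonneg _
    _ = _ := by
        rw [← intervalIntegral.integral_of_le Real.two_pi_pos.le,
          intervalIntegral.integral_const_mul, hval, mul_comm, ENNReal.ofReal_mul (by positivity)]

lemma lintegral_rpow_Ioo_lt_top {b : ℝ} (hb : -1 < b) :
    ∫⁻ x in Set.Ioo (0 : ℝ) 1, ENNReal.ofReal (x ^ b) < ∞ := by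
  have h1 := (intervalIntegral.intervalIntegrable_rpow' (a := 0) (b := 1) hb)
  rw [intervalIntegrable_iff_integrableOn_Ioo_of_le zero_le_one] at h1
  rw [← ofReal_integral_eq_lintegral_ofReal h1]
  · exact ENNReal.ofReal_lt_top
  · filter_upwards [ae_restrict_mem measurableSet_Ioo] with x hx
    exact Real.rpow_nonneg hx.1.le _

lemma lintegral_one_sub {φ : ℝ → ℝ≥0∞} :
    ∫⁻ x in Set.Ioo (0 : ℝ) 1, φ (1 - x) = ∫⁻ x in Set.Ioo (0 : ℝ) 1, φ x := by
  have h1 := (Measure.measurePreserving_sub_left (volume : Measure ℝ) 1).setLIntegral_comp_preimage_emb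
    (MeasurableEquiv.subLeft (1 : ℝ)).measurableEmbedding φ (Set.Ioo 0 1)
  rw [← h1]
  congr 2
  ext x
  simp only [Set.mem_preimage, Set.mem_Ioo]
  constructor <;> rintro ⟨a, b⟩ <;> constructor <;> linarith

/-- The one-variable integral behind the Forelli–Rudin estimate. -/
lemma lintegral_forelliRudin_le {σ δ : ℝ} (hσ : 0 < σ) (hσ1 : σ < 1) (hδ : 0 < δ) :
    ∫⁻ y in Set.Ioo (0 : ℝ) 1, ENNReal.ofReal (y ^ (-σ) / max y δ) ≤
      ENNReal.ofReal ((1 / (1 - σ) + 1 / σ) * δ ^ (-σ)) := by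
  have hsub : Set.Ioo (0 : ℝ) 1 ⊆ Set.Ioc 0 δ ∪ Set.Ioi δ := by
    intro y hy
    rcases le_or_gt y δ with h | h
    · exact Or.inl ⟨hy.1, h⟩
    · exact Or.inr h
  have hA : IntegrableOn (fun y : ℝ ↦ y ^ (-σ) * δ⁻¹) (Set.Ioc 0 δ) := by
    have h1 := (intervalIntegral.intervalIntegrable_rpow' (a := 0) (b := δ)
      (show -1 < -σ by linarith))
    rw [intervalIntegrable_iff_integrableOn_Ioc_of_le hδ.le] at h1
    exact h1.mul_const _
  have hB : IntegrableOn (fun y : ℝ ↦ y ^ (-σ - 1)) (Set.Ioi δ) :=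
    integrableOn_Ioi_rpow_of_lt (by linarith) hδ
  have hA' : ∫ y in Set.Ioc 0 δ, y ^ (-σ) * δ⁻¹ = 1 / (1 - σ) * δ ^ (-σ) := by
    rw [integral_mul_const, ← intervalIntegral.integral_of_le hδ.le,
      integral_rpow (Or.inl (by linarith)), Real.zero_rpow (by linarith), sub_zero,
      show -σ + 1 = 1 - σ by ring, show δ ^ (1 - σ) = δ * δ ^ (-σ) by
        rw [sub_eq_add_neg, Real.rpow_add hδ, Real.rpow_one]]
    have : 1 - σ ≠ 0 := by linarith
    field_simp
  have hB' : ∫ y in Set.Ioi δ, y ^ (-σ - 1) = 1 / σ * δ ^ (-σ) := by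
    rw [integral_Ioi_rpow_of_lt (by linarith) hδ, show -σ - 1 + 1 = -σ by ring]
    field_simp
  calc ∫⁻ y in Set.Ioo (0 : ℝ) 1, ENNReal.ofReal (y ^ (-σ) / max y δ)
      ≤ ∫⁻ y in Set.Ioc 0 δ ∪ Set.Ioi δ, ENNReal.ofReal (y ^ (-σ) / max y δ) :=
        lintegral_mono_set hsub
    _ ≤ (∫⁻ y in Set.Ioc 0 δ, ENNReal.ofReal (y ^ (-σ) / max y δ)) +
          ∫⁻ y in Set.Ioi δ, ENNReal.ofReal (y ^ (-σ) / max y δ) := lintegral_union_le _ _ _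
    _ ≤ (∫⁻ y in Set.Ioc 0 δ, ENNReal.ofReal (y ^ (-σ) * δ⁻¹)) +
          ∫⁻ y in Set.Ioi δ, ENNReal.ofReal (y ^ (-σ - 1)) := by
        gcongr 1
        · refine setLIntegral_mono' measurableSet_Ioc fun y hy ↦ ENNReal.ofReal_le_ofReal ?_
          rw [div_eq_mul_inv]
          exact mul_le_mul_of_nonneg_left (inv_anti₀ hδ (le_max_right _ _))
            (Real.rpow_nonneg hy.1.le _)
        · refine setLIntegral_mono' measurableSet_Ioi fun y hy ↦ ENNReal.ofReal_le_ofReal ?_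
          have hy0 : 0 < y := hδ.trans hy
          rw [Real.rpow_sub_one hy0.ne']
          exact div_le_div_of_nonneg_left (Real.rpow_nonneg hy0.le _) hy0 (le_max_left _ _)
    _ = ENNReal.ofReal (1 / (1 - σ) * δ ^ (-σ)) + ENNReal.ofReal (1 / σ * δ ^ (-σ)) := by
        rw [← hA', ← hB', ofReal_integral_eq_lintegral_ofReal hA,
          ofReal_integral_eq_lintegral_ofReal hB]
        · filter_upwards [ae_restrict_mem measurableSet_Ioi] with y hy
          exact Real.rpow_nonneg (hδ.trans hy).le _
        · filter_upwards [ae_restrict_mem measurableSet_Ioc] with y hy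
          exact mul_nonneg (Real.rpow_nonneg hy.1.le _) (inv_nonneg.2 hδ.le)
    _ = _ := by
        have : 0 < 1 - σ := by linarith
        rw [← ENNReal.ofReal_add (by positivity) (by positivity), add_mul]

lemma lintegral_disc_weight_lt_top {σ : ℝ} (hσ1 : σ < 1) :
    ∫⁻ v in ball (0 : ℂ) 1, ENNReal.ofReal (1 - ‖v‖ ^ 2) ^ (-σ) < ∞ := by
  rw [lintegral_disc_norm_sq (φ := fun x ↦ ENNReal.ofReal (1 - x) ^ (-σ)) (by fun_prop),
    lintegral_one_sub (φ := fun x ↦ ENNReal.ofReal x ^ (-σ))]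
  refine ENNReal.mul_lt_top ENNReal.coe_lt_top ?_
  refine lt_of_le_of_lt (le_of_eq ?_) (lintegral_rpow_Ioo_lt_top (show -1 < -σ by linarith))
  refine setLIntegral_congr_fun measurableSet_Ioo fun x hx ↦ ?_
  exact ENNReal.ofReal_rpow_of_pos hx.1

/-- **Forelli–Rudin estimate** on the unit disc. -/
lemma disc_forelliRudin {σ : ℝ} (hσ : 0 < σ) (hσ1 : σ < 1) :
    ∃ C : ℝ≥0, ∀ t ∈ ball (0 : ℂ) 1,
      ∫⁻ v in ball (0 : ℂ) 1, ‖1 / (1 - t * conj v) ^ 2‖ₑ * ENNReal.ofReal (1 - ‖v‖ ^ 2) ^ (-σ) ≤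
        C * ENNReal.ofReal (1 - ‖t‖ ^ 2) ^ (-σ) := by
  have hσ2 : 0 < 1 - σ := by linarith
  refine ⟨NNReal.pi * Real.toNNReal (1 / (1 - σ) + 1 / σ), fun t ht ↦ ?_⟩
  have ht1 : ‖t‖ < 1 := by simpa using ht
  have hδ : 0 < 1 - ‖t‖ ^ 2 := by nlinarith [norm_nonneg t]
  have hrot : RotationInvariant ((volume : Measure ℂ).restrict (ball 0 1)) :=
    rotationInvariant_volume_complex.restrict measurableSet_ball fun c z ↦ by
      simp [Circle.norm_coe]
  have hm : Measurable fun v : ℂ ↦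
      ‖1 / (1 - t * conj v) ^ 2‖ₑ * ENNReal.ofReal (1 - ‖v‖ ^ 2) ^ (-σ) := by
    have : Measurable fun v : ℂ ↦ conj v := Complex.continuous_conj.measurable
    fun_prop
  have h1 := hrot.lintegral_eq hm
  have h2 : ∀ v ∈ ball (0 : ℂ) 1, ∫⁻ θ in Set.Ioc 0 (2 * Real.pi),
      ‖1 / (1 - t * conj (circleMap 0 1 θ • v)) ^ 2‖ₑ *
        ENNReal.ofReal (1 - ‖circleMap 0 1 θ • v‖ ^ 2) ^ (-σ) =
      ENNReal.ofReal (2 * Real.pi) * (ENNReal.ofReal (1 / (1 - ‖t‖ ^ 2 * ‖v‖ ^ 2)) *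
        ENNReal.ofReal (1 - ‖v‖ ^ 2) ^ (-σ)) := by
    intro v hv
    have hv1 : ‖v‖ < 1 := by simpa using hv
    have ha : ‖t * conj v‖ < 1 := by
      rw [norm_mul, RCLike.norm_conj]
      nlinarith [norm_nonneg t, norm_nonneg v]
    have h3 : ∀ θ : ℝ, ‖1 / (1 - t * conj (circleMap 0 1 θ • v)) ^ 2‖ₑ *
        ENNReal.ofReal (1 - ‖circleMap 0 1 θ • v‖ ^ 2) ^ (-σ) =
        ‖1 / (1 - (t * conj v) * conj (circleMap 0 1 θ)) ^ 2‖ₑ *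
          ENNReal.ofReal (1 - ‖v‖ ^ 2) ^ (-σ) := by
      intro θ
      rw [norm_smul, norm_circleMap_zero, abs_one, one_mul, smul_eq_mul, map_mul,
        mul_comm (conj (circleMap 0 1 θ)), mul_assoc]
    simp_rw [h3]
    rw [lintegral_mul_const _ (by
      have : Measurable fun v : ℂ ↦ conj v := Complex.continuous_conj.measurable
      have : Measurable fun θ : ℝ ↦ circleMap 0 1 θ := (continuous_circleMap 0 1).measurable
      fun_prop), lintegral_circle_poisson ha, norm_mul, RCLike.norm_conj, mul_pow, mul_assoc]
  rw [setLIntegral_congr_fun measurableSet_ball h2,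
    lintegral_const_mul' _ _ ENNReal.ofReal_ne_top] at h1
  have h4 := (ENNReal.mul_right_inj (by simpa using Real.two_pi_pos) ENNReal.ofReal_ne_top).1 h1
  rw [h4, lintegral_disc_norm_sq
    (φ := fun x ↦ ENNReal.ofReal (1 / (1 - ‖t‖ ^ 2 * x)) * ENNReal.ofReal (1 - x) ^ (-σ))
    (by fun_prop), ENNReal.coe_mul, mul_assoc]
  gcongr 1
  calc ∫⁻ x in Set.Ioo (0 : ℝ) 1,
        ENNReal.ofReal (1 / (1 - ‖t‖ ^ 2 * x)) * ENNReal.ofReal (1 - x) ^ (-σ)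
      ≤ ∫⁻ x in Set.Ioo (0 : ℝ) 1,
          ENNReal.ofReal ((1 - x) ^ (-σ) / max (1 - x) (1 - ‖t‖ ^ 2)) := by
        refine setLIntegral_mono' measurableSet_Ioo fun x hx ↦ ?_
        have hx1 : 0 < 1 - x := by linarith [hx.2]
        rw [ENNReal.ofReal_rpow_of_pos hx1, mul_comm,
          ← ENNReal.ofReal_mul (Real.rpow_nonneg hx1.le _), mul_one_div]
        refine ENNReal.ofReal_le_ofReal ?_
        refine div_le_div_of_nonneg_left (Real.rpow_nonneg hx1.le _) (lt_max_of_lt_left hx1) ?_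
        refine max_le ?_ ?_ <;> nlinarith [hx.1, hx.2, sq_nonneg ‖t‖]
    _ = ∫⁻ y in Set.Ioo (0 : ℝ) 1, ENNReal.ofReal (y ^ (-σ) / max y (1 - ‖t‖ ^ 2)) :=
        lintegral_one_sub (φ := fun y ↦ ENNReal.ofReal (y ^ (-σ) / max y (1 - ‖t‖ ^ 2)))
    _ ≤ _ := lintegral_forelliRudin_le hσ hσ1 hδ
    _ = _ := by
        rw [ENNReal.ofReal_rpow_of_pos hδ, ENNReal.ofReal_mul (by positivity)]
        rfl

lemma volume_real_disc : volume.real (ball (0 : ℂ) 1) = Real.pi := by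
  simp [measureReal_def, Complex.volume_ball]

lemma puncturedDisc_eq : puncturedDisc = ball (0 : ℂ) 1 \ {0} := by
  ext z
  simp [puncturedDisc, and_comm]

lemma volume_restrict_puncturedDisc :
    (volume : Measure ℂ).restrict puncturedDisc = volume.restrict (ball 0 1) := by
  rw [puncturedDisc_eq]
  exact Measure.restrict_congr_set (sdiff_null_ae_eq_self (measure_singleton 0))

/-- The Cauchy–Schwarz inequality for a set of finite measure. -/
lemma setLIntegral_sq_le {α : Type*} [MeasurableSpace α] {μ : Measure α} {S : Set α}
    {f : α → ℝ≥0∞} (hf : AEMeasurable f (μ.restrict S)) :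
    (∫⁻ x in S, f x ∂μ) ^ 2 ≤ μ S * ∫⁻ x in S, f x ^ 2 ∂μ := by
  have h := ENNReal.lintegral_mul_le_Lp_mul_Lq (μ.restrict S) (f := fun _ ↦ 1) (g := f)
    Real.HolderConjugate.two_two aemeasurable_const hf
  have h3 := pow_le_pow_left' h 2
  simp only [Pi.mul_apply, one_mul, ENNReal.one_rpow, lintegral_const,
    Measure.restrict_apply_univ] at h3
  refine h3.trans (le_of_eq ?_)
  rw [mul_pow, ← ENNReal.rpow_natCast, ← ENNReal.rpow_natCast, ← ENNReal.rpow_mul,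
    ← ENNReal.rpow_mul]
  norm_num

/-- A square-integrable holomorphic function on the punctured disc is `o(1/|z|)` at the centre. -/
lemma isLittleO_of_memLp_puncturedDisc {F : ℂ → ℂ} (hF : DifferentiableOn ℂ F puncturedDisc)
    (hF2 : MemLp F 2 (volume.restrict puncturedDisc)) :
    (fun z ↦ F z - F 0) =o[𝓝[≠] 0] fun z : ℂ ↦ (z - 0)⁻¹ := by
  have hmain : ∀ z : ℂ, z ≠ 0 → ‖z‖ < 1 / 2 → ‖F z‖ₑ ^ 2 * ENNReal.ofReal (‖z‖ ^ 2) ≤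
      4 * ∫⁻ w in closedBall 0 (2 * ‖z‖), ‖F w‖ₑ ^ 2 ∂(volume.restrict puncturedDisc) := by
    intro z hz hz2
    have hz0 : 0 < ‖z‖ := norm_pos_iff.2 hz
    have hsub : ∀ w ∈ closedBall (0 : ℂ) (‖z‖ / 2), z + w ∈ puncturedDisc := by
      intro w hw
      have hw1 : ‖w‖ ≤ ‖z‖ / 2 := by simpa using hw
      constructor
      · intro h
        have : z = -w := eq_neg_of_add_eq_zero_left h
        rw [this, norm_neg] at hw1 hz0
        linarith
      · linarith [norm_add_le z w]
    have hd : DifferentiableOn ℂ (fun w ↦ F (z + w)) (closedBall 0 (‖z‖ / 2)) :=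
      hF.comp (by fun_prop) hsub
    have hmv := rotationInvariant_volume_complex.setIntegral_eq_of_balanced
      (measurableSet_closedBall (x := 0) (ε := ‖z‖ / 2)) (fun c hc w hw ↦ by
        simp only [mem_closedBall_zero_iff, norm_smul] at hw ⊢
        nlinarith [norm_nonneg w, norm_nonneg c]) hd
      (hd.continuousOn.integrableOn_compact (isCompact_closedBall _ _))
    rw [add_zero] at hmv
    have hvol : volume (closedBall (0 : ℂ) (‖z‖ / 2)) = ENNReal.ofReal (Real.pi * ‖z‖ ^ 2 / 4) := by
      rw [Complex.volume_closedBall, ← ENNReal.ofReal_pow (by positivity), mul_comm,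
        ← ENNReal.ofReal_coe_nnreal, ← ENNReal.ofReal_mul (by positivity), NNReal.coe_real_pi]
      congr 1
      ring
    have hpos : 0 < Real.pi * ‖z‖ ^ 2 / 4 := by positivity
    set V := ENNReal.ofReal (Real.pi * ‖z‖ ^ 2 / 4) with hV
    have hV0 : V ≠ 0 := by simpa [hV] using hpos
    have hVt : V ≠ ∞ := ENNReal.ofReal_ne_top
    have hm : AEMeasurable (fun w ↦ ‖F (z + w)‖ₑ) (volume.restrict (closedBall 0 (‖z‖ / 2))) :=
      (hd.continuousOn.aestronglyMeasurable measurableSet_closedBall).enorm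
    have h1 : (V * ‖F z‖ₑ) ^ 2 ≤ V * ∫⁻ w in closedBall 0 (‖z‖ / 2), ‖F (z + w)‖ₑ ^ 2 := by
      refine le_trans (pow_le_pow_left' ?_ 2) ((setLIntegral_sq_le hm).trans_eq (by rw [hvol]))
      refine le_trans (le_of_eq ?_) (enorm_integral_le_lintegral_enorm _)
      rw [hmv, enorm_mul, measureReal_def, hvol, ENNReal.toReal_ofReal hpos.le, hV]
      congr 1
      rw [← ofReal_norm, Complex.norm_real, Real.norm_of_nonneg hpos.le]
    have h2 : ∫⁻ w in closedBall 0 (‖z‖ / 2), ‖F (z + w)‖ₑ ^ 2 ≤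
        ∫⁻ w in closedBall 0 (2 * ‖z‖), ‖F w‖ₑ ^ 2 ∂(volume.restrict puncturedDisc) := by
      rw [Measure.restrict_restrict measurableSet_closedBall]
      have h3 := (measurePreserving_add_left (volume : Measure ℂ) z).setLIntegral_comp_preimage_emb
        (measurableEmbedding_addLeft z) (fun w ↦ ‖F w‖ₑ ^ 2)
        ((fun w ↦ z + w) '' closedBall 0 (‖z‖ / 2))
      rw [Set.preimage_image_eq _ (add_right_injective z)] at h3
      rw [h3]
      refine lintegral_mono_set ?_
      rintro _ ⟨w, hw, rfl⟩
      refine ⟨?_, hsub w hw⟩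
      have hw1 : ‖w‖ ≤ ‖z‖ / 2 := by simpa using hw
      rw [mem_closedBall_zero_iff]
      linarith [norm_add_le z w]
    have h3 : V * ‖F z‖ₑ ^ 2 ≤
        ∫⁻ w in closedBall 0 (2 * ‖z‖), ‖F w‖ₑ ^ 2 ∂(volume.restrict puncturedDisc) := by
      refine le_trans ?_ h2
      rw [mul_pow, sq V, mul_assoc] at h1
      exact (ENNReal.mul_le_mul_iff_right hV0 hVt).1 h1
    calc ‖F z‖ₑ ^ 2 * ENNReal.ofReal (‖z‖ ^ 2) ≤ 4 * (V * ‖F z‖ₑ ^ 2) := by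
          have h4 : ENNReal.ofReal (‖z‖ ^ 2) ≤ 4 * V := by
            rw [hV, show (4 : ℝ≥0∞) = ENNReal.ofReal 4 by norm_num,
              ← ENNReal.ofReal_mul (by norm_num)]
            refine ENNReal.ofReal_le_ofReal ?_
            nlinarith [Real.pi_gt_three, sq_nonneg ‖z‖]
          calc _ ≤ ‖F z‖ₑ ^ 2 * (4 * V) := by gcongr
            _ = _ := by ring
      _ ≤ _ := by gcongr
  have hlim : Tendsto (fun z : ℂ ↦
      4 * ∫⁻ w in closedBall 0 (2 * ‖z‖), ‖F w‖ₑ ^ 2 ∂(volume.restrict puncturedDisc))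
      (𝓝 0) (𝓝 0) := by
    have h1 : Tendsto (fun z : ℂ ↦ (volume.restrict puncturedDisc) (closedBall (0 : ℂ) (2 * ‖z‖)))
        (𝓝 0) (𝓝 0) := by
      have h2 : Tendsto (fun z : ℂ ↦ ENNReal.ofReal (2 * ‖z‖) ^ 2 * (NNReal.pi : ℝ≥0∞))
          (𝓝 0) (𝓝 0) := by
        have h3 : Tendsto (fun z : ℂ ↦ ENNReal.ofReal (2 * ‖z‖)) (𝓝 0) (𝓝 0) := by
          have : Continuous fun z : ℂ ↦ ENNReal.ofReal (2 * ‖z‖) :=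
            ENNReal.continuous_ofReal.comp (by fun_prop)
          simpa using this.tendsto 0
        have h4 := ENNReal.Tendsto.mul_const (b := (NNReal.pi : ℝ≥0∞))
          (ENNReal.Tendsto.pow h3 (n := 2)) (Or.inr ENNReal.coe_ne_top)
        simpa using h4
      refine tendsto_of_tendsto_of_tendsto_of_le_of_le tendsto_const_nhds h2
        (fun _ ↦ zero_le) fun z ↦ ?_
      exact (Measure.restrict_apply_le _ _).trans (Complex.volume_closedBall _ _).le
    have h5 := tendsto_setLIntegral_zero (memLp_two_iff.1 hF2).2.ne h1
    simpa using ENNReal.Tendsto.const_mul (a := 4) h5 (Or.inr (by norm_num))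
  have hF0 : (fun z ↦ F z) =o[𝓝[≠] 0] fun z : ℂ ↦ (z - 0)⁻¹ := by
    rw [Asymptotics.isLittleO_iff]
    intro ε hε
    have h1 := (ENNReal.tendsto_nhds_zero.1 hlim) (ENNReal.ofReal (ε ^ 2))
      (by simpa using pow_pos hε 2)
    have h2 : ∀ᶠ z : ℂ in 𝓝[≠] 0, z ≠ 0 := eventually_mem_nhdsWithin
    have h3 : ∀ᶠ z : ℂ in 𝓝[≠] 0, ‖z‖ < 1 / 2 := by
      have : ∀ᶠ z : ℂ in 𝓝 0, ‖z‖ < 1 / 2 :=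
        continuous_norm.tendsto' (0 : ℂ) 0 norm_zero (gt_mem_nhds (by norm_num))
      exact this.filter_mono nhdsWithin_le_nhds
    filter_upwards [h1.filter_mono nhdsWithin_le_nhds, h2, h3] with z hz1 hz2 hz3
    have h4 := (hmain z hz2 hz3).trans hz1
    rw [← ofReal_norm, ← ENNReal.ofReal_pow (norm_nonneg _), ← ENNReal.ofReal_mul (by positivity),
      ENNReal.ofReal_le_ofReal_iff (by positivity), ← mul_pow] at h4
    have h5 := le_of_sq_le_sq h4 hε.le
    rw [sub_zero, norm_inv, ← div_eq_mul_inv, le_div_iff₀ (norm_pos_iff.2 hz2)]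
    exact h5
  refine hF0.sub (Asymptotics.isLittleO_const_left.2 (Or.inr ?_))
  simp only [sub_zero]
  exact tendsto_norm_inv_nhdsNE_zero_atTop

/-- The Bergman kernel of the unit disc; the punctured disc has the same one. -/
noncomputable def discKernel (t v : ℂ) : ℂ := (Real.pi : ℂ)⁻¹ * (1 / (1 - t * conj v) ^ 2)

/-- A square-integrable holomorphic function extends over the puncture, so the reproducing formula of
the disc applies to it. -/
lemma isBergmanKernel_puncturedDisc : IsBergmanKernel puncturedDisc discKernel := by
  have hconj : Measurable fun v : ℂ ↦ conj v := Complex.continuous_conj.measurable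
  refine ⟨isOpen_puncturedDisc, ?_, ?_, ?_, ?_, ?_⟩
  · unfold discKernel Function.uncurry
    fun_prop
  · intro x y
    simp only [discKernel, map_mul, map_inv₀, Complex.conj_ofReal, map_div₀, map_one, map_pow,
      map_sub, Complex.conj_conj]
    rw [mul_comm x]
  · intro y hy
    refine DifferentiableOn.const_mul (DifferentiableOn.div (by fun_prop) (by fun_prop) ?_) _
    exact fun x hx ↦ pow_ne_zero _ (one_sub_mul_conj_ne_zero hx.2 hy.2)
  · intro y hy
    have hfin : IsFiniteMeasure (volume.restrict puncturedDisc) := by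
      rw [volume_restrict_puncturedDisc]
      exact ⟨by simp⟩
    refine MemLp.of_bound ?_ (Real.pi⁻¹ * (1 / (1 - ‖y‖) ^ 2)) ?_
    · refine Measurable.aestronglyMeasurable ?_
      unfold discKernel
      fun_prop
    · filter_upwards [ae_restrict_mem isOpen_puncturedDisc.measurableSet] with x hx
      have h1 : 0 < 1 - ‖y‖ := by linarith [hy.2]
      have h2 : 1 - ‖y‖ ≤ ‖1 - x * conj y‖ := by
        have h3 := norm_sub_norm_le 1 (x * conj y)
        rw [norm_one, norm_mul, RCLike.norm_conj] at h3
        nlinarith [norm_nonneg x, norm_nonneg y, hx.2]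
      rw [discKernel, norm_mul, norm_inv, Complex.norm_real,
        Real.norm_of_nonneg Real.pi_pos.le, norm_div, norm_one, norm_pow]
      gcongr
  · intro F hF hF2 z hz
    set G := Function.update F 0 (limUnder (𝓝[≠] (0 : ℂ)) F) with hG
    have hGd : DifferentiableOn ℂ G (ball 0 1) :=
      Complex.differentiableOn_update_limUnder_of_isLittleO (ball_mem_nhds _ one_pos)
        (by rwa [← puncturedDisc_eq]) (isLittleO_of_memLp_puncturedDisc hF hF2)
    have hGF : ∀ v ∈ puncturedDisc, G v = F v := fun v hv ↦ Function.update_of_ne hv.1 _ _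
    have hi : IntegrableOn G (ball 0 1) := by
      rw [IntegrableOn, ← volume_restrict_puncturedDisc]
      have hfin : IsFiniteMeasure (volume.restrict puncturedDisc) := by
        rw [volume_restrict_puncturedDisc]
        exact ⟨by simp⟩
      refine (hF2.integrable (by norm_num)).congr ?_
      filter_upwards [ae_restrict_mem isOpen_puncturedDisc.measurableSet] with v hv
      exact (hGF v hv).symm
    have h1 := disc_reproducing 0 hGd (by simpa using hi) hz.2
    simp only [pow_zero, Complex.ofReal_one, mul_one, zero_add, integral_const,
      measureReal_restrict_apply_univ, volume_real_disc, smul_eq_mul] at h1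
    have hpi : (Real.pi : ℂ) ≠ 0 := by exact_mod_cast Real.pi_ne_zero
    have h2 : F z = (Real.pi : ℂ)⁻¹ * (G z * Real.pi) := by
      rw [hGF z hz]
      field_simp
    rw [h2, ← h1, ← integral_const_mul, ← volume_restrict_puncturedDisc]
    refine setIntegral_congr_fun isOpen_puncturedDisc.measurableSet fun v hv ↦ ?_
    simp only [hGF v hv, discKernel]
    ring

lemma one_le_ofReal_rpow_neg {x σ : ℝ} (hx1 : x ≤ 1) (hσ : 0 ≤ σ) :
    1 ≤ ENNReal.ofReal x ^ (-σ) := by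
  rw [ENNReal.rpow_neg]
  refine ENNReal.one_le_inv.2 (ENNReal.rpow_le_one ?_ hσ)
  rw [← ENNReal.ofReal_one]
  exact ENNReal.ofReal_le_ofReal hx1

lemma rpow_neg_le_two_pow {x : ℝ≥0∞} (hx : 2⁻¹ ≤ x) {s : ℝ} (hs : 0 ≤ s) {n : ℕ} (hsn : s ≤ n) :
    x ^ (-s) ≤ 2 ^ n := by
  calc x ^ (-s) = (x ^ s)⁻¹ := ENNReal.rpow_neg _ _
    _ ≤ ((2⁻¹ : ℝ≥0∞) ^ s)⁻¹ := ENNReal.inv_le_inv.2 (ENNReal.rpow_le_rpow hx hs)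
    _ = 2 ^ s := by rw [ENNReal.inv_rpow, inv_inv]
    _ ≤ 2 ^ (n : ℝ) := ENNReal.rpow_le_rpow_of_exponent_le (by norm_num) hsn
    _ = 2 ^ n := ENNReal.rpow_natCast _ _

/-- The Forelli–Rudin estimate on the punctured disc, with an integrable power of the distance to
the puncture as an additional weight. -/
lemma subinvariant_discKernel {σ b : ℝ} (hσ : 0 < σ) (hσ1 : σ < 1) (hb : -2 < b) (hb0 : b ≤ 0) :
    Subinvariant puncturedDisc discKernel
      fun v ↦ ‖v‖ₑ ^ b * ENNReal.ofReal (1 - ‖v‖ ^ 2) ^ (-σ) := by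
  obtain ⟨C, hC⟩ := disc_forelliRudin hσ hσ1
  have hA : ∫⁻ v in ball (0 : ℂ) 1, ‖v‖ₑ ^ b < ∞ := by
    have h1 : ∀ᵐ v : ℂ, v ≠ 0 := by simp [ae_iff, measure_singleton]
    have h2 : ∫⁻ v in ball (0 : ℂ) 1, ‖v‖ₑ ^ b =
        ∫⁻ v in ball (0 : ℂ) 1, ENNReal.ofReal ((‖v‖ ^ 2) ^ (b / 2)) := by
      refine lintegral_congr_ae (ae_restrict_of_ae ?_)
      filter_upwards [h1] with v hv
      have hv0 := norm_pos_iff.2 hv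
      rw [← ofReal_norm, ENNReal.ofReal_rpow_of_pos hv0, ← Real.rpow_natCast,
        ← Real.rpow_mul hv0.le]
      congr 2
      push_cast
      ring
    rw [h2, lintegral_disc_norm_sq (φ := fun x ↦ ENNReal.ofReal (x ^ (b / 2))) (by fun_prop)]
    exact ENNReal.mul_lt_top ENNReal.coe_lt_top (lintegral_rpow_Ioo_lt_top (by linarith))
  lift (∫⁻ v in ball (0 : ℂ) 1, ‖v‖ₑ ^ b) to ℝ≥0 using hA.ne with A hA'
  refine ⟨8 * A + 4 * C, fun t ht ↦ ?_⟩
  have hconj : Measurable fun v : ℂ ↦ conj v := Complex.continuous_conj.measurable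
  rw [volume_restrict_puncturedDisc]
  -- near the puncture the kernel and the boundary weight are bounded, away from it so is `|v|^b`
  have key : ∀ v ∈ ball (0 : ℂ) 1,
      ‖discKernel t v‖ₑ * (‖v‖ₑ ^ b * ENNReal.ofReal (1 - ‖v‖ ^ 2) ^ (-σ)) ≤
        8 * ‖v‖ₑ ^ b +
          4 * (‖1 / (1 - t * conj v) ^ 2‖ₑ * ENNReal.ofReal (1 - ‖v‖ ^ 2) ^ (-σ)) := by
    intro v hv
    have hv1 : ‖v‖ < 1 := by simpa using hv
    have hpi : ‖discKernel t v‖ₑ ≤ ‖1 / (1 - t * conj v) ^ 2‖ₑ := by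
      rw [discKernel, enorm_mul]
      refine mul_le_of_le_one_left zero_le ?_
      rw [← ofReal_norm, norm_inv, Complex.norm_real, Real.norm_of_nonneg Real.pi_pos.le]
      refine ENNReal.ofReal_le_one.2 (inv_le_one_of_one_le₀ ?_)
      linarith [Real.pi_gt_three]
    rcases lt_or_ge ‖v‖ (1 / 2) with hv2 | hv2
    · refine le_trans ?_ le_self_add
      have h1 : ‖1 / (1 - t * conj v) ^ 2‖ₑ ≤ 4 := by
        rw [← ofReal_norm, show (4 : ℝ≥0∞) = ENNReal.ofReal 4 by norm_num]
        refine ENNReal.ofReal_le_ofReal ?_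
        have h2 : 1 / 2 ≤ ‖1 - t * conj v‖ := by
          have h3 := norm_sub_norm_le 1 (t * conj v)
          rw [norm_one, norm_mul, RCLike.norm_conj] at h3
          nlinarith [norm_nonneg t, norm_nonneg v, ht.2]
        rw [norm_div, norm_one, norm_pow, div_le_iff₀ (by positivity)]
        nlinarith
      have h2 : ENNReal.ofReal (1 - ‖v‖ ^ 2) ^ (-σ) ≤ 2 := by
        have h3 : (2⁻¹ : ℝ≥0∞) ≤ ENNReal.ofReal (1 - ‖v‖ ^ 2) := by
          rw [show (2⁻¹ : ℝ≥0∞) = ENNReal.ofReal 2⁻¹ by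
            rw [ENNReal.ofReal_inv_of_pos two_pos]; norm_num]
          refine ENNReal.ofReal_le_ofReal ?_
          nlinarith [norm_nonneg v]
        simpa using rpow_neg_le_two_pow h3 hσ.le (n := 1) (by simpa using hσ1.le)
      calc _ ≤ 4 * (‖v‖ₑ ^ b * 2) := by
            gcongr
            exact hpi.trans h1
        _ = _ := by ring
    · refine le_trans ?_ le_add_self
      have h3 : (2⁻¹ : ℝ≥0∞) ≤ ‖v‖ₑ := by
        rw [show (2⁻¹ : ℝ≥0∞) = ENNReal.ofReal 2⁻¹ by
          rw [ENNReal.ofReal_inv_of_pos two_pos]; norm_num, ← ofReal_norm]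
        refine ENNReal.ofReal_le_ofReal ?_
        linarith
      have h4 : ‖v‖ₑ ^ b ≤ 4 := by
        have := rpow_neg_le_two_pow h3 (s := -b) (by linarith) (n := 2) (by push_cast; linarith)
        rw [neg_neg] at this
        norm_num at this
        exact this
      calc _ ≤ ‖1 / (1 - t * conj v) ^ 2‖ₑ * (4 * ENNReal.ofReal (1 - ‖v‖ ^ 2) ^ (-σ)) := by
            gcongr
        _ = _ := by ring
  have ht1 : t ∈ ball (0 : ℂ) 1 := by simpa using ht.2
  have h1 : 1 ≤ ‖t‖ₑ ^ b := by
    rw [← neg_neg b, ENNReal.rpow_neg]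
    refine ENNReal.one_le_inv.2 (ENNReal.rpow_le_one ?_ (by linarith))
    rw [← ofReal_norm]
    exact ENNReal.ofReal_le_one.2 ht.2.le
  have h2 : 1 ≤ ENNReal.ofReal (1 - ‖t‖ ^ 2) ^ (-σ) :=
    one_le_ofReal_rpow_neg (by nlinarith [sq_nonneg ‖t‖]) hσ.le
  calc ∫⁻ v in ball (0 : ℂ) 1,
        ‖discKernel t v‖ₑ * (‖v‖ₑ ^ b * ENNReal.ofReal (1 - ‖v‖ ^ 2) ^ (-σ))
      ≤ ∫⁻ v in ball (0 : ℂ) 1, (8 * ‖v‖ₑ ^ b +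
          4 * (‖1 / (1 - t * conj v) ^ 2‖ₑ * ENNReal.ofReal (1 - ‖v‖ ^ 2) ^ (-σ))) :=
        setLIntegral_mono' measurableSet_ball key
    _ = 8 * A + 4 * ∫⁻ v in ball (0 : ℂ) 1,
          ‖1 / (1 - t * conj v) ^ 2‖ₑ * ENNReal.ofReal (1 - ‖v‖ ^ 2) ^ (-σ) := by
        rw [lintegral_add_left (by fun_prop), lintegral_const_mul' _ _ (by norm_num),
          lintegral_const_mul' _ _ (by norm_num), hA']
    _ ≤ 8 * A * (1 * 1) + 4 * (C * (1 * ENNReal.ofReal (1 - ‖t‖ ^ 2) ^ (-σ))) := by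
        rw [mul_one, mul_one, one_mul]
        gcongr
        exact hC t ht1
    _ ≤ 8 * A * (‖t‖ₑ ^ b * ENNReal.ofReal (1 - ‖t‖ ^ 2) ^ (-σ)) +
          4 * (C * (‖t‖ₑ ^ b * ENNReal.ofReal (1 - ‖t‖ ^ 2) ^ (-σ))) := by
        gcongr
    _ = _ := by
        push_cast
        ring

/-! ### The Euclidean ball -/

/-- The square of the Euclidean norm. The type `Fin m → ℂ` itself carries the sup norm. -/
noncomputable def normSq {m : ℕ} (z : Fin m → ℂ) : ℝ := ∑ i, ‖z i‖ ^ 2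

/-- The Hermitian inner product `∑ i, u i * conj (v i)`, linear in the first variable. -/
noncomputable def herm {m : ℕ} (u v : Fin m → ℂ) : ℂ := ∑ i, u i * conj (v i)

/-- The Euclidean ball `{|z|² < R}`. -/
def sqBall (m : ℕ) (R : ℝ) : Set (Fin m → ℂ) := {z | normSq z < R}

lemma continuous_normSq {m : ℕ} : Continuous (normSq : (Fin m → ℂ) → ℝ) := by
  unfold normSq
  fun_prop

@[fun_prop]
lemma measurable_normSq {m : ℕ} : Measurable (normSq : (Fin m → ℂ) → ℝ) :=
  continuous_normSq.measurable

lemma isOpen_sqBall (m : ℕ) (R : ℝ) : IsOpen (sqBall m R) :=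
  isOpen_lt continuous_normSq continuous_const

lemma normSq_nonneg {m : ℕ} (z : Fin m → ℂ) : 0 ≤ normSq z :=
  Finset.sum_nonneg fun _ _ ↦ sq_nonneg _

lemma normSq_smul {m : ℕ} (c : ℂ) (z : Fin m → ℂ) : normSq (c • z) = ‖c‖ ^ 2 * normSq z := by
  simp [normSq, Finset.mul_sum, mul_pow]

lemma normSq_cons {m : ℕ} (a : ℂ) (w : Fin m → ℂ) :
    normSq (Fin.cons a w : Fin (m + 1) → ℂ) = ‖a‖ ^ 2 + normSq w := by
  simp [normSq, Fin.sum_univ_succ]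

@[simp] lemma normSq_zero {m : ℕ} : normSq (0 : Fin m → ℂ) = 0 := by simp [normSq]

lemma herm_self {m : ℕ} (z : Fin m → ℂ) : herm z z = (normSq z : ℂ) := by
  simp only [herm, normSq, Complex.mul_conj, Complex.normSq_eq_norm_sq]
  push_cast
  rfl

lemma conj_herm {m : ℕ} (u v : Fin m → ℂ) : conj (herm u v) = herm v u := by
  simp [herm, mul_comm]

lemma herm_cons_zero {m : ℕ} (t : ℂ) (v : Fin (m + 1) → ℂ) :
    herm (Fin.cons t 0) v = t * conj (v 0) := by
  simp [herm, Fin.sum_univ_succ]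

lemma sqBall_eq_empty {m : ℕ} {R : ℝ} (hR : R ≤ 0) : sqBall m R = ∅ := by
  ext z
  simp only [sqBall, Set.mem_ofPred_eq, Set.mem_empty_iff_false, iff_false, not_lt]
  exact hR.trans (normSq_nonneg z)

lemma smul_mem_sqBall {m : ℕ} {R : ℝ} (c : ℂ) (hc : ‖c‖ ≤ 1) (z : Fin m → ℂ)
    (hz : z ∈ sqBall m R) : c • z ∈ sqBall m R := by
  simp only [sqBall, Set.mem_ofPred_eq, normSq_smul] at *
  exact (mul_le_of_le_one_left (normSq_nonneg z) (pow_le_one₀ (norm_nonneg c) hc)).trans_lt hz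

lemma sqrt_smul_mem_sqBall_iff {m : ℕ} {R : ℝ} (hR : 0 < R) (z : Fin m → ℂ) :
    ((√R : ℝ) : ℂ) • z ∈ sqBall m R ↔ z ∈ sqBall m 1 := by
  simp only [sqBall, Set.mem_ofPred_eq, normSq_smul, Complex.norm_real,
    Real.norm_of_nonneg (Real.sqrt_nonneg _), Real.sq_sqrt hR.le]
  constructor <;> intro h <;> nlinarith

lemma volume_sqBall_lt_top (m : ℕ) (R : ℝ) : volume (sqBall m R) < ∞ := by
  refine lt_of_le_of_lt (measure_mono ?_) (measure_closedBall_lt_top (x := 0) (r := R + 1))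
  intro z hz
  simp only [sqBall, Set.mem_ofPred_eq] at hz
  have hR : 0 < R := (normSq_nonneg z).trans_lt hz
  rw [mem_closedBall_zero_iff, pi_norm_le_iff_of_nonneg (by linarith)]
  intro i
  have h1 : ‖z i‖ ^ 2 ≤ normSq z :=
    Finset.single_le_sum (f := fun i ↦ ‖z i‖ ^ 2) (fun _ _ ↦ sq_nonneg _) (Finset.mem_univ i)
  nlinarith [norm_nonneg (z i)]

lemma setLIntegral_sqBall {m : ℕ} {R : ℝ} (hR : 0 < R) {g : (Fin m → ℂ) → ℝ≥0∞}
    (hg : Measurable g) :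
    ∫⁻ w in sqBall m R, g w =
      ENNReal.ofReal R ^ m * ∫⁻ w in sqBall m 1, g (((√R : ℝ) : ℂ) • w) := by
  have hR' : ((√R : ℝ) : ℂ) ≠ 0 := by exact_mod_cast (Real.sqrt_pos.2 hR).ne'
  rw [← lintegral_indicator (isOpen_sqBall m R).measurableSet,
    ← map_smul_volume_pi hR' _ (hg.indicator (isOpen_sqBall m R).measurableSet),
    ← lintegral_indicator (isOpen_sqBall m 1).measurableSet]
  congr 1
  · rw [pow_mul, ← ofReal_norm, Complex.norm_real, Real.norm_of_nonneg (Real.sqrt_nonneg _),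
      ← ENNReal.ofReal_pow (Real.sqrt_nonneg _), Real.sq_sqrt hR.le]
  · refine lintegral_congr fun w ↦ ?_
    by_cases hw : w ∈ sqBall m 1
    · rw [Set.indicator_of_mem hw, Set.indicator_of_mem ((sqrt_smul_mem_sqBall_iff hR w).2 hw)]
    · rw [Set.indicator_of_notMem hw,
        Set.indicator_of_notMem (fun h ↦ hw ((sqrt_smul_mem_sqBall_iff hR w).1 h))]

lemma volume_real_sqBall {m : ℕ} {R : ℝ} (hR : 0 < R) :
    volume.real (sqBall m R) = R ^ m * volume.real (sqBall m 1) := by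
  have h := setLIntegral_sqBall (m := m) hR (g := fun _ ↦ 1) measurable_const
  simp only [lintegral_const, Measure.restrict_apply_univ, one_mul] at h
  rw [measureReal_def, h, ENNReal.toReal_mul, ENNReal.toReal_pow, ENNReal.toReal_ofReal hR.le]
  rfl

lemma volume_real_sqBall_pos (m : ℕ) : 0 < volume.real (sqBall m 1) := by
  refine ENNReal.toReal_pos (IsOpen.measure_pos _ (isOpen_sqBall m 1) ⟨0, ?_⟩).ne'
    (volume_sqBall_lt_top m 1).ne
  simp [sqBall]

/-- Splitting off the first coordinate. -/
lemma measurePreserving_cons (m : ℕ) :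
    MeasurePreserving (fun q : ℂ × (Fin m → ℂ) ↦ (Fin.cons q.1 q.2 : Fin (m + 1) → ℂ)) := by
  have h := (volume_preserving_piFinSuccAbove (fun _ : Fin (m + 1) ↦ ℂ) 0).symm
  convert h using 1
  ext q i
  simp [MeasurableEquiv.piFinSuccAbove, Fin.insertNthEquiv]

lemma measurableEmbedding_cons (m : ℕ) :
    MeasurableEmbedding (fun q : ℂ × (Fin m → ℂ) ↦ (Fin.cons q.1 q.2 : Fin (m + 1) → ℂ)) := by
  have h := (MeasurableEquiv.piFinSuccAbove (fun _ : Fin (m + 1) ↦ ℂ) 0).symm.measurableEmbedding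
  convert h using 1
  ext q i
  simp [MeasurableEquiv.piFinSuccAbove, Fin.insertNthEquiv]

lemma cons_mem_sqBall_iff {m : ℕ} (a : ℂ) (w : Fin m → ℂ) :
    (Fin.cons a w : Fin (m + 1) → ℂ) ∈ sqBall (m + 1) 1 ↔ w ∈ sqBall m (1 - ‖a‖ ^ 2) := by
  simp only [sqBall, Set.mem_ofPred_eq, normSq_cons]
  constructor <;> intro h <;> linarith

/-- Integration over the ball by slices with fixed first coordinate. -/
lemma setLIntegral_ball_eq_slices {m : ℕ} {g : (Fin (m + 1) → ℂ) → ℝ≥0∞} (hg : Measurable g) :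
    ∫⁻ z in sqBall (m + 1) 1, g z =
      ∫⁻ a in ball (0 : ℂ) 1, ∫⁻ w in sqBall m (1 - ‖a‖ ^ 2), g (Fin.cons a w) := by
  have hS := (isOpen_sqBall (m + 1) 1).measurableSet
  have hgi : Measurable fun q : ℂ × (Fin m → ℂ) ↦
      (sqBall (m + 1) 1).indicator g (Fin.cons q.1 q.2) :=
    (hg.indicator hS).comp (measurableEmbedding_cons m).measurable
  rw [← lintegral_indicator hS, ← (measurePreserving_cons m).lintegral_comp (hg.indicator hS),
    Measure.volume_eq_prod, lintegral_prod _ hgi.aemeasurable,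
    ← lintegral_indicator measurableSet_ball]
  refine lintegral_congr fun a ↦ ?_
  have h1 : ∀ w : Fin m → ℂ, (sqBall (m + 1) 1).indicator g (Fin.cons a w) =
      (sqBall m (1 - ‖a‖ ^ 2)).indicator (fun w ↦ g (Fin.cons a w)) w := by
    intro w
    by_cases hw : w ∈ sqBall m (1 - ‖a‖ ^ 2)
    · rw [Set.indicator_of_mem hw, Set.indicator_of_mem ((cons_mem_sqBall_iff a w).2 hw)]
    · rw [Set.indicator_of_notMem hw,
        Set.indicator_of_notMem (fun h ↦ hw ((cons_mem_sqBall_iff a w).1 h))]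
  simp_rw [h1]
  rw [lintegral_indicator (isOpen_sqBall _ _).measurableSet]
  by_cases ha : a ∈ ball (0 : ℂ) 1
  · rw [Set.indicator_of_mem ha]
  · rw [Set.indicator_of_notMem ha, sqBall_eq_empty, Measure.restrict_empty, lintegral_zero_measure]
    have : 1 ≤ ‖a‖ := by simpa using ha
    nlinarith

lemma integrableOn_cons {m : ℕ} {g : (Fin (m + 1) → ℂ) → ℂ}
    (hg : IntegrableOn g (sqBall (m + 1) 1)) :
    Integrable (fun q : ℂ × (Fin m → ℂ) ↦ (sqBall (m + 1) 1).indicator g (Fin.cons q.1 q.2))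
      (volume.prod volume) := by
  have h1 := (integrable_indicator_iff (isOpen_sqBall (m + 1) 1).measurableSet).2 hg
  rw [← (measurePreserving_cons m).integrable_comp_emb (measurableEmbedding_cons m)] at h1
  exact h1

lemma indicator_cons {m : ℕ} (g : (Fin (m + 1) → ℂ) → ℂ) (a : ℂ) :
    (fun w : Fin m → ℂ ↦ (sqBall (m + 1) 1).indicator g (Fin.cons a w)) =
      (sqBall m (1 - ‖a‖ ^ 2)).indicator (fun w ↦ g (Fin.cons a w)) := by
  ext w
  by_cases hw : w ∈ sqBall m (1 - ‖a‖ ^ 2)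
  · rw [Set.indicator_of_mem hw, Set.indicator_of_mem ((cons_mem_sqBall_iff a w).2 hw)]
  · rw [Set.indicator_of_notMem hw,
      Set.indicator_of_notMem (fun h ↦ hw ((cons_mem_sqBall_iff a w).1 h))]

/-- The Bochner integral version of `setLIntegral_ball_eq_slices`. -/
lemma setIntegral_ball_eq_slices {m : ℕ} {g : (Fin (m + 1) → ℂ) → ℂ}
    (hg : IntegrableOn g (sqBall (m + 1) 1)) :
    ∫ z in sqBall (m + 1) 1, g z =
      ∫ a in ball (0 : ℂ) 1, ∫ w in sqBall m (1 - ‖a‖ ^ 2), g (Fin.cons a w) := by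
  have hS := (isOpen_sqBall (m + 1) 1).measurableSet
  rw [← integral_indicator hS, ← (measurePreserving_cons m).integral_comp
    (measurableEmbedding_cons m), Measure.volume_eq_prod, integral_prod _ (integrableOn_cons hg),
    ← integral_indicator measurableSet_ball]
  refine integral_congr_ae (ae_of_all _ fun a ↦ ?_)
  simp only
  rw [indicator_cons, integral_indicator (isOpen_sqBall _ _).measurableSet]
  by_cases ha : a ∈ ball (0 : ℂ) 1
  · rw [Set.indicator_of_mem ha]
  · rw [Set.indicator_of_notMem ha, sqBall_eq_empty, Measure.restrict_empty, integral_zero_measure]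
    have : 1 ≤ ‖a‖ := by simpa using ha
    nlinarith

/-- Mean value property on the slices of the ball: what is left is an integral over the disc, with
a power of `1 - |a|²` as weight. -/
lemma integral_slice_ae {m : ℕ} {F : (Fin (m + 1) → ℂ) → ℂ}
    (hF : DifferentiableOn ℂ F (sqBall (m + 1) 1)) (hi : IntegrableOn F (sqBall (m + 1) 1)) :
    ∀ᵐ a ∂(volume.restrict (ball (0 : ℂ) 1)),
      ∫ w in sqBall m (1 - ‖a‖ ^ 2), F (Fin.cons a w) =
        (volume.real (sqBall m 1) : ℂ) *
          (F (Fin.cons a 0) * (((1 - ‖a‖ ^ 2) ^ m : ℝ) : ℂ)) := by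
  filter_upwards [ae_restrict_of_ae (integrableOn_cons hi).prod_right_ae,
    ae_restrict_mem measurableSet_ball] with a ha ha1
  have ha2 : ‖a‖ < 1 := by simpa using ha1
  have hR : 0 < 1 - ‖a‖ ^ 2 := by nlinarith [norm_nonneg a]
  rw [indicator_cons, integrable_indicator_iff (isOpen_sqBall _ _).measurableSet] at ha
  have hcons : Differentiable ℂ fun w : Fin m → ℂ ↦ (Fin.cons a w : Fin (m + 1) → ℂ) := by
    rw [differentiable_pi]
    intro i
    refine Fin.cases ?_ (fun j ↦ ?_) i
    · simp
    · simp only [Fin.cons_succ]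
      fun_prop
  have h := (rotationInvariant_volume_pi m).setIntegral_eq_of_balanced
    (isOpen_sqBall m (1 - ‖a‖ ^ 2)).measurableSet smul_mem_sqBall
    (hF.comp hcons.differentiableOn fun w hw ↦ (cons_mem_sqBall_iff a w).2 hw) ha
  refine h.trans ?_
  rw [volume_real_sqBall hR]
  simp only [Function.comp_apply]
  push_cast
  ring

lemma integrableOn_disc_of_ball {m : ℕ} {F : (Fin (m + 1) → ℂ) → ℂ}
    (hF : DifferentiableOn ℂ F (sqBall (m + 1) 1)) (hi : IntegrableOn F (sqBall (m + 1) 1)) :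
    IntegrableOn (fun a ↦ F (Fin.cons a 0) * (((1 - ‖a‖ ^ 2) ^ m : ℝ) : ℂ)) (ball (0 : ℂ) 1) := by
  have h1 := (integrableOn_cons hi).integral_prod_left
  have h2 : IntegrableOn (fun a ↦ (volume.real (sqBall m 1) : ℂ) *
      (F (Fin.cons a 0) * (((1 - ‖a‖ ^ 2) ^ m : ℝ) : ℂ))) (ball (0 : ℂ) 1) := by
    refine (h1.integrableOn (s := ball 0 1)).congr ?_
    filter_upwards [integral_slice_ae hF hi] with a ha
    rw [← ha, indicator_cons, integral_indicator (isOpen_sqBall _ _).measurableSet]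
  have h3 : (volume.real (sqBall m 1) : ℂ) ≠ 0 := by
    exact_mod_cast (volume_real_sqBall_pos m).ne'
  have h4 := h2.const_mul (volume.real (sqBall m 1) : ℂ)⁻¹
  simp only [inv_mul_cancel_left₀ h3] at h4
  exact h4

lemma differentiable_cons_left (m : ℕ) :
    Differentiable ℂ fun a : ℂ ↦ (Fin.cons a 0 : Fin (m + 1) → ℂ) := by
  rw [differentiable_pi]
  intro i
  refine Fin.cases ?_ (fun j ↦ ?_) i
  · simp
  · simp

lemma cons_zero_mem_sqBall_iff {m : ℕ} (a : ℂ) :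
    (Fin.cons a 0 : Fin (m + 1) → ℂ) ∈ sqBall (m + 1) 1 ↔ ‖a‖ < 1 := by
  simp only [sqBall, Set.mem_ofPred_eq, normSq_cons, normSq_zero, add_zero]
  constructor <;> intro h <;> nlinarith [norm_nonneg a]

/-- The mean value property in the slices reduces the reproducing formula at a point of the first axis
to the weighted formula `disc_reproducing` on the disc. -/
lemma integral_ball_kernel_axis {m : ℕ} {F : (Fin (m + 1) → ℂ) → ℂ}
    (hF : DifferentiableOn ℂ F (sqBall (m + 1) 1)) (hi : IntegrableOn F (sqBall (m + 1) 1))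
    {t : ℂ} (ht : ‖t‖ < 1) :
    ∫ v in sqBall (m + 1) 1, F v * (1 / (1 - t * conj (v 0)) ^ (m + 2)) =
      (volume.real (sqBall m 1) : ℂ) * (F (Fin.cons t 0) *
        ((∫ a in ball (0 : ℂ) 1, (1 - ‖a‖ ^ 2) ^ m : ℝ) : ℂ)) := by
  have hS := (isOpen_sqBall (m + 1) 1).measurableSet
  have hv0 : ∀ v ∈ sqBall (m + 1) 1, ‖v 0‖ < 1 := by
    intro v hv
    have h1 : ‖v 0‖ ^ 2 ≤ normSq v :=
      Finset.single_le_sum (f := fun i ↦ ‖v i‖ ^ 2) (fun _ _ ↦ sq_nonneg _) (Finset.mem_univ 0)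
    have h2 : normSq v < 1 := hv
    nlinarith [norm_nonneg (v 0)]
  have hconj : Measurable fun v : Fin (m + 1) → ℂ ↦ conj (v 0) :=
    Complex.continuous_conj.measurable.comp (measurable_pi_apply 0)
  have hi2 : IntegrableOn (fun v ↦ F v * (1 / (1 - t * conj (v 0)) ^ (m + 2)))
      (sqBall (m + 1) 1) := by
    refine Integrable.mul_bdd (c := 1 / (1 - ‖t‖) ^ (m + 2)) hi
      (Measurable.aestronglyMeasurable (by fun_prop)) ?_
    filter_upwards [ae_restrict_mem hS] with v hv
    have h1 : 0 < 1 - ‖t‖ := by linarith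
    have h2 : 1 - ‖t‖ ≤ ‖1 - t * conj (v 0)‖ := by
      have h3 := norm_sub_norm_le 1 (t * conj (v 0))
      rw [norm_one, norm_mul, RCLike.norm_conj] at h3
      nlinarith [norm_nonneg t, norm_nonneg (v 0), hv0 v hv]
    rw [norm_div, norm_one, norm_pow]
    gcongr
  rw [setIntegral_ball_eq_slices hi2]
  have h1 : ∀ a : ℂ, ∫ w in sqBall m (1 - ‖a‖ ^ 2), F (Fin.cons a w) *
      (1 / (1 - t * conj ((Fin.cons a w : Fin (m + 1) → ℂ) 0)) ^ (m + 2)) =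
      (∫ w in sqBall m (1 - ‖a‖ ^ 2), F (Fin.cons a w)) *
        (1 / (1 - t * conj a) ^ (m + 2)) := by
    intro a
    simp only [Fin.cons_zero]
    rw [integral_mul_const]
  simp_rw [h1]
  have h2 : ∫ a in ball (0 : ℂ) 1, (∫ w in sqBall m (1 - ‖a‖ ^ 2), F (Fin.cons a w)) *
        (1 / (1 - t * conj a) ^ (m + 2)) =
      ∫ a in ball (0 : ℂ) 1, (volume.real (sqBall m 1) : ℂ) *
        (F (Fin.cons a 0) * (((1 - ‖a‖ ^ 2) ^ m : ℝ) : ℂ) * (1 / (1 - t * conj a) ^ (m + 2))) := by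
    refine integral_congr_ae ?_
    filter_upwards [integral_slice_ae hF hi] with a ha
    rw [ha]
    ring
  have hd : DifferentiableOn ℂ (fun a : ℂ ↦ F (Fin.cons a 0)) (ball 0 1) :=
    hF.comp (differentiable_cons_left m).differentiableOn
      fun a ha ↦ (cons_zero_mem_sqBall_iff a).2 (by simpa using ha)
  rw [h2, integral_const_mul, disc_reproducing m hd (integrableOn_disc_of_ball hF hi) ht]

/-- Comparison of volumes: the case `F = 1`, `t = 0` of `integral_ball_kernel_axis`. -/
lemma volume_real_ball_succ (m : ℕ) :
    (volume.real (sqBall (m + 1) 1) : ℂ) = (volume.real (sqBall m 1) : ℂ) *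
      ((∫ a in ball (0 : ℂ) 1, (1 - ‖a‖ ^ 2) ^ m : ℝ) : ℂ) := by
  have h := integral_ball_kernel_axis (m := m) (F := fun _ ↦ 1) (differentiableOn_const 1)
    (integrableOn_const (volume_sqBall_lt_top _ _).ne) (t := 0) (by simp)
  simpa [integral_const] using h

/-- Reproducing formula for the ball, at the points of the first coordinate axis. -/
lemma ball_reproducing_axis {m : ℕ} {F : (Fin (m + 1) → ℂ) → ℂ}
    (hF : DifferentiableOn ℂ F (sqBall (m + 1) 1)) (hi : IntegrableOn F (sqBall (m + 1) 1))
    {t : ℂ} (ht : ‖t‖ < 1) :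
    ∫ v in sqBall (m + 1) 1, F v * (1 / (1 - t * conj (v 0)) ^ (m + 2)) =
      F (Fin.cons t 0) * volume.real (sqBall (m + 1) 1) := by
  rw [integral_ball_kernel_axis hF hi ht, volume_real_ball_succ]
  ring

/-- Every vector is moved to the first coordinate axis by a unitary map. -/
lemma exists_unitary {m : ℕ} (u : Fin (m + 1) → ℂ) :
    ∃ (U : (Fin (m + 1) → ℂ) ≃L[ℂ] (Fin (m + 1) → ℂ)) (t : ℂ),
      (∀ x y, herm (U x) (U y) = herm x y) ∧ U u = Fin.cons t 0 := by
  let W := WithLp.linearEquiv 2 ℂ (Fin (m + 1) → ℂ)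
  have hW : ∀ x y : EuclideanSpace ℂ (Fin (m + 1)), inner ℂ y x = herm (W x) (W y) := by
    intro x y
    simp [herm, PiLp.inner_apply, W]
  obtain ⟨e, c, he, hc⟩ : ∃ (e : EuclideanSpace ℂ (Fin (m + 1))) (c : ℂ),
      ‖e‖ = 1 ∧ W.symm u = c • e := by
    rcases eq_or_ne (W.symm u) 0 with h | h
    · refine ⟨EuclideanSpace.single 0 1, 0, by simp, by simp [h]⟩
    · refine ⟨((‖W.symm u‖ : ℂ)⁻¹) • W.symm u, ‖W.symm u‖, ?_, ?_⟩
      · rw [norm_smul, norm_inv, Complex.norm_real, norm_norm,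
          inv_mul_cancel₀ (norm_ne_zero_iff.2 h)]
      · rw [smul_inv_smul₀]
        exact_mod_cast (norm_ne_zero_iff.2 h)
  have hon : Orthonormal ℂ (({0} : Set (Fin (m + 1))).domRestrict
      (fun _ ↦ e : Fin (m + 1) → EuclideanSpace ℂ (Fin (m + 1)))) := by
    refine ⟨fun i ↦ he, fun i j hij ↦ ?_⟩
    exact absurd (Subsingleton.elim i j) hij
  obtain ⟨b, hb⟩ := hon.exists_orthonormalBasis_extension_of_card_eq (by simp)
  have hb0 : b 0 = e := hb 0 rfl
  refine ⟨((W.symm.trans b.repr.toLinearEquiv).trans W).toContinuousLinearEquiv, c, ?_, ?_⟩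
  · intro x y
    have h1 := hW (b.repr (W.symm x)) (b.repr (W.symm y))
    have h2 := hW (W.symm x) (W.symm y)
    rw [b.repr.inner_map_map, h2] at h1
    simp only [LinearEquiv.apply_symm_apply] at h1
    exact h1.symm
  · change W (b.repr (W.symm u)) = _
    rw [hc, map_smul, map_smul, ← hb0, b.repr_self]
    ext i
    refine Fin.cases ?_ (fun j ↦ ?_) i
    · simp [W]
    · simp [W]

lemma normSq_eq_of_unitary {m : ℕ} {U : (Fin m → ℂ) ≃L[ℂ] (Fin m → ℂ)}
    (hU : ∀ x y, herm (U x) (U y) = herm x y) (x : Fin m → ℂ) : normSq (U x) = normSq x := by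
  have h := hU x x
  rw [herm_self, herm_self] at h
  exact_mod_cast h

/-- Unitary maps preserve Lebesgue measure: the image measure is a Haar measure which agrees with
Lebesgue measure on the unit ball. -/
lemma measurePreserving_of_unitary {m : ℕ} {U : (Fin m → ℂ) ≃L[ℂ] (Fin m → ℂ)}
    (hU : ∀ x y, herm (U x) (U y) = herm x y) : MeasurePreserving U := by
  refine ⟨U.continuous.measurable, ?_⟩
  have hmap : (Measure.map U (volume : Measure (Fin m → ℂ))).IsAddHaarMeasure :=
    ContinuousLinearEquiv.isAddHaarMeasure_map U volume
  have h1 := Measure.isAddLeftInvariant_eq_smul (Measure.map U (volume : Measure (Fin m → ℂ))) volume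
  have h2 : Measure.map U (volume : Measure (Fin m → ℂ)) (sqBall m 1) = volume (sqBall m 1) := by
    rw [Measure.map_apply U.continuous.measurable (isOpen_sqBall m 1).measurableSet]
    congr 1
    ext x
    simp [sqBall, normSq_eq_of_unitary hU]
  have hpos : volume (sqBall m 1) ≠ 0 := by
    intro h
    have := volume_real_sqBall_pos m
    rw [measureReal_def, h] at this
    simp at this
  obtain ⟨c, hc⟩ : ∃ c : ℝ≥0∞, Measure.map U (volume : Measure (Fin m → ℂ)) = c • volume :=
    ⟨_, h1.trans rfl⟩
  rw [hc, Measure.smul_apply, smul_eq_mul] at h2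
  have h3 : c = 1 := by
    rw [← ENNReal.mul_left_inj hpos (volume_sqBall_lt_top m 1).ne, h2, one_mul]
  rw [hc, h3, one_smul]

/-- The Bergman kernel of the unit ball of `ℂᵐ`. -/
noncomputable def ballKernel (m : ℕ) (u v : Fin m → ℂ) : ℂ :=
  (volume.real (sqBall m 1) : ℂ)⁻¹ * (1 / (1 - herm u v) ^ (m + 1))

lemma norm_herm_sq_le {m : ℕ} (u v : Fin m → ℂ) : ‖herm u v‖ ^ 2 ≤ normSq u * normSq v := by
  have h1 : ‖herm u v‖ ≤ ∑ i, ‖u i‖ * ‖v i‖ := by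
    refine (norm_sum_le _ _).trans (le_of_eq ?_)
    simp
  calc ‖herm u v‖ ^ 2 ≤ (∑ i, ‖u i‖ * ‖v i‖) ^ 2 := by gcongr
    _ ≤ _ := Finset.sum_mul_sq_le_sq_mul_sq _ _ _

lemma norm_herm_le {m : ℕ} {u v : Fin m → ℂ} (hv : v ∈ sqBall m 1) :
    ‖herm u v‖ ≤ √(normSq u) := by
  refine Real.le_sqrt_of_sq_le ((norm_herm_sq_le u v).trans ?_)
  have hv1 : normSq v < 1 := hv
  nlinarith [normSq_nonneg u]

lemma sqrt_normSq_lt_one {m : ℕ} {u : Fin m → ℂ} (hu : u ∈ sqBall m 1) : √(normSq u) < 1 := by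
  rw [Real.sqrt_lt' one_pos, one_pow]
  exact hu

lemma one_sub_herm_ne_zero {m : ℕ} {u v : Fin m → ℂ} (hu : u ∈ sqBall m 1) (hv : v ∈ sqBall m 1) :
    1 - herm u v ≠ 0 := by
  intro h
  have h1 := (norm_herm_le (u := u) hv).trans_lt (sqrt_normSq_lt_one hu)
  rw [← sub_eq_zero.1 h, norm_one] at h1
  exact lt_irrefl _ h1

/-- A unitary map, which leaves the kernel and the measure invariant, moves the point of evaluation to
the first coordinate axis. -/
lemma isBergmanKernel_ball (m : ℕ) :
    IsBergmanKernel (sqBall (m + 1) 1) (ballKernel (m + 1)) := by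
  have hS := (isOpen_sqBall (m + 1) 1).measurableSet
  have hfin : IsFiniteMeasure (volume.restrict (sqBall (m + 1) 1)) :=
    ⟨by simpa using volume_sqBall_lt_top (m + 1) 1⟩
  have hconj : Measurable fun v : ℂ ↦ conj v := Complex.continuous_conj.measurable
  have hmeas : Measurable (Function.uncurry (ballKernel (m + 1))) := by
    unfold ballKernel Function.uncurry herm
    fun_prop
  refine ⟨isOpen_sqBall _ _, hmeas, ?_, ?_, ?_, ?_⟩
  · intro x y
    simp only [ballKernel, map_mul, map_inv₀, Complex.conj_ofReal, map_div₀, map_one, map_pow,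
      map_sub, conj_herm]
  · intro y hy
    have hd : DifferentiableOn ℂ (fun x ↦ (1 - herm x y) ^ (m + 1 + 1)) (sqBall (m + 1) 1) := by
      unfold herm
      fun_prop
    simp only [ballKernel, one_div]
    exact (hd.inv fun x hx ↦ pow_ne_zero _ (one_sub_herm_ne_zero hx hy)).const_mul _
  · intro y hy
    set c := 1 - √(normSq y) with hc
    have hc0 : 0 < c := by linarith [sqrt_normSq_lt_one hy]
    refine MemLp.of_bound ?_
      (‖(volume.real (sqBall (m + 1) 1) : ℂ)⁻¹‖ * (1 / c ^ (m + 1 + 1))) ?_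
    · exact (hmeas.comp measurable_prodMk_right).aestronglyMeasurable
    · filter_upwards [ae_restrict_mem hS] with x hx
      have h2 : c ≤ ‖1 - herm x y‖ := by
        have h3 := norm_sub_norm_le 1 (herm x y)
        have h4 := norm_herm_le (u := y) hx
        rw [← conj_herm, RCLike.norm_conj] at h4
        rw [norm_one] at h3
        linarith
      rw [ballKernel, norm_mul, norm_div, norm_one, norm_pow]
      gcongr
  · intro F hF hF2 u hu
    obtain ⟨U, t, hU, hUu⟩ := exists_unitary u
    have hmp := measurePreserving_of_unitary hU
    have hpre : U ⁻¹' (sqBall (m + 1) 1) = sqBall (m + 1) 1 := by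
      ext x
      simp [sqBall, normSq_eq_of_unitary hU]
    have ht : ‖t‖ < 1 := by
      rw [← cons_zero_mem_sqBall_iff (m := m), ← hUu]
      rw [← hpre] at hu
      exact hu
    have hGd : DifferentiableOn ℂ (fun v ↦ F (U.symm v)) (sqBall (m + 1) 1) := by
      refine hF.comp U.symm.differentiableOn fun v hv ↦ ?_
      rw [← hpre]
      simpa using hv
    have hi : IntegrableOn F (sqBall (m + 1) 1) := hF2.integrable (by norm_num)
    have hres := hmp.restrict_preimage hS
    rw [hpre] at hres
    have hemb : MeasurableEmbedding U := U.toHomeomorph.measurableEmbedding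
    have hGi : IntegrableOn (fun v ↦ F (U.symm v)) (sqBall (m + 1) 1) := by
      rw [IntegrableOn, ← hres.integrable_comp_emb hemb]
      simp only [Function.comp_def, U.symm_apply_apply]
      exact hi
    have h1 := ball_reproducing_axis hGd hGi ht
    rw [← hUu, U.symm_apply_apply, ← hres.integral_comp hemb] at h1
    simp only [U.symm_apply_apply] at h1
    have hV : (volume.real (sqBall (m + 1) 1) : ℂ) ≠ 0 := by
      exact_mod_cast (volume_real_sqBall_pos (m + 1)).ne'
    have h2 : F u = (volume.real (sqBall (m + 1) 1) : ℂ)⁻¹ *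
        (F u * volume.real (sqBall (m + 1) 1)) := by
      field_simp
    rw [h2, ← h1, ← integral_const_mul]
    refine integral_congr_ae (ae_of_all _ fun v ↦ ?_)
    simp only [ballKernel]
    rw [← herm_cons_zero, ← hUu, hU]
    ring

/-- Scaling of the weight on the slices of the ball to the unit ball. -/
lemma lintegral_slice_weight {m : ℕ} {R σ : ℝ} (hR : 0 < R) :
    ∫⁻ w in sqBall m R, ENNReal.ofReal (R - normSq w) ^ (-σ) =
      ENNReal.ofReal R ^ m * (ENNReal.ofReal R ^ (-σ) *
        ∫⁻ w in sqBall m 1, ENNReal.ofReal (1 - normSq w) ^ (-σ)) := by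
  have hR0 : ENNReal.ofReal R ≠ 0 := by simpa using hR
  rw [setLIntegral_sqBall hR (by fun_prop), ← lintegral_const_mul' _ _
    (ENNReal.rpow_ne_top_of_ne_zero hR0 ENNReal.ofReal_ne_top)]
  congr 1
  refine setLIntegral_congr_fun (isOpen_sqBall m 1).measurableSet fun w _ ↦ ?_
  have h1 : R - normSq (((√R : ℝ) : ℂ) • w) = R * (1 - normSq w) := by
    rw [normSq_smul, Complex.norm_real, Real.norm_of_nonneg (Real.sqrt_nonneg _),
      Real.sq_sqrt hR.le]
    ring
  simp only [h1]
  rw [ENNReal.ofReal_mul hR.le, ENNReal.mul_rpow_of_ne_top ENNReal.ofReal_ne_top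
    ENNReal.ofReal_ne_top]

/-- The weight `(1 - |w|²)^{-σ}` is integrable over the ball. -/
lemma lintegral_ball_weight_lt_top {σ : ℝ} (hσ1 : σ < 1) (m : ℕ) :
    ∫⁻ w in sqBall m 1, ENNReal.ofReal (1 - normSq w) ^ (-σ) < ∞ := by
  induction m with
  | zero =>
    simp only [normSq, Finset.univ_eq_empty, Finset.sum_empty, sub_zero, ENNReal.ofReal_one,
      ENNReal.one_rpow, lintegral_const, one_mul, Measure.restrict_apply_univ]
    exact volume_sqBall_lt_top 0 1
  | succ m ih =>
    rw [setLIntegral_ball_eq_slices (by fun_prop)]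
    calc ∫⁻ a in ball (0 : ℂ) 1, ∫⁻ w in sqBall m (1 - ‖a‖ ^ 2),
          ENNReal.ofReal (1 - normSq (Fin.cons a w : Fin (m + 1) → ℂ)) ^ (-σ)
        ≤ ∫⁻ a in ball (0 : ℂ) 1, ENNReal.ofReal (1 - ‖a‖ ^ 2) ^ (-σ) *
            ∫⁻ w in sqBall m 1, ENNReal.ofReal (1 - normSq w) ^ (-σ) := by
          refine setLIntegral_mono' measurableSet_ball fun a ha ↦ ?_
          have ha1 : ‖a‖ < 1 := by simpa using ha
          have hR : 0 < 1 - ‖a‖ ^ 2 := by nlinarith [norm_nonneg a]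
          simp only [normSq_cons, ← sub_sub]
          rw [lintegral_slice_weight hR]
          refine mul_le_of_le_one_left zero_le (pow_le_one₀ zero_le ?_)
          exact ENNReal.ofReal_le_one.2 (by nlinarith [sq_nonneg ‖a‖])
      _ = (∫⁻ a in ball (0 : ℂ) 1, ENNReal.ofReal (1 - ‖a‖ ^ 2) ^ (-σ)) *
            ∫⁻ w in sqBall m 1, ENNReal.ofReal (1 - normSq w) ^ (-σ) :=
          lintegral_mul_const' _ _ ih.ne
      _ < ∞ := ENNReal.mul_lt_top (lintegral_disc_weight_lt_top hσ1) ih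

/-- **Forelli–Rudin estimate** on the unit ball. A unitary map reduces it to points of the first
coordinate axis, and integration over slices to the estimate on the disc. -/
lemma subinvariant_ballKernel {σ : ℝ} (hσ : 0 < σ) (hσ1 : σ < 1) (m : ℕ) :
    Subinvariant (sqBall (m + 1) 1) (ballKernel (m + 1))
      fun v ↦ ENNReal.ofReal (1 - normSq v) ^ (-σ) := by
  obtain ⟨C, hC⟩ := disc_forelliRudin hσ hσ1
  have hA := lintegral_ball_weight_lt_top hσ1 m
  have hS := (isOpen_sqBall (m + 1) 1).measurableSet
  lift (∫⁻ w in sqBall m 1, ENNReal.ofReal (1 - normSq w) ^ (-σ)) to ℝ≥0 using hA.ne with A hA'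
  set V := ‖(volume.real (sqBall (m + 1) 1) : ℂ)⁻¹‖₊ with hV
  refine ⟨V * A * 2 ^ m * C, fun u hu ↦ ?_⟩
  obtain ⟨U, t, hU, hUu⟩ := exists_unitary u
  have hmp := measurePreserving_of_unitary hU
  have hpre : U ⁻¹' (sqBall (m + 1) 1) = sqBall (m + 1) 1 := by
    ext x
    simp [sqBall, normSq_eq_of_unitary hU]
  have ht : ‖t‖ < 1 := by
    rw [← cons_zero_mem_sqBall_iff (m := m), ← hUu]
    rw [← hpre] at hu
    exact hu
  have hnu : normSq u = ‖t‖ ^ 2 := by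
    rw [← normSq_eq_of_unitary hU, hUu, normSq_cons, normSq_zero, add_zero]
  have hemb : MeasurableEmbedding U := U.toHomeomorph.measurableEmbedding
  have hres := hmp.restrict_preimage hS
  rw [hpre] at hres
  have h1 := hres.lintegral_comp_emb hemb
    fun v ↦ ‖ballKernel (m + 1) (Fin.cons t 0) v‖ₑ * ENNReal.ofReal (1 - normSq v) ^ (-σ)
  have h2 : ∀ v, ballKernel (m + 1) (Fin.cons t 0) (U v) = ballKernel (m + 1) u v := by
    intro v
    simp only [ballKernel, ← hUu, hU]
  simp only [h2, normSq_eq_of_unitary hU] at h1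
  have hm : Measurable fun v : Fin (m + 1) → ℂ ↦
      ‖ballKernel (m + 1) (Fin.cons t 0) v‖ₑ * ENNReal.ofReal (1 - normSq v) ^ (-σ) :=
    ((isBergmanKernel_ball m).measurable_right _).enorm.mul (by fun_prop)
  rw [h1, setLIntegral_ball_eq_slices hm]
  simp only [hnu]
  have key : ∀ a ∈ ball (0 : ℂ) 1, ∫⁻ w in sqBall m (1 - ‖a‖ ^ 2),
      ‖ballKernel (m + 1) (Fin.cons t 0) (Fin.cons a w)‖ₑ *
        ENNReal.ofReal (1 - normSq (Fin.cons a w : Fin (m + 1) → ℂ)) ^ (-σ) ≤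
      V * A * 2 ^ m *
        (‖1 / (1 - t * conj a) ^ 2‖ₑ * ENNReal.ofReal (1 - ‖a‖ ^ 2) ^ (-σ)) := by
    intro a ha
    have ha1 : ‖a‖ < 1 := by simpa using ha
    have hR : 0 < 1 - ‖a‖ ^ 2 := by nlinarith [norm_nonneg a]
    have hne := one_sub_mul_conj_ne_zero ht ha1
    have h3 : ∀ w : Fin m → ℂ, ‖ballKernel (m + 1) (Fin.cons t 0) (Fin.cons a w)‖ₑ =
        V * ‖1 / (1 - t * conj a) ^ (m + 2)‖ₑ := by
      intro w
      rw [ballKernel, herm_cons_zero, Fin.cons_zero, enorm_mul]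
      rfl
    simp only [h3, normSq_cons, ← sub_sub]
    rw [lintegral_const_mul' _ _ (ENNReal.mul_ne_top ENNReal.coe_ne_top enorm_ne_top),
      lintegral_slice_weight hR, ← hA']
    -- `1 - |a|² ≤ 2 |1 - t conj a|` absorbs the power `m` of the kernel
    have h4 : ‖1 / (1 - t * conj a) ^ (m + 2)‖ₑ * ENNReal.ofReal (1 - ‖a‖ ^ 2) ^ m ≤
        2 ^ m * ‖1 / (1 - t * conj a) ^ 2‖ₑ := by
      rw [← ofReal_norm, ← ofReal_norm, ← ENNReal.ofReal_pow hR.le,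
        ← ENNReal.ofReal_mul (norm_nonneg _), show (2 : ℝ≥0∞) ^ m = ENNReal.ofReal (2 ^ m) by
          rw [ENNReal.ofReal_pow (by norm_num)]; norm_num,
        ← ENNReal.ofReal_mul (by positivity)]
      refine ENNReal.ofReal_le_ofReal ?_
      have h5 : 1 - ‖a‖ ^ 2 ≤ 2 * ‖1 - t * conj a‖ := by
        have h6 := norm_sub_norm_le 1 (t * conj a)
        rw [norm_one, norm_mul, RCLike.norm_conj] at h6
        nlinarith [norm_nonneg a, norm_nonneg t]
      have h7 : 0 < ‖1 - t * conj a‖ := norm_pos_iff.2 hne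
      have h8 := pow_le_pow_left₀ hR.le h5 m
      rw [norm_div, norm_div, norm_one, norm_pow, norm_pow, pow_add, one_div_mul_eq_div,
        mul_one_div, div_le_div_iff₀ (by positivity) (by positivity)]
      rw [mul_pow] at h8
      calc _ ≤ 2 ^ m * ‖1 - t * conj a‖ ^ m * ‖1 - t * conj a‖ ^ 2 := by gcongr
        _ = _ := by ring
    calc _ = V * A * (‖1 / (1 - t * conj a) ^ (m + 2)‖ₑ * ENNReal.ofReal (1 - ‖a‖ ^ 2) ^ m) *
          ENNReal.ofReal (1 - ‖a‖ ^ 2) ^ (-σ) := by ring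
      _ ≤ V * A * (2 ^ m * ‖1 / (1 - t * conj a) ^ 2‖ₑ) *
          ENNReal.ofReal (1 - ‖a‖ ^ 2) ^ (-σ) := by gcongr
      _ = _ := by ring
  refine (setLIntegral_mono' measurableSet_ball key).trans ?_
  rw [lintegral_const_mul' _ _ (by
    rw [show (V : ℝ≥0∞) * A * 2 ^ m = ((V * A * 2 ^ m : ℝ≥0) : ℝ≥0∞) by push_cast; rfl]
    exact ENNReal.coe_ne_top)]
  push_cast
  rw [mul_assoc ((V : ℝ≥0∞) * A * 2 ^ m)]
  gcongr 1
  exact hC t (by simpa using ht)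

/-- Schur's test applies to the ball for all exponents. -/
lemma hasSchurKernel_ball {p q : ℝ} (hpq : p.HolderConjugate q) (m : ℕ) :
    HasSchurKernel (sqBall (m + 1) 1) p q := by
  have hp := hpq.pos
  have hq := hpq.symm.pos
  refine ⟨ballKernel (m + 1), fun v ↦ ENNReal.ofReal (1 - normSq v) ^ (-(1 / (p * q))),
    isBergmanKernel_ball m, by fun_prop, fun v hv ↦ ?_, fun v hv ↦ ?_, ?_, ?_⟩
  · have hv1 : 0 < 1 - normSq v := sub_pos.2 hv
    exact (ENNReal.rpow_pos (by simpa using hv1) ENNReal.ofReal_ne_top).ne'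
  · have hv1 : 0 < 1 - normSq v := sub_pos.2 hv
    exact ENNReal.rpow_ne_top_of_ne_zero (by simpa using hv1) ENNReal.ofReal_ne_top
  · simp only [← ENNReal.rpow_mul]
    rw [show -(1 / (p * q)) * p = -(1 / q) by field_simp]
    refine subinvariant_ballKernel (by positivity) ?_ m
    rw [div_lt_one hq]
    exact hpq.symm.lt
  · simp only [← ENNReal.rpow_mul]
    rw [show -(1 / (p * q)) * q = -(1 / p) by field_simp]
    refine subinvariant_ballKernel (by positivity) ?_ m
    rw [div_lt_one hp]
    exact hpq.lt

/-! ### Schur's test on cones -/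

/-- Pulled back to `D × (punctured disc)`, the weight on the cone becomes a product whose second factor
is `|η|^{N - t r} (1 - |η|²)^{-s r}`, the Jacobian determinant being `η^N`. The conditions on the
exponents are those of the Forelli–Rudin estimate `subinvariant_discKernel`. -/
lemma subinvariant_cone {N : ℕ} {D : Set (Fin N → ℂ)} {K : (Fin N → ℂ) → (Fin N → ℂ) → ℂ}
    (hK : IsBergmanKernel D K) {h : (Fin N → ℂ) → ℝ≥0∞} (hh : Measurable h) {r s t : ℝ}
    (hr : 0 ≤ r) (hs : Subinvariant D K fun x ↦ h x ^ r) (hsr : 0 < s * r) (hsr1 : s * r < 1)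
    (ht : (N : ℝ) ≤ t * r) (ht2 : t * r < N + 2) :
    Subinvariant (cone D)
      (fun y y' ↦ K (y.2⁻¹ • y.1) (y'.2⁻¹ • y'.1) * discKernel y.2 y'.2 *
        ((y.2 ^ N)⁻¹ * conj (y'.2 ^ N)⁻¹))
      fun z ↦ (h (z.2⁻¹ • z.1) * (‖z.2‖ₑ ^ (-t) * ENNReal.ofReal (1 - ‖z.2‖ ^ 2) ^ (-s))) ^ r := by
  have hb := isBiholomorphism_cone hK.isOpen
  have hK0 := hK.prod isBergmanKernel_puncturedDisc
  refine hb.subinvariant hK0 (by fun_prop) ?_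
  have h1 := Subinvariant.prod hK isBergmanKernel_puncturedDisc (hh.pow_const r) (by fun_prop) hs
    (subinvariant_discKernel (σ := s * r) (b := N - t * r) hsr hsr1 (by linarith) (by linarith))
  refine h1.congr hK0.isOpen.measurableSet ?_
  rintro ⟨u, η⟩ ⟨-, hη⟩
  have hη0 : ‖η‖ₑ ≠ 0 := by simpa using hη.1
  simp only [inv_smul_smul₀ hη.1]
  rw [ENNReal.mul_rpow_of_nonneg _ _ hr, ENNReal.mul_rpow_of_nonneg _ _ hr, ← ENNReal.rpow_mul,
    ← ENNReal.rpow_mul, neg_mul, neg_mul, enorm_pow, sub_eq_add_neg,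
    ENNReal.rpow_add _ _ hη0 enorm_ne_top, ENNReal.rpow_natCast]
  ring

/-- Schur's test passes from a set in `ℂᴺ` to the cone over it, if the exponents satisfy
`(N + 1) |1 / p - 1 / 2| < 1 / 2`, written here without denominators. -/
lemma HasSchurKernel.cone {N : ℕ} {D : Set (Fin N → ℂ)} {p q : ℝ} (hpq : p.HolderConjugate q)
    (h1 : (N : ℝ) * (p - 1) < N + 2) (h2 : (N : ℝ) < (N + 2) * (p - 1))
    (hD : HasSchurKernel D p q) : HasSchurKernel (cone D) p q := by
  obtain ⟨K, h, hK, hh⟩ := hD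
  have hp := hpq.pos
  have hq := hpq.symm.pos
  have hp1 : 0 < p - 1 := sub_pos.2 hpq.lt
  have hqp : q * (p - 1) = p := by
    have := hpq.mul_eq_add
    linarith
  -- `t` is the least exponent for which `|η|^{N - t p}` and `|η|^{N - t q}` are both nonincreasing;
  -- they are both integrable on the disc exactly when `h1` and `h2` hold
  set t : ℝ := max (N / p) (N / q) with ht
  have htp : t * p = max (N : ℝ) (N * (p - 1)) := by
    rw [ht, max_mul_of_nonneg _ _ hp.le]
    congr 1
    · field_simp
    · rw [div_mul_eq_mul_div, div_eq_iff hq.ne', mul_assoc, mul_comm (p - 1), hqp]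
  have htq : t * q * (p - 1) = max (N : ℝ) (N * (p - 1)) := by
    rw [mul_assoc, hqp, htp]
  have hs : 0 < 1 / (p * q) := by positivity
  have hsp : 1 / (p * q) * p = 1 / q := by field_simp
  have hsq : 1 / (p * q) * q = 1 / p := by field_simp
  refine ⟨_, fun z ↦ h (z.2⁻¹ • z.1) *
      (‖z.2‖ₑ ^ (-t) * ENNReal.ofReal (1 - ‖z.2‖ ^ 2) ^ (-(1 / (p * q)))),
    (isBiholomorphism_cone hK.isOpen).isBergmanKernel (hK.prod isBergmanKernel_puncturedDisc),
    ?_, fun z hz ↦ ?_, fun z hz ↦ ?_, ?_, ?_⟩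
  · have := hh.measurable
    fun_prop
  · have hz1 : 0 < 1 - ‖z.2‖ ^ 2 := by nlinarith [norm_nonneg z.2, hz.1.2]
    have hz2 : 0 < ‖z.2‖ₑ := by simpa using hz.1.1
    exact mul_ne_zero (hh.ne_zero _ hz.2) (mul_ne_zero
      (ENNReal.rpow_pos hz2 enorm_ne_top).ne'
      (ENNReal.rpow_pos (by simpa using hz1) ENNReal.ofReal_ne_top).ne')
  · have hz1 : 0 < 1 - ‖z.2‖ ^ 2 := by nlinarith [norm_nonneg z.2, hz.1.2]
    have hz2 : ‖z.2‖ₑ ≠ 0 := by simpa using hz.1.1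
    exact ENNReal.mul_ne_top (hh.ne_top _ hz.2) (ENNReal.mul_ne_top
      (ENNReal.rpow_ne_top_of_ne_zero hz2 enorm_ne_top)
      (ENNReal.rpow_ne_top_of_ne_zero (by simpa using hz1) ENNReal.ofReal_ne_top))
  · refine subinvariant_cone hK hh.measurable hp.le hh.left ?_ ?_ ?_ ?_
    · positivity
    · rw [hsp, div_lt_one hq]
      exact hpq.symm.lt
    · rw [htp]
      exact le_max_left _ _
    · rw [htp]
      exact max_lt (by linarith) h1
  · refine subinvariant_cone hK hh.measurable hq.le hh.right ?_ ?_ ?_ ?_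
    · positivity
    · rw [hsq, div_lt_one hp]
      exact hpq.lt
    · refine le_of_mul_le_mul_right ?_ hp1
      rw [htq]
      exact le_max_right _ _
    · refine lt_of_mul_lt_mul_right ?_ hp1.le
      rw [htq]
      refine max_lt h2 ?_
      nlinarith

/-! ### The standard model as an iterated cone over a product of balls -/

lemma blockNorm_smul {n : ℕ} (a b : ℕ) (c : ℂ) (z : Fin n → ℂ) :
    blockNorm a b (c • z) = ‖c‖ * blockNorm a b z := by
  simp only [blockNorm, Pi.smul_apply, norm_smul, mul_pow, ← Finset.mul_sum]
  rw [Real.sqrt_mul (sq_nonneg _), Real.sqrt_sq (norm_nonneg _)]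

lemma blockNorm_nonneg {n : ℕ} (a b : ℕ) (z : Fin n → ℂ) : 0 ≤ blockNorm a b z :=
  Real.sqrt_nonneg _

/-- Concatenation of two vectors of coordinates. -/
noncomputable def appendEquiv (M k : ℕ) :
    ((Fin M → ℂ) × (Fin k → ℂ)) ≃L[ℂ] (Fin (M + k) → ℂ) :=
  ((LinearEquiv.sumArrowLequivProdArrow (Fin M) (Fin k) ℂ ℂ).symm.trans
    (LinearEquiv.funCongrLeft ℂ ℂ finSumFinEquiv.symm)).toContinuousLinearEquiv

lemma appendEquiv_apply {M k : ℕ} (q : (Fin M → ℂ) × (Fin k → ℂ)) (i : Fin (M + k)) :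
    appendEquiv M k q i = Sum.elim q.1 q.2 (finSumFinEquiv.symm i) := by
  simp [appendEquiv, LinearEquiv.sumArrowLequivProdArrow]
  rfl

@[simp] lemma appendEquiv_castAdd {M k : ℕ} (q : (Fin M → ℂ) × (Fin k → ℂ)) (i : Fin M) :
    appendEquiv M k q (Fin.castAdd k i) = q.1 i := by
  simp [appendEquiv_apply]

@[simp] lemma appendEquiv_natAdd {M k : ℕ} (q : (Fin M → ℂ) × (Fin k → ℂ)) (i : Fin k) :
    appendEquiv M k q (Fin.natAdd M i) = q.2 i := by
  simp [appendEquiv_apply]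

lemma measurePreserving_appendEquiv (M k : ℕ) : MeasurePreserving (appendEquiv M k) := by
  have h1 := volume_measurePreserving_sumPiEquivProdPi_symm (fun _ : Fin M ⊕ Fin k ↦ ℂ)
  have h2 := volume_measurePreserving_piCongrLeft (fun _ : Fin (M + k) ↦ ℂ) finSumFinEquiv
  have h3 := h2.comp h1
  have hfun : ⇑(appendEquiv M k) = (MeasurableEquiv.piCongrLeft (fun _ : Fin (M + k) ↦ ℂ)
      finSumFinEquiv) ∘ (MeasurableEquiv.sumPiEquivProdPi (fun _ : Fin M ⊕ Fin k ↦ ℂ)).symm := by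
    ext q i
    rw [appendEquiv_apply]
    obtain ⟨s, rfl⟩ := (finSumFinEquiv (m := M) (n := k)).surjective i
    rw [Equiv.symm_apply_apply]
    simp only [Function.comp_apply]
    rw [MeasurableEquiv.coe_piCongrLeft, Equiv.piCongrLeft_apply_apply]
    rcases s with s | s <;> rfl
  rw [hfun]
  exact h3

/-- Appending one more coordinate. -/
noncomputable def snocEquiv (N : ℕ) : ((Fin N → ℂ) × ℂ) ≃L[ℂ] (Fin (N + 1) → ℂ) :=
  LinearEquiv.toContinuousLinearEquiv
    { toFun := fun q ↦ Fin.snoc (α := fun _ ↦ ℂ) q.1 q.2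
      invFun := fun z ↦ (fun i ↦ z i.castSucc, z (Fin.last N))
      map_add' := fun x y ↦ by
        ext i
        refine Fin.lastCases ?_ (fun j ↦ ?_) i <;> simp
      map_smul' := fun c x ↦ by
        ext i
        refine Fin.lastCases ?_ (fun j ↦ ?_) i <;> simp
      left_inv := fun q ↦ by simp
      right_inv := fun z ↦ by
        ext i
        refine Fin.lastCases ?_ (fun j ↦ ?_) i <;> simp }

lemma snocEquiv_apply {N : ℕ} (q : (Fin N → ℂ) × ℂ) :
    snocEquiv N q = Fin.snoc (α := fun _ ↦ ℂ) q.1 q.2 := rfl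

@[simp] lemma snocEquiv_castSucc {N : ℕ} (q : (Fin N → ℂ) × ℂ) (i : Fin N) :
    snocEquiv N q i.castSucc = q.1 i := by simp [snocEquiv_apply]

@[simp] lemma snocEquiv_last {N : ℕ} (q : (Fin N → ℂ) × ℂ) :
    snocEquiv N q (Fin.last N) = q.2 := by simp [snocEquiv_apply]

lemma measurePreserving_snocEquiv (N : ℕ) : MeasurePreserving (snocEquiv N) := by
  have h1 := (volume_preserving_piFinSuccAbove (fun _ : Fin (N + 1) ↦ ℂ) (Fin.last N)).symm
  have h2 := h1.comp (Measure.measurePreserving_swap (μ := (volume : Measure (Fin N → ℂ)))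
    (ν := (volume : Measure ℂ)))
  have hfun : ⇑(snocEquiv N) =
      (MeasurableEquiv.piFinSuccAbove (fun _ : Fin (N + 1) ↦ ℂ) (Fin.last N)).symm ∘
        Prod.swap := by
    ext q i
    refine Fin.lastCases ?_ (fun j ↦ ?_) i <;>
      simp [MeasurableEquiv.piFinSuccAbove, Fin.insertNthEquiv]
  rw [hfun]
  exact h2

lemma blockNorm_append_left {M k a b : ℕ} (hb : b ≤ M) (q : (Fin M → ℂ) × (Fin k → ℂ)) :
    blockNorm a b (appendEquiv M k q) = blockNorm a b q.1 := by
  unfold blockNorm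
  congr 1
  rw [Finset.sum_filter, Finset.sum_filter, Fin.sum_univ_add]
  simp only [appendEquiv_castAdd, appendEquiv_natAdd, Fin.val_castAdd, Fin.val_natAdd]
  rw [add_eq_left]
  refine Finset.sum_eq_zero fun i _ ↦ if_neg ?_
  omega

lemma blockNorm_append_right {M k : ℕ} (q : (Fin M → ℂ) × (Fin k → ℂ)) :
    blockNorm M (M + k) (appendEquiv M k q) = √(normSq q.2) := by
  unfold blockNorm normSq
  congr 1
  rw [Finset.sum_filter, Fin.sum_univ_add]
  simp only [appendEquiv_castAdd, appendEquiv_natAdd, Fin.val_castAdd, Fin.val_natAdd]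
  rw [Finset.sum_eq_zero (fun i _ ↦ if_neg (by have := i.2; omega)), zero_add]
  exact Finset.sum_congr rfl fun i _ ↦ if_pos (by have := i.2; omega)

lemma blockNorm_snoc {N a b : ℕ} (hb : b ≤ N) (q : (Fin N → ℂ) × ℂ) :
    blockNorm a b (snocEquiv N q) = blockNorm a b q.1 := by
  unfold blockNorm
  congr 1
  rw [Finset.sum_filter, Finset.sum_filter, Fin.sum_univ_castSucc]
  simp only [snocEquiv_castSucc, Fin.val_castSucc, Fin.val_last]
  rw [if_neg (by omega), add_zero]

lemma blockStart_castSucc {l : ℕ} (κ : Fin (l + 1) → ℕ) (j : Fin l) :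
    blockStart κ j.castSucc = blockStart (fun s : Fin l ↦ κ s.castSucc) j := by
  unfold blockStart
  rw [← Fin.map_castSuccEmb_Iio, Finset.sum_map]
  rfl

lemma blockStart_last {l : ℕ} (κ : Fin (l + 1) → ℕ) :
    blockStart κ (Fin.last l) = ∑ s : Fin l, κ s.castSucc := by
  unfold blockStart
  rw [Fin.Iio_last_eq_map, Finset.sum_map]
  rfl

lemma blockStart_add_le {l : ℕ} (κ : Fin l → ℕ) (j : Fin l) :
    blockStart κ j + κ j ≤ ∑ s, κ s := by
  unfold blockStart
  rw [add_comm, ← Finset.sum_insert (by simp)]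
  exact Finset.sum_le_sum_of_subset (Finset.subset_univ _)

/-- The product of the unit balls of the blocks of coordinates. -/
def ballProduct {l : ℕ} (κ : Fin l → ℕ) (M : ℕ) : Set (Fin M → ℂ) :=
  {z | ∀ j, blockNorm (blockStart κ j) (blockStart κ j + κ j) z < 1}

lemma isOpen_ballProduct {l : ℕ} (κ : Fin l → ℕ) (M : ℕ) : IsOpen (ballProduct κ M) := by
  simp only [ballProduct, Set.ofPred_forall]
  exact isOpen_iInter_of_finite fun j ↦ isOpen_lt (continuous_blockNorm _ _) continuous_const

/-- The one-point space `ℂ⁰`, as the empty product of balls, has volume `1` and Bergman kernel `1`. -/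
lemma hasSchurKernel_point {p q : ℝ} : HasSchurKernel (Set.univ : Set (Fin 0 → ℂ)) p q := by
  have hvol : (volume : Measure (Fin 0 → ℂ)) Set.univ = 1 := by
    rw [volume_pi, Measure.pi_of_empty]
    simp
  have hprob : IsProbabilityMeasure (volume : Measure (Fin 0 → ℂ)) := ⟨hvol⟩
  refine ⟨fun _ _ ↦ 1, fun _ ↦ 1, ⟨isOpen_univ, measurable_const, by simp,
    fun _ _ ↦ differentiableOn_const 1, fun _ _ ↦ memLp_const 1, fun F _ _ z _ ↦ ?_⟩,
    ⟨measurable_const, by simp, by simp, ⟨1, by simp⟩, ⟨1, by simp⟩⟩⟩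
  have h : ∀ ζ, F ζ = F z := fun ζ ↦ congrArg F (Subsingleton.elim _ _)
  simp [h]

lemma hasSchurKernel_ballProduct {p q : ℝ} (hpq : p.HolderConjugate q) :
    ∀ (l : ℕ) (κ : Fin l → ℕ), (∀ j, 1 ≤ κ j) → ∀ M : ℕ, M = ∑ s, κ s →
      HasSchurKernel (ballProduct κ M) p q := by
  intro l
  induction l with
  | zero =>
    rintro κ - M rfl
    have h : ballProduct κ (∑ s, κ s) = Set.univ := by
      ext z
      simp [ballProduct]
    rw [h]
    exact hasSchurKernel_point
  | succ l ih =>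
    rintro κ hκ M hM
    obtain ⟨m, hm⟩ : ∃ m, κ (Fin.last l) = m + 1 :=
      ⟨κ (Fin.last l) - 1, by have := hκ (Fin.last l); omega⟩
    rw [Fin.sum_univ_castSucc, hm] at hM
    subst hM
    set M' := ∑ s : Fin l, κ s.castSucc with hM'
    refine HasSchurKernel.of_preimage (appendEquiv M' (m + 1))
      (measurePreserving_appendEquiv _ _) (isOpen_ballProduct κ _) ?_
    have h := (ih (fun s ↦ κ s.castSucc) (fun j ↦ hκ _) M' rfl).prod hpq.pos.le hpq.symm.pos.le
      (hasSchurKernel_ball hpq m)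
    suffices hset : appendEquiv M' (m + 1) ⁻¹' ballProduct κ (M' + (m + 1)) =
        ballProduct (fun s ↦ κ s.castSucc) M' ×ˢ sqBall (m + 1) 1 by
      rw [hset]
      exact h
    ext x
    simp only [ballProduct, Set.mem_preimage, Set.mem_ofPred_eq, Set.mem_prod]
    rw [Fin.forall_fin_succ']
    refine and_congr (forall_congr' fun j ↦ ?_) ?_
    · rw [blockStart_castSucc, blockNorm_append_left (blockStart_add_le _ j)]
    · rw [blockStart_last, hm, ← hM', blockNorm_append_right]
      simp only [sqBall, Set.mem_ofPred_eq]
      rw [Real.sqrt_lt' one_pos, one_pow]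

/-- With a single coordinate after the blocks, the standard model is the cone over a product of balls. -/
lemma preimage_standardModel_base {l : ℕ} (hl : 1 ≤ l) (κ : Fin l → ℕ) {N : ℕ}
    (hN : N = ∑ s, κ s) :
    snocEquiv N ⁻¹' (standardModel (N + 1) κ : Set (Fin (N + 1) → ℂ)) =
      cone (ballProduct κ N) := by
  ext ⟨z, ξ⟩
  have hle : ∀ j, blockStart κ j + κ j ≤ N := fun j ↦ hN ▸ blockStart_add_le κ j
  have hmem : (snocEquiv N (z, ξ) ∈ standardModel (N + 1) κ) ↔
      (∀ j, blockNorm (blockStart κ j) (blockStart κ j + κ j) z < ‖ξ‖) ∧ ‖ξ‖ < 1 := by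
    constructor
    · rintro ⟨h1, -, h3⟩
      refine ⟨fun j ↦ ?_, by simpa using h3 (Fin.last N) (by simp)⟩
      have := h1 (Fin.last N) (by simp [hN]) j
      rwa [blockNorm_snoc (hle j), snocEquiv_last] at this
    · rintro ⟨h1, h2⟩
      have hlast : ∀ i : Fin (N + 1), (i : ℕ) = N → i = Fin.last N := fun i hi ↦ Fin.ext hi
      refine ⟨fun i hi j ↦ ?_, fun i j hi hj ↦ ?_, fun i hi ↦ ?_⟩
      · rw [hlast i (hi.trans hN.symm), blockNorm_snoc (hle j), snocEquiv_last]
        exact h1 j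
      · have := j.2
        omega
      · rw [hlast i (by omega), snocEquiv_last]
        exact h2
  rw [Set.mem_preimage, SetLike.mem_coe, hmem]
  simp only [cone, puncturedDisc, ballProduct, Set.mem_ofPred_eq, blockNorm_smul, norm_inv]
  constructor
  · rintro ⟨h1, h2⟩
    have h0 : 0 < ‖ξ‖ := (blockNorm_nonneg _ _ _).trans_lt (h1 ⟨0, hl⟩)
    refine ⟨⟨by simpa using h0, by simpa using h2⟩, fun j ↦ ?_⟩
    rw [inv_mul_lt_one₀ h0]
    exact h1 j
  · rintro ⟨⟨h0, h2⟩, h1⟩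
    have h0' : 0 < ‖ξ‖ := by simpa using h0
    refine ⟨fun j ↦ ?_, by simpa using h2⟩
    rw [← inv_mul_lt_one₀ h0']
    exact h1 j

/-- Each further coordinate replaces the standard model by the cone over it. -/
lemma preimage_standardModel_succ {l : ℕ} (κ : Fin l → ℕ) {N : ℕ} (hN : ∑ s, κ s < N) :
    snocEquiv N ⁻¹' (standardModel (N + 1) κ : Set (Fin (N + 1) → ℂ)) =
      cone (standardModel N κ : Set (Fin N → ℂ)) := by
  ext ⟨z, ξ⟩
  have hle : ∀ j, blockStart κ j + κ j ≤ N := fun j ↦ (blockStart_add_le κ j).trans hN.le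
  have hmem : (snocEquiv N (z, ξ) ∈ standardModel (N + 1) κ) ↔
      (∀ i : Fin N, (i : ℕ) = ∑ s, κ s → ∀ j : Fin l,
        blockNorm (blockStart κ j) (blockStart κ j + κ j) z < ‖z i‖) ∧
      ((∀ i j : Fin N, ∑ s, κ s ≤ (i : ℕ) → (j : ℕ) = i + 1 → ‖z i‖ < ‖z j‖) ∧
        ∀ i : Fin N, (i : ℕ) + 1 = N → ‖z i‖ < ‖ξ‖) ∧ ‖ξ‖ < 1 := by
    constructor
    · rintro ⟨h1, h2, h3⟩
      refine ⟨fun i hi j ↦ ?_, ⟨fun i j hi hj ↦ ?_, fun i hi ↦ ?_⟩,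
        by simpa using h3 (Fin.last N) (by simp)⟩
      · simpa [blockNorm_snoc (hle j)] using h1 i.castSucc (by simpa using hi) j
      · simpa using h2 i.castSucc j.castSucc (by simpa using hi) (by simpa using hj)
      · simpa using h2 i.castSucc (Fin.last N) (by simp; omega) (by simp; omega)
    · rintro ⟨h1, ⟨h2, h3⟩, h4⟩
      refine ⟨fun i ↦ ?_, fun i j ↦ ?_, fun i ↦ ?_⟩
      · refine Fin.lastCases (fun hi ↦ ?_) (fun i hi j ↦ ?_) i
        · rw [Fin.val_last] at hi
          omega
        · simpa [blockNorm_snoc (hle j)] using h1 i (by simpa using hi) j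
      · refine Fin.lastCases (fun hi hj ↦ ?_) (fun i ↦ ?_) i
        · have := j.2
          rw [Fin.val_last] at hj
          omega
        · refine Fin.lastCases (fun hi hj ↦ ?_) (fun j hi hj ↦ ?_) j
          · rw [Fin.val_last, Fin.val_castSucc] at hj
            simpa using h3 i hj.symm
          · simpa using h2 i j (by simpa using hi) (by simpa using hj)
      · refine Fin.lastCases (fun _ ↦ by simpa using h4) (fun i hi ↦ ?_) i
        have := i.2
        rw [Fin.val_castSucc] at hi
        omega
  have hmem' : ∀ w : Fin N → ℂ, w ∈ (standardModel N κ : Set (Fin N → ℂ)) ↔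
      (∀ i : Fin N, (i : ℕ) = ∑ s, κ s → ∀ j : Fin l,
        blockNorm (blockStart κ j) (blockStart κ j + κ j) w < ‖w i‖) ∧
      (∀ i j : Fin N, ∑ s, κ s ≤ (i : ℕ) → (j : ℕ) = i + 1 → ‖w i‖ < ‖w j‖) ∧
        ∀ i : Fin N, (i : ℕ) + 1 = N → ‖w i‖ < 1 := fun w ↦ Iff.rfl
  rw [Set.mem_preimage, SetLike.mem_coe, hmem, cone, Set.mem_ofPred_eq, hmem']
  simp only [puncturedDisc, Set.mem_ofPred_eq, blockNorm_smul, norm_inv, Pi.smul_apply,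
    norm_smul]
  have hiff : ∀ h0 : 0 < ‖ξ‖, (∀ a b : ℝ, ‖ξ‖⁻¹ * a < ‖ξ‖⁻¹ * b ↔ a < b) ∧
      ∀ a : ℝ, ‖ξ‖⁻¹ * a < 1 ↔ a < ‖ξ‖ := fun h0 ↦
    ⟨fun a b ↦ mul_lt_mul_iff_right₀ (inv_pos.2 h0), fun a ↦ inv_mul_lt_one₀ h0⟩
  constructor
  · rintro ⟨h1, h2, h3⟩
    have h0 : 0 < ‖ξ‖ := (norm_nonneg _).trans_lt (h2.2 ⟨N - 1, by omega⟩ (by simp; omega))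
    simp only [hiff h0]
    exact ⟨⟨by simpa using h0, by simpa using h3⟩, h1, h2⟩
  · rintro ⟨⟨h0, h2⟩, h1⟩
    have h0' : 0 < ‖ξ‖ := by simpa using h0
    simp only [hiff h0'] at h1
    exact ⟨h1.1, h1.2, by simpa using h2⟩

/-- The hypotheses `h1` and `h2` are the condition of `HasSchurKernel.cone` for the last of the cones,
which is the most restrictive one; they say that `2n / (n + 1) < p < 2n / (n - 1)`. -/
theorem hasSchurKernel_standardModel {p q : ℝ} (hpq : p.HolderConjugate q) {l : ℕ} (hl : 1 ≤ l)
    (κ : Fin l → ℕ) (hκ : ∀ j, 1 ≤ κ j) {n : ℕ} (hn : ∑ s, κ s < n)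
    (h1 : ((n : ℝ) - 1) * (p - 1) < n + 1) (h2 : ((n : ℝ) - 1) < (n + 1) * (p - 1)) :
    HasSchurKernel (standardModel n κ : Set (Fin n → ℂ)) p q := by
  obtain ⟨d, rfl⟩ : ∃ d, n = ∑ s, κ s + d + 1 := ⟨n - (∑ s, κ s) - 1, by omega⟩
  have hp : 1 < p := hpq.lt
  -- the two conditions on the exponent are inherited by the lower dimensions
  have hlow : ∀ N : ℕ, N ≤ ∑ s, κ s + d →
      (N : ℝ) * (p - 1) < N + 2 ∧ (N : ℝ) < (N + 2) * (p - 1) := by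
    intro N hN
    have hN' : (N : ℝ) ≤ ((∑ s, κ s + d : ℕ) : ℝ) := by exact_mod_cast hN
    have h0 : (0 : ℝ) ≤ N := by positivity
    rw [Nat.cast_succ] at h1 h2
    set A : ℝ := ((∑ s, κ s + d : ℕ) : ℝ)
    constructor
    · rcases le_total p 2 with h | h <;> nlinarith
    · rcases le_total p 2 with h | h <;> nlinarith
  clear h1 h2 hn
  induction d with
  | zero =>
    refine HasSchurKernel.of_preimage (snocEquiv _) (measurePreserving_snocEquiv _)
      (standardModel _ κ).isOpen ?_
    rw [preimage_standardModel_base hl κ rfl]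
    exact (hasSchurKernel_ballProduct hpq l κ hκ _ rfl).cone hpq (hlow _ le_rfl).1
      (hlow _ le_rfl).2
  | succ d ih =>
    refine HasSchurKernel.of_preimage (snocEquiv _) (measurePreserving_snocEquiv _)
      (standardModel _ κ).isOpen ?_
    rw [preimage_standardModel_succ κ (by omega)]
    exact (ih fun N hN ↦ hlow N (by omega)).cone hpq (hlow _ le_rfl).1 (hlow _ le_rfl).2

theorem bergmanProjectionBounded_standardModel {l : ℕ} (hl : 1 ≤ l) (κ : Fin l → ℕ)
    (hκ : ∀ j, 1 ≤ κ j) {n : ℕ} (hn : ∑ s, κ s < n) {p : ℝ} (h1 : 2 * (n : ℝ) / (n + 1) < p)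
    (h2 : p < 2 * (n : ℝ) / (n - 1)) : BergmanProjectionBounded (standardModel n κ) p := by
  have hn2 : 2 ≤ n := by
    have := hκ ⟨0, hl⟩
    have := Finset.single_le_sum (f := κ) (fun _ _ ↦ Nat.zero_le _)
      (Finset.mem_univ (⟨0, hl⟩ : Fin l))
    omega
  have hn2' : (2 : ℝ) ≤ n := by exact_mod_cast hn2
  rw [div_lt_iff₀ (by linarith)] at h1
  rw [lt_div_iff₀ (by linarith)] at h2
  have hp : 1 < p := by nlinarith
  have hpq := Real.HolderConjugate.conjExponent hp
  obtain ⟨K, h, hK, hh⟩ := hasSchurKernel_standardModel hpq hl κ hκ hn (by linarith) (by linarith)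
  exact hK.bergmanProjectionBounded hpq hh

lemma hartogsTriangle_eq_standardModel (n k : ℕ) :
    hartogsTriangle n k = standardModel n (fun _ : Fin 1 ↦ k) := by
  ext z
  simp [hartogsTriangle, standardModel, blockStart]

/-! ### Circle averages on annuli -/

/-- The circle averages of a function that is holomorphic near a closed annulus centred at `0`
agree on the two boundary circles. -/
lemma circleAverage_eq_of_differentiableAt {r R : ℝ} (h0 : 0 < r) (hle : r ≤ R) {φ : ℂ → ℂ}
    (hφ : ∀ c : ℂ, r ≤ ‖c‖ → ‖c‖ ≤ R → DifferentiableAt ℂ φ c) :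
    Real.circleAverage φ 0 r = Real.circleAverage φ 0 R := by
  rw [Real.circleAverage_eq_circleIntegral h0.ne',
    Real.circleAverage_eq_circleIntegral (h0.trans_le hle).ne']
  congr 1
  refine (Complex.circleIntegral_sub_center_inv_smul_eq_of_differentiable_on_annulus_off_countable
    h0 hle Set.countable_empty (fun c hc ↦ ?_) fun c hc ↦ ?_).symm
  · simp only [Set.mem_sdiff, mem_closedBall, mem_ball, dist_zero_right, not_lt] at hc
    exact (hφ c hc.2 hc.1).continuousAt.continuousWithinAt
  · simp only [Set.mem_sdiff, mem_closedBall, mem_ball, dist_zero_right, not_le] at hc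
    exact hφ c hc.1.2.le hc.1.1.le

/-! ### Hartogs domains and the critical monomial -/

/-- A domain of finite volume on which the last coordinate takes its values in the punctured unit
disc, and which is a complex cone except for the bound on the last coordinate. -/
structure IsHartogsDomain {N : ℕ} (D : Set (Fin (N + 1) → ℂ)) : Prop where
  isOpen : IsOpen D
  nonempty : D.Nonempty
  volume_lt_top : volume D < ∞
  last_ne_zero : ∀ z ∈ D, z (Fin.last N) ≠ 0
  norm_last_lt : ∀ z ∈ D, ‖z (Fin.last N)‖ < 1
  smul_mem : ∀ z ∈ D, ∀ c : ℂ, c ≠ 0 → ‖c * z (Fin.last N)‖ < 1 → c • z ∈ D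

/-- The dyadic piece `{2^{-j-1} ≤ |z_n| < 2^{-j}}` of a set, `z_n` being the last coordinate. -/
def shell {N : ℕ} (D : Set (Fin (N + 1) → ℂ)) (j : ℕ) : Set (Fin (N + 1) → ℂ) :=
  {z | z ∈ D ∧ (1 / 2) ^ (j + 1) ≤ ‖z (Fin.last N)‖ ∧ ‖z (Fin.last N)‖ < (1 / 2) ^ j}

/-- The monomial `z_n^{-(n-1)}` in dimension `n = N + 1`. -/
noncomputable def criticalMonomial (N : ℕ) (z : Fin (N + 1) → ℂ) : ℂ :=
  (z (Fin.last N) ^ N)⁻¹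

lemma criticalMonomial_smul {N : ℕ} (c : ℂ) (z : Fin (N + 1) → ℂ) :
    criticalMonomial N (c • z) = (c ^ N)⁻¹ * criticalMonomial N z := by
  simp [criticalMonomial, mul_pow, mul_comm]

lemma measurable_criticalMonomial (N : ℕ) : Measurable (criticalMonomial N) := by
  unfold criticalMonomial
  fun_prop

namespace IsHartogsDomain

variable {N : ℕ} {D : Set (Fin (N + 1) → ℂ)}

lemma differentiableOn_criticalMonomial (hD : IsHartogsDomain D) :
    DifferentiableOn ℂ (criticalMonomial N) D := by
  intro z hz
  have h : z (Fin.last N) ^ N ≠ 0 := pow_ne_zero _ (hD.last_ne_zero z hz)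
  have hd : DifferentiableAt ℂ (fun z : Fin (N + 1) → ℂ ↦ z (Fin.last N) ^ N) z := by fun_prop
  exact (hd.inv h).differentiableWithinAt

lemma measurableSet_shell (hD : IsHartogsDomain D) (j : ℕ) : MeasurableSet (shell D j) := by
  have hc : Continuous fun z : Fin (N + 1) → ℂ ↦ ‖z (Fin.last N)‖ := by fun_prop
  exact hD.isOpen.measurableSet.inter
    ((isClosed_le continuous_const hc).measurableSet.inter
      (isOpen_lt hc continuous_const).measurableSet)

lemma shell_subset (j : ℕ) : shell D j ⊆ D := fun _ hz ↦ hz.1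

lemma disjoint_shell : Pairwise (Function.onFun Disjoint (shell D)) := by
  have key : ∀ i j, i < j → Disjoint (shell D i) (shell D j) := by
    intro i j hij
    refine Set.disjoint_left.2 fun z hi hj ↦ ?_
    have h1 : ((1 : ℝ) / 2) ^ j ≤ (1 / 2) ^ (i + 1) :=
      pow_le_pow_of_le_one (by norm_num) (by norm_num) hij
    exact absurd (hj.2.2.trans_le (h1.trans hi.2.1)) (lt_irrefl _)
  intro i j hij
  rcases hij.lt_or_gt with h | h
  · exact key i j h
  · exact (key j i h).symm

/-- The last coordinate does not vanish on `D`, so the dyadic pieces exhaust `D`. -/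
lemma iUnion_shell (hD : IsHartogsDomain D) : ⋃ j, shell D j = D := by
  refine Set.Subset.antisymm (Set.iUnion_subset fun j ↦ shell_subset j) fun z hz ↦ ?_
  obtain ⟨j, h1, h2⟩ := exists_nat_pow_near_of_lt_one
    (norm_pos_iff.2 (hD.last_ne_zero z hz)) (hD.norm_last_lt z hz).le
    (show (0 : ℝ) < 1 / 2 by norm_num) (by norm_num)
  rcases h2.lt_or_eq with h2 | h2
  · exact Set.mem_iUnion.2 ⟨j, hz, h1.le, h2⟩
  · have hj : j ≠ 0 := by
      rintro rfl
      exact (hD.norm_last_lt z hz).ne (by simpa using h2)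
    obtain ⟨i, rfl⟩ := Nat.exists_eq_succ_of_ne_zero hj
    refine Set.mem_iUnion.2 ⟨i, hz, h2.ge, h2.trans_lt ?_⟩
    exact pow_lt_pow_right_of_lt_one₀ (by norm_num) (by norm_num) i.lt_succ_self

lemma smul_mem_shell_iff (hD : IsHartogsDomain D) (j : ℕ) (u : Fin (N + 1) → ℂ) :
    ((1 / 2 : ℝ) ^ j) • u ∈ shell D j ↔ u ∈ shell D 0 := by
  set r : ℝ := (1 / 2 : ℝ) ^ j with hr
  have hr0 : 0 < r := by positivity
  have hr1 : r ≤ 1 := pow_le_one₀ (by norm_num) (by norm_num)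
  have hrc : (r : ℂ) ≠ 0 := by exact_mod_cast hr0.ne'
  have hn : ‖(r • u) (Fin.last N)‖ = r * ‖u (Fin.last N)‖ := by
    rw [Pi.smul_apply, norm_smul, Real.norm_of_nonneg hr0.le]
  have hb : ((1 / 2) ^ (j + 1) ≤ ‖(r • u) (Fin.last N)‖ ∧ ‖(r • u) (Fin.last N)‖ < (1 / 2) ^ j) ↔
      ((1 / 2) ^ (0 + 1) ≤ ‖u (Fin.last N)‖ ∧ ‖u (Fin.last N)‖ < (1 / 2) ^ 0) := by
    rw [hn, pow_succ, ← hr, mul_le_mul_iff_right₀ hr0, zero_add, pow_one, pow_zero]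
    rw [mul_lt_iff_lt_one_right hr0]
  refine ⟨fun h ↦ ⟨?_, hb.1 h.2⟩, fun h ↦ ⟨?_, hb.2 h.2⟩⟩
  · have h1 := hD.smul_mem _ h.1 (r : ℂ)⁻¹ (inv_ne_zero hrc) ?_
    · rwa [← Complex.coe_smul, smul_smul, inv_mul_cancel₀ hrc, one_smul] at h1
    · have := (hb.1 h.2).2
      rw [norm_mul, hn, norm_inv, Complex.norm_real, Real.norm_of_nonneg hr0.le,
        inv_mul_cancel_left₀ hr0.ne']
      simpa using this
  · rw [← Complex.coe_smul]
    refine hD.smul_mem _ h.1 _ hrc ?_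
    rw [norm_mul, Complex.norm_real, Real.norm_of_nonneg hr0.le]
    have := hD.norm_last_lt u h.1
    nlinarith [norm_nonneg (u (Fin.last N))]

lemma circle_smul_mem_shell_iff (hD : IsHartogsDomain D) (j : ℕ) (c : Circle)
    (z : Fin (N + 1) → ℂ) : (c : ℂ) • z ∈ shell D j ↔ z ∈ shell D j := by
  have key : ∀ (c : Circle) (z : Fin (N + 1) → ℂ), z ∈ shell D j → (c : ℂ) • z ∈ shell D j := by
    intro c z hz
    have hn : ‖((c : ℂ) • z) (Fin.last N)‖ = ‖z (Fin.last N)‖ := by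
      rw [Pi.smul_apply, norm_smul, Circle.norm_coe, one_mul]
    refine ⟨hD.smul_mem z hz.1 _ (Circle.coe_ne_zero c) ?_, by rw [hn]; exact hz.2⟩
    rw [norm_mul, Circle.norm_coe, one_mul]
    exact hD.norm_last_lt z hz.1
  refine ⟨fun h ↦ ?_, key c z⟩
  have := key c⁻¹ _ h
  rwa [smul_smul, ← Circle.coe_mul, inv_mul_cancel, Circle.coe_one, one_smul] at this

/-- Scaling of the `L^p` norms of the critical monomial on the dyadic pieces. -/
lemma lintegral_shell (hD : IsHartogsDomain D) {p : ℝ} (hp : 0 ≤ p) (j : ℕ) :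
    ∫⁻ z in shell D j, ‖criticalMonomial N z‖ₑ ^ p =
      ENNReal.ofReal (2 ^ (N * p - (2 * N + 2))) ^ j *
        ∫⁻ z in shell D 0, ‖criticalMonomial N z‖ₑ ^ p := by
  set r : ℝ := (1 / 2 : ℝ) ^ j with hr
  have hr0 : 0 < r := by positivity
  have hrc : (r : ℂ) ≠ 0 := by exact_mod_cast hr0.ne'
  have hm : Measurable fun z : Fin (N + 1) → ℂ ↦ ‖criticalMonomial N z‖ₑ ^ p :=
    (measurable_criticalMonomial N).enorm.pow_const p
  have hm' : Measurable fun u : Fin (N + 1) → ℂ ↦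
      (shell D j).indicator (fun z ↦ ‖criticalMonomial N z‖ₑ ^ p) ((r : ℂ) • u) :=
    (hm.indicator (hD.measurableSet_shell j)).comp (measurable_const_smul _)
  rw [← lintegral_indicator (hD.measurableSet_shell j),
    ← map_smul_volume_pi hrc _ (hm.indicator (hD.measurableSet_shell j)),
    ← lintegral_indicator (hD.measurableSet_shell 0),
    ← lintegral_const_mul _ (hm.indicator (hD.measurableSet_shell 0)),
    ← lintegral_const_mul _ hm']
  refine lintegral_congr fun u ↦ ?_
  by_cases hu : u ∈ shell D 0
  · have hu' : (r : ℂ) • u ∈ shell D j := by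
      rw [Complex.coe_smul]
      exact (hD.smul_mem_shell_iff j u).2 hu
    rw [Set.indicator_of_mem hu, Set.indicator_of_mem hu', criticalMonomial_smul, enorm_mul,
      ENNReal.mul_rpow_of_nonneg _ _ hp, ← mul_assoc]
    congr 1
    have h1 : ‖(r : ℂ)‖ₑ = ENNReal.ofReal r := by
      rw [← ofReal_norm, Complex.norm_real, Real.norm_of_nonneg hr0.le]
    have h2 : ‖((r : ℂ) ^ N)⁻¹‖ₑ = ENNReal.ofReal ((r ^ N)⁻¹) := by
      rw [← ofReal_norm, norm_inv, norm_pow, Complex.norm_real, Real.norm_of_nonneg hr0.le]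
    rw [h1, h2, ENNReal.ofReal_rpow_of_nonneg (by positivity) hp, ← ENNReal.ofReal_pow hr0.le,
      ← ENNReal.ofReal_mul (by positivity), ← ENNReal.ofReal_pow (by positivity)]
    congr 1
    have h3 : r = (2 : ℝ) ^ (-(j : ℝ)) := by
      rw [Real.rpow_neg (by norm_num), Real.rpow_natCast, hr, one_div, inv_pow]
    rw [h3, ← Real.rpow_natCast (2 ^ (-(j : ℝ))), ← Real.rpow_natCast (2 ^ (-(j : ℝ))),
      ← Real.rpow_mul (by norm_num), ← Real.rpow_mul (by norm_num), ← Real.rpow_neg (by norm_num),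
      ← Real.rpow_mul (by norm_num), ← Real.rpow_add (by norm_num), ← Real.rpow_natCast _ j,
      ← Real.rpow_mul (by norm_num)]
    congr 1
    push_cast
    ring
  · have hu' : (r : ℂ) • u ∉ shell D j := by
      rw [Complex.coe_smul]
      exact fun h ↦ hu ((hD.smul_mem_shell_iff j u).1 h)
    rw [Set.indicator_of_notMem hu, Set.indicator_of_notMem hu', mul_zero, mul_zero]

open scoped Pointwise in
/-- The inner products of a holomorphic function with the critical monomial on the dyadic pieces
form a geometric progression: only the component of degree `-N` of the function counts, by
rotation, and this component is homogeneous. -/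
lemma integral_shell (hD : IsHartogsDomain D) {h : (Fin (N + 1) → ℂ) → ℂ}
    (hh : DifferentiableOn ℂ h D)
    (hint : IntegrableOn (fun z ↦ conj (criticalMonomial N z) * h z) D) (j : ℕ) :
    ∫ z in shell D j, conj (criticalMonomial N z) * h z =
      (1 / 4) ^ j * ∫ z in shell D 0, conj (criticalMonomial N z) * h z := by
  set H : (Fin (N + 1) → ℂ) → ℂ :=
    fun z ↦ Real.circleAverage (fun c ↦ c ^ N * h (c • z)) 0 1 with hH
  have havg : ∀ j, ∫ z in shell D j, conj (criticalMonomial N z) * h z =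
      ∫ z in shell D j, conj (criticalMonomial N z) * H z := by
    intro j
    rw [((rotationInvariant_volume_pi (N + 1)).restrict (hD.measurableSet_shell j)
      (hD.circle_smul_mem_shell_iff j)).integral_eq (hint.mono_set (shell_subset j))]
    congr 1
    ext z
    rw [hH]
    simp only
    rw [← smul_eq_mul (conj (criticalMonomial N z)), ← Real.circleAverage_fun_smul]
    refine Real.circleAverage_congr_sphere fun c hc ↦ ?_
    have hc1 : ‖c‖ = 1 := by simpa using hc
    have hc2 : conj ((c ^ N)⁻¹) = c ^ N := by
      rw [← Complex.inv_eq_conj (by simp [hc1]), inv_inv]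
    simp only [smul_eq_mul]
    rw [criticalMonomial_smul, map_mul, hc2]
    ring
  set r : ℝ := (1 / 2 : ℝ) ^ j with hr
  have hr0 : 0 < r := by positivity
  have hr1 : r ≤ 1 := pow_le_one₀ (by norm_num) (by norm_num)
  have hrc : (r : ℂ) ≠ 0 := by exact_mod_cast hr0.ne'
  have hhom : ∀ u ∈ shell D 0, H (r • u) = ((r : ℂ) ^ N)⁻¹ * H u := by
    intro u hu
    have h1 := circleAverage_mul_right (fun c ↦ c ^ N * h (c • u)) (r : ℂ)
    rw [Complex.norm_real, Real.norm_of_nonneg hr0.le,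
      circleAverage_eq_of_differentiableAt hr0 hr1] at h1
    · rw [hH]
      simp only
      rw [← h1, ← smul_eq_mul ((r : ℂ) ^ N)⁻¹, ← Real.circleAverage_fun_smul]
      congr 1
      ext c
      rw [smul_eq_mul, mul_pow, mul_smul, Complex.coe_smul]
      field_simp
    · intro c hc1 hc2
      have hc0 : c ≠ 0 := norm_pos_iff.1 (hr0.trans_le hc1)
      have hmem : c • u ∈ D := by
        refine hD.smul_mem u hu.1 c hc0 ?_
        rw [norm_mul]
        have := hD.norm_last_lt u hu.1
        nlinarith [norm_nonneg (u (Fin.last N))]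
      have hd : DifferentiableAt ℂ h (c • u) := hh.differentiableAt (hD.isOpen.mem_nhds hmem)
      have hl : DifferentiableAt ℂ (fun c : ℂ ↦ c • u) c := by fun_prop
      exact (differentiableAt_id.pow N).mul (hd.comp c hl)
  have hset : r • shell D 0 = shell D j := by
    ext z
    rw [Set.mem_smul_set_iff_inv_smul_mem₀ hr0.ne', ← hD.smul_mem_shell_iff j, ← hr,
      smul_inv_smul₀ hr0.ne']
  have hscale := Measure.setIntegral_comp_smul (volume : Measure (Fin (N + 1) → ℂ))
    (fun z ↦ conj (criticalMonomial N z) * H z) (shell D 0) hr0.ne'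
  rw [hset] at hscale
  have hfin : Module.finrank ℝ (Fin (N + 1) → ℂ) = 2 * N + 2 := by
    rw [Module.finrank_pi_fintype]
    simp
    ring
  rw [hfin, abs_of_pos (by positivity), Complex.real_smul] at hscale
  have hcongr : ∫ u in shell D 0, conj (criticalMonomial N (r • u)) * H (r • u) =
      ∫ u in shell D 0, ((r : ℂ) ^ (2 * N))⁻¹ * (conj (criticalMonomial N u) * H u) := by
    refine setIntegral_congr_fun (hD.measurableSet_shell 0) fun u hu ↦ ?_
    rw [hhom u hu, ← Complex.coe_smul, criticalMonomial_smul, map_mul, map_inv₀, map_pow,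
      Complex.conj_ofReal, two_mul, pow_add, mul_inv]
    ring
  rw [hcongr, integral_const_mul] at hscale
  rw [havg, havg 0]
  have h4 : ((1 : ℂ) / 4) ^ j = (r : ℂ) ^ 2 := by
    rw [hr]
    push_cast
    rw [← pow_mul, mul_comm, pow_mul]
    norm_num
  rw [h4]
  have hrN : (r : ℂ) ^ (2 * N) ≠ 0 := pow_ne_zero _ hrc
  push_cast at hscale
  rw [pow_add] at hscale
  field_simp at hscale
  rw [← hscale, mul_comm]

end IsHartogsDomain

/-! ### Unboundedness on Hartogs domains -/

/-- The test function `∑_{j < J} 4^j 1_{S_j} e`, where `S_j` are the dyadic pieces of `D` and `e` is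
the critical monomial. -/
noncomputable def testFunction {N : ℕ} (D : Set (Fin (N + 1) → ℂ)) (J : ℕ)
    (z : Fin (N + 1) → ℂ) : ℂ :=
  ∑ j ∈ Finset.range J, (shell D j).indicator (fun z ↦ 4 ^ j * criticalMonomial N z) z

lemma testFunction_of_mem {N : ℕ} {D : Set (Fin (N + 1) → ℂ)} (J : ℕ) {i : ℕ}
    {z : Fin (N + 1) → ℂ} (hz : z ∈ shell D i) :
    testFunction D J z = if i < J then 4 ^ i * criticalMonomial N z else 0 := by
  have hne : ∀ j, j ≠ i → (shell D j).indicator (fun z ↦ 4 ^ j * criticalMonomial N z) z = 0 :=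
    fun j hj ↦ Set.indicator_of_notMem
      (fun hz' ↦ Set.disjoint_left.1 (IsHartogsDomain.disjoint_shell hj) hz' hz) _
  unfold testFunction
  split_ifs with h
  · rw [Finset.sum_eq_single i (fun j _ hj ↦ hne j hj) (by simp [h]), Set.indicator_of_mem hz]
  · refine Finset.sum_eq_zero fun j hj ↦ hne j ?_
    rw [Finset.mem_range] at hj
    omega

namespace IsHartogsDomain

variable {N : ℕ} {D : Set (Fin (N + 1) → ℂ)}

lemma measurable_testFunction (hD : IsHartogsDomain D) (J : ℕ) :
    Measurable (testFunction D J) :=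
  Finset.measurable_sum _ fun j _ ↦
    ((measurable_criticalMonomial N).const_mul _).indicator (hD.measurableSet_shell j)

lemma lintegral_eq_tsum (hD : IsHartogsDomain D) (g : (Fin (N + 1) → ℂ) → ℝ≥0∞) :
    ∫⁻ z in D, g z = ∑' j, ∫⁻ z in shell D j, g z := by
  conv_lhs => rw [← hD.iUnion_shell]
  exact lintegral_iUnion hD.measurableSet_shell disjoint_shell g

lemma lintegral_shell_zero_lt_top (hD : IsHartogsDomain D) {p : ℝ} (hp : 0 ≤ p) :
    ∫⁻ z in shell D 0, ‖criticalMonomial N z‖ₑ ^ p < ∞ := by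
  calc ∫⁻ z in shell D 0, ‖criticalMonomial N z‖ₑ ^ p
      ≤ ∫⁻ z in shell D 0, ENNReal.ofReal (2 ^ N) ^ p := by
        refine setLIntegral_mono' (hD.measurableSet_shell 0) fun z hz ↦ ?_
        refine ENNReal.rpow_le_rpow ?_ hp
        rw [← ofReal_norm]
        refine ENNReal.ofReal_le_ofReal ?_
        have h1 : 1 / 2 ≤ ‖z (Fin.last N)‖ := by simpa using hz.2.1
        rw [criticalMonomial, norm_inv, norm_pow, ← inv_pow]
        refine pow_le_pow_left₀ (by positivity) ?_ N
        rw [inv_le_comm₀ (by linarith) (by norm_num)]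
        linarith
    _ = ENNReal.ofReal (2 ^ N) ^ p * volume (shell D 0) := setLIntegral_const _ _
    _ < ∞ := ENNReal.mul_lt_top (ENNReal.rpow_lt_top_of_nonneg hp ENNReal.ofReal_ne_top)
        ((measure_mono (shell_subset 0)).trans_lt hD.volume_lt_top)

lemma volume_shell_zero_pos (hD : IsHartogsDomain D) : 0 < volume (shell D 0) := by
  obtain ⟨z, hz⟩ := hD.nonempty
  have hz0 := hD.last_ne_zero z hz
  set c : ℂ := 3 / 4 / z (Fin.last N) with hc
  have hcz : c * z (Fin.last N) = 3 / 4 := div_mul_cancel₀ _ hz0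
  have hU : IsOpen (D ∩ {z | 1 / 2 < ‖z (Fin.last N)‖}) :=
    hD.isOpen.inter (isOpen_lt continuous_const (by fun_prop))
  have hsub : D ∩ {z | 1 / 2 < ‖z (Fin.last N)‖} ⊆ shell D 0 := fun w hw ↦
    ⟨hw.1, by simpa using (show 1 / 2 < ‖w (Fin.last N)‖ from hw.2).le,
      by simpa using hD.norm_last_lt w hw.1⟩
  refine (hU.measure_pos volume ⟨c • z, hD.smul_mem z hz c ?_ ?_, ?_⟩).trans_le
    (measure_mono hsub)
  · exact div_ne_zero (by norm_num) hz0
  · rw [hcz]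
    norm_num
  · rw [Set.mem_ofPred_eq, Pi.smul_apply, smul_eq_mul, hcz]
    norm_num

lemma lintegral_shell_zero_pos (hD : IsHartogsDomain D) (p : ℝ) :
    0 < ∫⁻ z in shell D 0, ‖criticalMonomial N z‖ₑ ^ p := by
  rw [setLIntegral_pos_iff ((measurable_criticalMonomial N).enorm.pow_const p)]
  refine hD.volume_shell_zero_pos.trans_le (measure_mono fun z hz ↦ ⟨?_, hz⟩)
  have h0 : criticalMonomial N z ≠ 0 :=
    inv_ne_zero (pow_ne_zero _ (hD.last_ne_zero z hz.1))
  exact (ENNReal.rpow_pos (enorm_pos.2 h0) enorm_ne_top).ne'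

/-- The critical monomial belongs to `A²(D)`, as `|e|²` decays by the factor `1/4` from one dyadic
piece to the next. -/
lemma memLp_criticalMonomial (hD : IsHartogsDomain D) :
    MemLp (criticalMonomial N) 2 (volume.restrict D) := by
  refine memLp_two_iff.2 ⟨(measurable_criticalMonomial N).aestronglyMeasurable, ?_⟩
  have h1 := hD.lintegral_eq_tsum fun z ↦ ‖criticalMonomial N z‖ₑ ^ (2 : ℝ)
  have h2 : ∀ j, ∫⁻ z in shell D j, ‖criticalMonomial N z‖ₑ ^ (2 : ℝ) =
      ENNReal.ofReal (1 / 4) ^ j * ∫⁻ z in shell D 0, ‖criticalMonomial N z‖ₑ ^ (2 : ℝ) := by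
    intro j
    rw [hD.lintegral_shell zero_le_two]
    congr 3
    rw [show (N : ℝ) * 2 - (2 * N + 2) = -2 by ring, Real.rpow_neg (by norm_num)]
    norm_num
  rw [tsum_congr h2, ENNReal.tsum_mul_right, ENNReal.tsum_geometric] at h1
  simp only [ENNReal.rpow_two] at h1
  rw [h1]
  refine ENNReal.mul_lt_top ?_ ?_
  · rw [ENNReal.inv_lt_top, tsub_pos_iff_lt, ENNReal.ofReal_lt_one]
    norm_num
  · simpa only [ENNReal.rpow_two] using hD.lintegral_shell_zero_lt_top zero_le_two

/-- The dyadic pieces contribute a geometric progression, whose ratio is at most `1` if and only if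
`p ≤ 2n / (n + 1)`, for `n = N + 1`. -/
lemma lintegral_testFunction (hD : IsHartogsDomain D) {p : ℝ} (hp : 0 < p) (J : ℕ) :
    ∫⁻ z in D, ‖testFunction D J z‖ₑ ^ p =
      (∑ j ∈ Finset.range J, ENNReal.ofReal (2 ^ ((N + 2) * p - (2 * N + 2))) ^ j) *
        ∫⁻ z in shell D 0, ‖criticalMonomial N z‖ₑ ^ p := by
  have hj : ∀ j, ∫⁻ z in shell D j, ‖testFunction D J z‖ₑ ^ p =
      if j < J then ENNReal.ofReal (2 ^ ((N + 2) * p - (2 * N + 2))) ^ j *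
        ∫⁻ z in shell D 0, ‖criticalMonomial N z‖ₑ ^ p else 0 := by
    intro j
    rw [setLIntegral_congr_fun (hD.measurableSet_shell j) (g := fun z ↦
      ‖if j < J then 4 ^ j * criticalMonomial N z else 0‖ₑ ^ p)
      fun z hz ↦ by simp only [testFunction_of_mem J hz]]
    split_ifs with h
    · simp only [enorm_mul, ENNReal.mul_rpow_of_nonneg _ _ hp.le]
      rw [lintegral_const_mul _ ((measurable_criticalMonomial N).enorm.pow_const p),
        hD.lintegral_shell hp.le, ← mul_assoc]
      congr 1
      have h4 : ‖(4 : ℂ) ^ j‖ₑ = ENNReal.ofReal (4 ^ j) := by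
        rw [← ofReal_norm, norm_pow]
        norm_num
      rw [h4, ENNReal.ofReal_rpow_of_nonneg (by positivity) hp.le,
        ← ENNReal.ofReal_pow (by positivity), ← ENNReal.ofReal_mul (by positivity),
        ← ENNReal.ofReal_pow (by positivity)]
      congr 1
      rw [show (4 : ℝ) = 2 ^ (2 : ℝ) by norm_num, ← Real.rpow_natCast, ← Real.rpow_natCast,
        ← Real.rpow_natCast, ← Real.rpow_mul (by norm_num), ← Real.rpow_mul (by norm_num),
        ← Real.rpow_mul (by norm_num), ← Real.rpow_mul (by norm_num),
        ← Real.rpow_add (by norm_num)]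
      congr 1
      ring
    · simp [hp]
  rw [hD.lintegral_eq_tsum]
  simp_rw [hj]
  rw [tsum_eq_sum (s := Finset.range J) fun j hj ↦ if_neg (by simpa using hj), Finset.sum_mul]
  exact Finset.sum_congr rfl fun j hj ↦ if_pos (by simpa using hj)

lemma memLp_testFunction (hD : IsHartogsDomain D) {p : ℝ} (hp : 0 < p) (J : ℕ) :
    MemLp (testFunction D J) (ENNReal.ofReal p) (volume.restrict D) := by
  refine ⟨(hD.measurable_testFunction J).aestronglyMeasurable, ?_⟩
  rw [eLpNorm_lt_top_iff_lintegral_rpow_enorm_lt_top (by simpa using hp) ENNReal.ofReal_ne_top,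
    ENNReal.toReal_ofReal hp.le, hD.lintegral_testFunction hp]
  refine ENNReal.mul_lt_top ?_ (hD.lintegral_shell_zero_lt_top hp.le)
  exact ENNReal.sum_lt_top.2 fun j _ ↦ ENNReal.pow_lt_top ENNReal.ofReal_lt_top

/-- On `A²(D)`, pairing with the test function is a large multiple of pairing with the critical
monomial. -/
lemma integral_testFunction (hD : IsHartogsDomain D) (J : ℕ) {h : (Fin (N + 1) → ℂ) → ℂ}
    (hh : DifferentiableOn ℂ h D) (hh2 : MemLp h 2 (volume.restrict D)) :
    ∫ z in D, conj (testFunction D J z) * h z =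
      (3 / 4 * J) * ∫ z in D, conj (criticalMonomial N z) * h z := by
  have hint : IntegrableOn (fun z ↦ conj (criticalMonomial N z) * h z) D :=
    hD.memLp_criticalMonomial.star.integrable_mul hh2
  have hT : MemLp (testFunction D J) 2 (volume.restrict D) := by
    simpa using hD.memLp_testFunction zero_lt_two J
  have hintT : IntegrableOn (fun z ↦ conj (testFunction D J z) * h z) D :=
    hT.star.integrable_mul hh2
  set I : ℂ := ∫ z in shell D 0, conj (criticalMonomial N z) * h z with hI
  have hsum : ∀ g : (Fin (N + 1) → ℂ) → ℂ, IntegrableOn g D →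
      ∫ z in D, g z = ∑' j, ∫ z in shell D j, g z := by
    intro g hg
    conv_lhs => rw [← hD.iUnion_shell]
    exact integral_iUnion hD.measurableSet_shell disjoint_shell (by rwa [hD.iUnion_shell])
  have h1 : ∫ z in D, conj (criticalMonomial N z) * h z = 4 / 3 * I := by
    rw [hsum _ hint]
    rw [tsum_congr (hD.integral_shell hh hint), tsum_mul_right, tsum_geometric_of_norm_lt_one (by norm_num), ← hI]
    norm_num
  have h2 : ∫ z in D, conj (testFunction D J z) * h z = J * I := by
    rw [hsum _ hintT]
    have hj : ∀ j, ∫ z in shell D j, conj (testFunction D J z) * h z =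
        if j < J then I else 0 := by
      intro j
      rw [setIntegral_congr_fun (hD.measurableSet_shell j) (g := fun z ↦
        (if j < J then 4 ^ j else 0) * (conj (criticalMonomial N z) * h z))]
      · rw [integral_const_mul, hD.integral_shell hh hint, ← mul_assoc]
        split_ifs
        · rw [← mul_pow, hI]
          norm_num
        · simp
      · intro z hz
        simp only [testFunction_of_mem J hz]
        split_ifs
        · rw [map_mul, map_pow, Complex.conj_ofNat, mul_assoc]
        · simp
    simp_rw [hj]
    rw [tsum_eq_sum (s := Finset.range J) fun j hj ↦ if_neg (by simpa using hj),
      Finset.sum_congr rfl fun j hj ↦ if_pos (by simpa using hj)]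
    simp
  rw [h1, h2]
  ring

end IsHartogsDomain

/-- The Bergman projection of the test function is a large multiple of the critical monomial. -/
lemma bergmanProjection_testFunction {N : ℕ} {D : TopologicalSpace.Opens (Fin (N + 1) → ℂ)}
    (hD : IsHartogsDomain (D : Set (Fin (N + 1) → ℂ))) (J : ℕ)
    {f : Lp ℂ 2 (volume.restrict (D : Set (Fin (N + 1) → ℂ)))}
    (hf : f =ᵐ[volume.restrict (D : Set (Fin (N + 1) → ℂ))] testFunction D J) :
    bergmanProjection D f =ᵐ[volume.restrict (D : Set (Fin (N + 1) → ℂ))]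
      fun z ↦ 3 / 4 * J * criticalMonomial N z := by
  set e := hD.memLp_criticalMonomial.toLp with he
  have hee : e =ᵐ[volume.restrict (D : Set (Fin (N + 1) → ℂ))] criticalMonomial N :=
    hD.memLp_criticalMonomial.coeFn_toLp
  have hemem : e ∈ bergmanSpace D := ⟨_, hD.differentiableOn_criticalMonomial, hee⟩
  have hproj : bergmanProjection D f = ((3 / 4 * J : ℝ) : ℂ) • e := by
    refine Submodule.eq_starProjection_of_mem_of_inner_eq_zero
      ((bergmanSpace D).smul_mem _ hemem) fun h hh ↦ ?_
    obtain ⟨H, hH, hhH⟩ := hh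
    have hH2 : MemLp H 2 (volume.restrict (D : Set (Fin (N + 1) → ℂ))) :=
      (memLp_congr_ae hhH).1 (Lp.memLp _)
    have hinner : ∀ (g : Lp ℂ 2 (volume.restrict (D : Set (Fin (N + 1) → ℂ))))
        (G : (Fin (N + 1) → ℂ) → ℂ), g =ᵐ[volume.restrict (D : Set (Fin (N + 1) → ℂ))] G →
        inner ℂ g h = ∫ z in D, conj (G z) * H z := by
      intro g G hg
      rw [L2.inner_def]
      refine integral_congr_ae ?_
      filter_upwards [hg, hhH] with z hz hz'
      rw [hz, hz', RCLike.inner_apply, mul_comm]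
    rw [inner_sub_left, inner_smul_left, hinner f _ hf, hinner e _ hee, Complex.conj_ofReal,
      hD.integral_testFunction J hH hH2]
    push_cast
    ring
  rw [hproj]
  filter_upwards [Lp.coeFn_smul ((3 / 4 * J : ℝ) : ℂ) e, hee] with z hz hz'
  rw [hz, Pi.smul_apply, hz', smul_eq_mul]
  push_cast
  ring

/-- The projection of the test function has `L^p` norm of order `J`, whereas the `L^p` norm of the test
function is of order at most `J^{1/p}`, and bounded if `p = 1`. -/
theorem IsHartogsDomain.not_bergmanProjectionBounded {N : ℕ} (hN : 1 ≤ N)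
    {D : TopologicalSpace.Opens (Fin (N + 1) → ℂ)}
    (hD : IsHartogsDomain (D : Set (Fin (N + 1) → ℂ))) {p : ℝ} (hp1 : 1 ≤ p)
    (hp2 : (N + 2) * p ≤ 2 * N + 2) : ¬ BergmanProjectionBounded D p := by
  rintro ⟨C, hC⟩
  have hp : 0 < p := by linarith
  have hp0 : ENNReal.ofReal p ≠ 0 := by simpa using hp
  have hpt : (ENNReal.ofReal p).toReal = p := ENNReal.toReal_ofReal hp.le
  set ω : ℝ := 2 ^ ((N + 2) * p - (2 * N + 2)) with hω
  have hω0 : 0 < ω := by positivity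
  set a := ∫⁻ z in shell (D : Set (Fin (N + 1) → ℂ)) 0, ‖criticalMonomial N z‖ₑ ^ p with ha
  have ha0 : a ≠ 0 := (hD.lintegral_shell_zero_pos p).ne'
  have hat : a ≠ ∞ := (hD.lintegral_shell_zero_lt_top hp.le).ne
  -- the estimate `(3J/4)^p ‖e‖_p^p ≤ C^p ‖f‖_p^p`, restricted on the left to one dyadic piece
  have key : ∀ J : ℕ, (3 / 4 * J : ℝ) ^ p ≤ (C : ℝ) ^ p * ∑ j ∈ Finset.range J, ω ^ j := by
    intro J
    have hT : MemLp (testFunction (D : Set (Fin (N + 1) → ℂ)) J) 2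
        (volume.restrict (D : Set (Fin (N + 1) → ℂ))) := by
      simpa using hD.memLp_testFunction zero_lt_two J
    have hf := hT.coeFn_toLp
    have h1 := (hC hT.toLp ((memLp_congr_ae hf).2 (hD.memLp_testFunction hp J))).2
    rw [eLpNorm_congr_ae hf, eLpNorm_congr_ae (bergmanProjection_testFunction hD J hf),
      eLpNorm_eq_lintegral_rpow_enorm_toReal hp0 ENNReal.ofReal_ne_top,
      eLpNorm_eq_lintegral_rpow_enorm_toReal hp0 ENNReal.ofReal_ne_top, hpt] at h1
    have h2 := ENNReal.rpow_le_rpow h1 hp.le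
    rw [ENNReal.mul_rpow_of_nonneg _ _ hp.le, ← ENNReal.rpow_mul, ← ENNReal.rpow_mul,
      one_div_mul_cancel hp.ne', ENNReal.rpow_one, ENNReal.rpow_one,
      hD.lintegral_testFunction hp, ← hω, ← ha, ← mul_assoc] at h2
    have h3 : ENNReal.ofReal (3 / 4 * J) ^ p * a ≤
        ∫⁻ z in (D : Set (Fin (N + 1) → ℂ)), ‖3 / 4 * J * criticalMonomial N z‖ₑ ^ p := by
      refine le_trans (le_of_eq ?_) (lintegral_mono_set (IsHartogsDomain.shell_subset 0))
      rw [ha, ← lintegral_const_mul _ ((measurable_criticalMonomial N).enorm.pow_const p)]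
      refine lintegral_congr fun z ↦ ?_
      rw [enorm_mul, ENNReal.mul_rpow_of_nonneg _ _ hp.le]
      congr 2
      rw [← ofReal_norm]
      congr 1
      simp
    have h4 := (ENNReal.mul_le_mul_iff_left ha0 hat).1 (h3.trans h2)
    have h5 : (∑ j ∈ Finset.range J, ENNReal.ofReal ω ^ j) =
        ENNReal.ofReal (∑ j ∈ Finset.range J, ω ^ j) := by
      rw [ENNReal.ofReal_sum_of_nonneg fun j _ ↦ by positivity]
      exact Finset.sum_congr rfl fun j _ ↦ (ENNReal.ofReal_pow hω0.le j).symm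
    rw [h5, ENNReal.ofReal_rpow_of_nonneg (by positivity) hp.le, ← ENNReal.ofReal_coe_nnreal,
      ENNReal.ofReal_rpow_of_nonneg (by positivity) hp.le, ← ENNReal.ofReal_mul (by positivity),
      ENNReal.ofReal_le_ofReal_iff (by positivity)] at h4
    exact h4
  rcases hp1.eq_or_lt with rfl | hp1
  · -- for `p = 1` the ratio `ω = 2^{-N}` is at most `1/2`
    have hω1 : ω ≤ 1 / 2 := by
      rw [hω, show (1 : ℝ) / 2 = 2 ^ (-1 : ℝ) by norm_num [Real.rpow_neg]]
      refine Real.rpow_le_rpow_of_exponent_le (by norm_num) ?_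
      have : (1 : ℝ) ≤ N := by exact_mod_cast hN
      linarith
    obtain ⟨J, hJ⟩ := exists_nat_gt (4 / 3 * (C * 2 : ℝ))
    have h1 := key J
    have h2 : ∑ j ∈ Finset.range J, ω ^ j ≤ 2 :=
      (Finset.sum_le_sum fun j _ ↦ pow_le_pow_left₀ hω0.le hω1 j).trans (sum_geometric_two_le J)
    rw [Real.rpow_one, Real.rpow_one] at h1
    have h3 := mul_le_mul_of_nonneg_left h2 C.coe_nonneg
    linarith
  · have hω1 : ω ≤ 1 := Real.rpow_le_one_of_one_le_of_nonpos (by norm_num) (by linarith)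
    have h1 : ∀ J : ℕ, 1 ≤ J → (J : ℝ) ^ (p - 1) ≤ (4 / 3 * C : ℝ) ^ p := by
      intro J hJ
      have hJ0 : (0 : ℝ) < J := by exact_mod_cast hJ
      have h2 : ∑ j ∈ Finset.range J, ω ^ j ≤ J := by
        refine (Finset.sum_le_sum fun j _ ↦ pow_le_one₀ hω0.le hω1).trans ?_
        simp
      have h3 := (key J).trans (mul_le_mul_of_nonneg_left h2 (by positivity))
      rw [Real.mul_rpow (by norm_num) hJ0.le] at h3
      rw [Real.rpow_sub_one hJ0.ne', div_le_iff₀ hJ0, Real.mul_rpow (by norm_num) C.coe_nonneg,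
        mul_assoc]
      have h4 : (4 / 3 : ℝ) ^ p * (3 / 4) ^ p = 1 := by
        rw [← Real.mul_rpow (by norm_num) (by norm_num)]
        norm_num
      calc (J : ℝ) ^ p = (4 / 3 : ℝ) ^ p * ((3 / 4) ^ p * (J : ℝ) ^ p) := by
            rw [← mul_assoc, h4, one_mul]
        _ ≤ _ := mul_le_mul_of_nonneg_left h3 (by positivity)
    have ht : Tendsto (fun J : ℕ ↦ (J : ℝ) ^ (p - 1)) atTop atTop :=
      (tendsto_rpow_atTop (sub_pos.2 hp1)).comp tendsto_natCast_atTop_atTop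
    obtain ⟨J, hJ, hJ1⟩ := ((ht.eventually_gt_atTop ((4 / 3 * C : ℝ) ^ p)).and
      (eventually_ge_atTop 1)).exists
    exact absurd (h1 J hJ1) (not_le.2 hJ)

/-! ### The standard model is a Hartogs domain -/

lemma exists_blockStart_le {l : ℕ} (κ : Fin l → ℕ) {i : ℕ} (hi : i < ∑ s, κ s) :
    ∃ j, blockStart κ j ≤ i ∧ i < blockStart κ j + κ j := by
  induction l with
  | zero => simp at hi
  | succ l ih =>
    rw [Fin.sum_univ_castSucc] at hi
    by_cases h : i < ∑ s : Fin l, κ s.castSucc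
    · obtain ⟨j, hj⟩ := ih (fun s ↦ κ s.castSucc) h
      exact ⟨j.castSucc, by rwa [blockStart_castSucc]⟩
    · refine ⟨Fin.last l, ?_⟩
      rw [blockStart_last]
      omega

lemma norm_le_blockNorm {n a b : ℕ} (z : Fin n → ℂ) {i : Fin n} (ha : a ≤ i) (hb : (i : ℕ) < b) :
    ‖z i‖ ≤ blockNorm a b z := by
  refine Real.le_sqrt_of_sq_le ?_
  exact Finset.single_le_sum (f := fun i ↦ ‖z i‖ ^ 2) (fun _ _ ↦ by positivity) (by simp [ha, hb])

/-- The standard model lies in the unit polydisc. -/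
lemma norm_lt_one_of_mem_standardModel {l n : ℕ} {κ : Fin l → ℕ} (hn : ∑ s, κ s < n)
    {z : Fin n → ℂ} (hz : z ∈ standardModel n κ) (i : Fin n) : ‖z i‖ < 1 := by
  obtain ⟨h1, h2, h3⟩ := hz
  have hchain : ∀ d : ℕ, ∀ i : Fin n, (i : ℕ) + d + 1 = n → ∑ s, κ s ≤ i → ‖z i‖ < 1 := by
    intro d
    induction d with
    | zero => exact fun i hi _ ↦ h3 i hi
    | succ d ih =>
      intro i hi hk
      exact (h2 i ⟨i + 1, by omega⟩ hk rfl).trans (ih _ (by simp; omega) (by simp; omega))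
  by_cases hi : ∑ s, κ s ≤ i
  · exact hchain (n - i - 1) i (by omega) hi
  · obtain ⟨j, hj1, hj2⟩ := exists_blockStart_le κ (not_le.1 hi)
    exact ((norm_le_blockNorm z hj1 hj2).trans_lt (h1 ⟨_, hn⟩ rfl j)).trans
      (hchain (n - (∑ s, κ s) - 1) ⟨_, hn⟩ (by simp; omega) le_rfl)

lemma isHartogsDomain_standardModel {l N : ℕ} (hl : 1 ≤ l) {κ : Fin l → ℕ}
    (hn : ∑ s, κ s < N + 1) :
    IsHartogsDomain (standardModel (N + 1) κ : Set (Fin (N + 1) → ℂ)) where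
  isOpen := (standardModel (N + 1) κ).isOpen
  nonempty := by
    -- the coordinates in the blocks vanish, the remaining ones increase
    set w : Fin (N + 1) → ℂ :=
      fun i ↦ if (i : ℕ) < ∑ s, κ s then 0 else (((i + 1 : ℕ) / (N + 2 : ℕ) : ℝ) : ℂ) with hw
    have hnorm : ∀ i : Fin (N + 1), ∑ s, κ s ≤ (i : ℕ) →
        ‖w i‖ = ((i + 1 : ℕ) : ℝ) / ((N + 2 : ℕ) : ℝ) := by
      intro i hi
      simp only [hw]
      rw [if_neg (by omega), Complex.norm_real, Real.norm_of_nonneg (by positivity)]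
    refine ⟨w, fun i hi j ↦ ?_, fun i j hi hj ↦ ?_, fun i hi ↦ ?_⟩
    · have h0 : blockNorm (blockStart κ j) (blockStart κ j + κ j) w = 0 := by
        unfold blockNorm
        rw [Finset.sum_eq_zero, Real.sqrt_zero]
        intro i hi
        have := blockStart_add_le κ j
        rw [Finset.mem_filter] at hi
        simp only [hw]
        rw [if_pos (by omega)]
        simp
      rw [h0, hnorm i hi.ge]
      positivity
    · rw [hnorm i hi, hnorm j (by omega), hj]
      gcongr
      omega
    · rw [hnorm i (by omega), div_lt_one (by positivity)]
      exact_mod_cast (by omega)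
  volume_lt_top := by
    refine (measure_mono fun z hz ↦ ?_).trans_lt (measure_ball_lt_top (x := (0 : Fin (N + 1) → ℂ))
      (r := 1))
    rw [mem_ball_zero_iff, pi_norm_lt_iff one_pos]
    exact norm_lt_one_of_mem_standardModel hn hz
  last_ne_zero := by
    rintro z ⟨h1, h2, -⟩
    refine norm_pos_iff.1 ?_
    rcases (Nat.lt_succ_iff.1 hn).eq_or_lt with h | h
    · exact (blockNorm_nonneg _ _ _).trans_lt (h1 (Fin.last N) h.symm ⟨0, hl⟩)
    · exact (norm_nonneg _).trans_lt
        (h2 ⟨N - 1, by omega⟩ (Fin.last N) (by simp; omega) (by simp; omega))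
  norm_last_lt := fun z hz ↦ hz.2.2 _ rfl
  smul_mem := by
    rintro z ⟨h1, h2, -⟩ c hc hlt
    have hc0 : 0 < ‖c‖ := norm_pos_iff.2 hc
    refine ⟨fun i hi j ↦ ?_, fun i j hi hj ↦ ?_, fun i hi ↦ ?_⟩
    · rw [blockNorm_smul, Pi.smul_apply, norm_smul, mul_lt_mul_iff_right₀ hc0]
      exact h1 i hi j
    · rw [Pi.smul_apply, Pi.smul_apply, norm_smul, norm_smul, mul_lt_mul_iff_right₀ hc0]
      exact h2 i j hi hj
    · rw [show i = Fin.last N from Fin.ext (by simpa using hi)]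
      exact hlt

theorem not_bergmanProjectionBounded_standardModel {l : ℕ} (hl : 1 ≤ l) (κ : Fin l → ℕ)
    (hκ : ∀ j, 1 ≤ κ j) {n : ℕ} (hn : ∑ s, κ s < n) {p : ℝ} (hp1 : 1 ≤ p)
    (hp2 : p ≤ 2 * (n : ℝ) / (n + 1)) : ¬ BergmanProjectionBounded (standardModel n κ) p := by
  have h1 := hκ ⟨0, hl⟩
  have h2 := Finset.single_le_sum (f := κ) (fun _ _ ↦ Nat.zero_le _)
    (Finset.mem_univ (⟨0, hl⟩ : Fin l))
  obtain ⟨N, rfl⟩ : ∃ N, n = N + 1 := ⟨n - 1, by omega⟩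
  refine (isHartogsDomain_standardModel hl hn).not_bergmanProjectionBounded (by omega) hp1 ?_
  rw [le_div_iff₀ (by positivity)] at hp2
  push_cast at hp2
  linarith

end

end HartogsBergman

theorem theorem1p2 (n : ℕ) :
    (∀ k : ℕ, 1 ≤ k → k < n →
      (∀ p : ℝ, 2 * (n : ℝ) / ((n : ℝ) + 1) < p → p < 2 * (n : ℝ) / ((n : ℝ) - 1) →
        HartogsBergman.BergmanProjectionBounded (HartogsBergman.hartogsTriangle n k) p) ∧
      (∀ p : ℝ, 1 ≤ p → p ≤ 2 * (n : ℝ) / ((n : ℝ) + 1) →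
        ¬ HartogsBergman.BergmanProjectionBounded (HartogsBergman.hartogsTriangle n k) p)) ∧
    (∀ (l : ℕ) (κ : Fin l → ℕ), 1 ≤ l → (∀ j, 1 ≤ κ j) → ∑ j, κ j < n →
      (∀ p : ℝ, 2 * (n : ℝ) / ((n : ℝ) + 1) < p → p < 2 * (n : ℝ) / ((n : ℝ) - 1) →
        HartogsBergman.BergmanProjectionBounded (HartogsBergman.standardModel n κ) p) ∧
      (∀ p : ℝ, 1 ≤ p → p ≤ 2 * (n : ℝ) / ((n : ℝ) + 1) →
        ¬ HartogsBergman.BergmanProjectionBounded (HartogsBergman.standardModel n κ) p)) := by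
  have hmodel : ∀ (l : ℕ) (κ : Fin l → ℕ), 1 ≤ l → (∀ j, 1 ≤ κ j) → ∑ j, κ j < n →
      (∀ p : ℝ, 2 * (n : ℝ) / ((n : ℝ) + 1) < p → p < 2 * (n : ℝ) / ((n : ℝ) - 1) →
        HartogsBergman.BergmanProjectionBounded (HartogsBergman.standardModel n κ) p) ∧
      (∀ p : ℝ, 1 ≤ p → p ≤ 2 * (n : ℝ) / ((n : ℝ) + 1) →
        ¬ HartogsBergman.BergmanProjectionBounded (HartogsBergman.standardModel n κ) p) :=
    fun l κ hl hκ hn ↦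
      ⟨fun p h1 h2 ↦ HartogsBergman.bergmanProjectionBounded_standardModel hl κ hκ hn h1 h2,
        fun p h1 h2 ↦
          HartogsBergman.not_bergmanProjectionBounded_standardModel hl κ hκ hn h1 h2⟩
  refine ⟨fun k hk hkn ↦ ?_, hmodel⟩
  rw [HartogsBergman.hartogsTriangle_eq_standardModel]
  exact hmodel 1 (fun _ ↦ k) le_rfl (fun _ ↦ hk) (by simpa using hkn)
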